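/- **Theorem 4.4.** Let $k$ be a field and $G$ a group with unit $e$; all tensor products are over $k$, $\tau$ is the flip and $\iota$ the identity. *Multipliers and modules.* For an algebra $B$ (not necessarily unital) with non-degenerate product, $M(B)$ is its multiplier algebra. Modules over $B$ are assumed unital ($BX=X$) and non-degenerate ($Bx=0$ implies $x=0$); the action of $B$ on $X$ extends to $M(B)$ by $m\cdot(b\cdot x)=(mb)\cdot x$. Homomorphisms $f:B\to M(C)$ with $f(B)C=C=Cf(B)$ are extended to $M(B)\to M(C)$. *Multiplier Hopf $T$-coalgebras.* A multiplier Hopf algebra is an algebra $A$ with non-degenerate product and a homomorphism $\Delta:A\to M(A\otimes A)$ such that $\Delta(a)(1\otimes b)$ and $(a\otimes 1)\Delta(b)$ lie in $A\otimes A$, $\Delta$ is coassociative, $(a\otimes1\otimes1)(\Delta\otimes\iota)(\Delta(b)(1\otimes c))=(\iota\otimes\Delta)((a\otimes1)\Delta(b))(1\otimes1\otimes c)$, and the maps $a\otimes b\mapsto\Delta(a)(1\otimes b)$ and $a\otimes b\mapsto(a\otimes1)\Delta(b)$ are bijections of $A\otimes A$. Its counit $\varepsilon$ is determined by $(\varepsilon\otimes\iota)(\Delta(a)(1\otimes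 b))=ab$ and $(\iota\otimes\varepsilon)((a\otimes1)\Delta(b))=ab$. It is regular if $(A,\tau\circ\Delta)$ is also a multiplier Hopf algebra. Let $A=\bigoplus_{p\in G}A_p$ be a (regular) multiplier Hopf $T$-coalgebra, that is, a regular multiplier Hopf algebra with non-zero subalgebras $A_p$ such that $A$ is their direct sum, $A_pA_q=0$ for $p\ne q$, $\Delta(A_{pq})(1\otimes A_q)=A_p\otimes A_q=(A_p\otimes1)\Delta(A_{pq})$ (linear spans are understood), together with a group homomorphism $\pi$ from $G$ to the algebra automorphisms of $A$ with $\pi_p(A_q)=A_{pqp^{-1}}$, $\Delta\pi_p=(\pi_p\otimes\pi_p)\Delta$ and $\varepsilon\pi_p=\varepsilon$. Let $\Delta_{s,t}:A_{st}\to M(A_s\otimes A_t)$ be the components of $\Delta$. *Crossed modules.* A crossed left $A$-$G$-module $M$ is a family $(M_p)_{p\in G}$ of unital non-degenerate left $A_p$-modules with linear isomorphisms $\pi_{M,q}:M_p\to M_{qpq^{-1}}$ such that $\pi_{M,q}(a\cdot m)=\pi_q(a)\cdot\pi_{M,q}(m)$ and $\pi_{M,p}\pi_{M,q}=\pi_{M,pq}$.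 Morphisms are families of $A_p$-linear maps $f_p:M_p\to N_p$ with $\pi_{N,q}f_p=f_{qpq^{-1}}\pi_{M,q}$. They form a monoidal category with $(M\otimes N)_p=\bigoplus_{st=p}M_s\otimes N_t$, where $a\in A_{st}$ acts on $M_s\otimes N_t$ through $\Delta_{s,t}(a)\in M(A_s\otimes A_t)$ and $\pi_{M\otimes N,q}=\pi_{M,q}\otimes\pi_{N,q}$ on each summand, with unit object $K$, $K_e=k$ (with $a\cdot\kappa=\varepsilon(a)\kappa$ and $\pi_{K,q}=\iota$), $K_p=0$ for $p\neq e$, and with the evident associativity and unit constraints. *The maps $c$.* Let $R=\{R_{p,q}\in M(A_p\otimes A_q)\}_{p,q\in G}$ be a family of multipliers. For crossed modules $M,N$ let $(c_{M,N})_p:(M\otimes N)_p\to(N\otimes M)_p$ be the direct sum over $st=p$ of the maps $$c_{M_s,N_t}:M_s\otimes N_t\to N_{sts^{-1}}\otimes M_s,\qquad c_{M_s,N_t}(m\otimes n)=(\pi_{N,s}\otimes\iota)\,\tau\big(R_{s,t}\cdot(m\otimes n)\big).$$ *Quasitriangular structures.* For $a\in A_{sr}$ put $\widetilde\Delta_{r,s}(a)=(\pi_{s^{-1}}\otimes\iota)\Delta_{srs^{-1},s}(a)\in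 M(A_r\otimes A_s)$. The family $R$ is a quasitriangular structure on $A$ if every $R_{s,t}$ is invertible in $M(A_s\otimes A_t)$ and, for all $q,r,s,t\in G$, 1. $(\pi_q\otimes\pi_q)(R_{s,t})=R_{qsq^{-1},\,qtq^{-1}}$; 2. $R_{s,t}\,\Delta_{s,t}(a)=\tau\big(\widetilde\Delta_{t,s}(a)\big)\,R_{s,t}$ for all $a\in A_{st}$; 3. $(\iota\otimes\Delta_{s,t})(R_{r,st})=(R_{r,t})_{13}(R_{r,s})_{12}$ in $M(A_r\otimes A_s\otimes A_t)$; 4. $(\widetilde\Delta_{r,s}\otimes\iota)(R_{sr,t})=(R_{r,t})_{13}(R_{s,t})_{23}$ in $M(A_r\otimes A_s\otimes A_t)$. Then the maps $c_{M,N}$ form a braiding of the monoidal category of crossed left $A$-$G$-modules (that is, there is a braided structure on this monoidal category whose braiding is $c$) if and only if $R$ is a quasitriangular structure on $A$. -/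

import Mathlib

open TensorProduct DirectSum CategoryTheory

universe u

namespace TCoalg

noncomputable section

set_option linter.unusedSectionVars false

/-! ## Non-degenerate algebras, multiplier algebras, modules -/

section Generic

/-- The product of `B` is non-degenerate. -/
def NondegMul (B : Type*) [NonUnitalRing B] : Prop :=
  (∀ a : B, (∀ b, a * b = 0) → a = 0) ∧ (∀ a : B, (∀ b, b * a = 0) → a = 0)

variable (k : Type*) [Field k]

/-- The multiplier algebra `M(B)`: pairs `(L, R)` of linear maps with `x (L y) = (R x) y`, where
`L` is left multiplication by the multiplier and `R` is right multiplication by it.  The product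
is composition on the first factor and reversed composition on the second one. -/
def multSubalgebra (B : Type*) [NonUnitalRing B] [Module k B] [IsScalarTower k B B]
    [SMulCommClass k B B] : Subalgebra k (Module.End k B × (Module.End k B)ᵐᵒᵖ) where
  carrier := {m | ∀ x y, x * m.1 y = m.2.unop x * y}
  mul_mem' := by
    intro a b ha hb x y
    rw [Set.mem_ofPred_eq] at ha hb
    simp [ha, hb]
  add_mem' := by
    intro a b ha hb x y
    rw [Set.mem_ofPred_eq] at ha hb
    simp [ha, hb, mul_add, add_mul]
  algebraMap_mem' := by
    intro c x y
    simp [Module.algebraMap_end_apply, mul_smul_comm, smul_mul_assoc]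

/-- The multiplier algebra `M(B)`. -/
def Mult (B : Type*) [NonUnitalRing B] [Module k B] [IsScalarTower k B B]
    [SMulCommClass k B B] := ↥(multSubalgebra k B)

instance (B : Type*) [NonUnitalRing B] [Module k B] [IsScalarTower k B B]
    [SMulCommClass k B B] : Ring (Mult k B) := inferInstanceAs (Ring ↥(multSubalgebra k B))

instance (B : Type*) [NonUnitalRing B] [Module k B] [IsScalarTower k B B]
    [SMulCommClass k B B] : Algebra k (Mult k B) :=
  inferInstanceAs (Algebra k ↥(multSubalgebra k B))

variable {k}
variable {B C D : Type*}
  [NonUnitalRing B] [Module k B] [IsScalarTower k B B] [SMulCommClass k B B]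
  [NonUnitalRing C] [Module k C] [IsScalarTower k C C] [SMulCommClass k C C]
  [NonUnitalRing D] [Module k D] [IsScalarTower k D D] [SMulCommClass k D D]

namespace Mult

/-- Left multiplication `x ↦ m x` of a multiplier on the algebra. -/
def l (m : Mult k B) : B →ₗ[k] B := m.1.1

/-- Right multiplication `x ↦ x m` of a multiplier on the algebra. -/
def r (m : Mult k B) : B →ₗ[k] B := m.1.2.unop

/-- A multiplier from its left and right multiplications. -/
def mk (L R : B →ₗ[k] B) (h : ∀ x y, x * L y = R x * y) : Mult k B :=
  ⟨(L, MulOpposite.op R), h⟩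

theorem l_r (m : Mult k B) (x y : B) : x * m.l y = m.r x * y := m.2 x y

@[simp] theorem l_mk (L R : B →ₗ[k] B) (h) : (mk L R h).l = L := rfl
@[simp] theorem r_mk (L R : B →ₗ[k] B) (h) : (mk L R h).r = R := rfl
@[simp] theorem l_one (x : B) : (1 : Mult k B).l x = x := rfl
@[simp] theorem r_one (x : B) : (1 : Mult k B).r x = x := rfl
@[simp] theorem l_mul (m n : Mult k B) (x : B) : (m * n).l x = m.l (n.l x) := rfl
@[simp] theorem r_mul (m n : Mult k B) (x : B) : (m * n).r x = n.r (m.r x) := rfl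
@[simp] theorem l_zero : (0 : Mult k B).l = 0 := rfl
@[simp] theorem l_add (m n : Mult k B) : (m + n).l = m.l + n.l := rfl
@[simp] theorem r_add (m n : Mult k B) : (m + n).r = m.r + n.r := rfl
@[simp] theorem l_smul (c : k) (m : Mult k B) : (c • m).l = c • m.l := rfl
@[simp] theorem r_smul (c : k) (m : Mult k B) : (c • m).r = c • m.r := rfl

theorem ext_lr {m n : Mult k B} (h : m.l = n.l) (h' : m.r = n.r) : m = n :=
  Subtype.ext (Prod.ext h (MulOpposite.unop_injective h'))

theorem ext_l (hB : NondegMul B) {m n : Mult k B} (h : ∀ x, m.l x = n.l x) : m = n := by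
  refine ext_lr (LinearMap.ext h) (LinearMap.ext fun x => sub_eq_zero.1 (hB.1 _ fun y => ?_))
  rw [sub_mul, ← l_r, ← l_r, h, sub_self]

theorem l_mul_right (hB : NondegMul B) (m : Mult k B) (x y : B) : m.l (x * y) = m.l x * y := by
  refine sub_eq_zero.1 (hB.2 _ fun z => ?_)
  rw [mul_sub, l_r, ← mul_assoc, ← mul_assoc, l_r, sub_self]

theorem r_mul_left (hB : NondegMul B) (m : Mult k B) (x y : B) : m.r (x * y) = x * m.r y := by
  refine sub_eq_zero.1 (hB.1 _ fun z => ?_)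
  rw [sub_mul, ← l_r, mul_assoc, mul_assoc, l_r, sub_self]

/-- The canonical map `B → M(B)`. -/
def incl : B →ₗ[k] Mult k B where
  toFun b := mk (LinearMap.mulLeft k b) (LinearMap.mulRight k b) (by simp [mul_assoc])
  map_add' _ _ := ext_lr (LinearMap.ext fun _ => add_mul _ _ _)
    (LinearMap.ext fun _ => mul_add _ _ _)
  map_smul' _ _ := ext_lr (LinearMap.ext fun _ => smul_mul_assoc _ _ _)
    (LinearMap.ext fun _ => mul_smul_comm _ _ _)

@[simp] theorem incl_l (b x : B) : (incl b : Mult k B).l x = b * x := rfl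
@[simp] theorem incl_r (b x : B) : (incl b : Mult k B).r x = x * b := rfl

theorem incl_mul (a b : B) : (incl (a * b) : Mult k B) = incl a * incl b :=
  ext_lr (by ext; simp [mul_assoc]) (by ext; simp [mul_assoc])

/-- The multiplier `m ⊗ n` of `B ⊗ C`. -/
def tmul (m : Mult k B) (n : Mult k C) : Mult k (B ⊗[k] C) :=
  mk (TensorProduct.map m.l n.l) (TensorProduct.map m.r n.r) (by
    intro x y
    induction x using TensorProduct.induction_on with
    | zero => simp
    | add x x' h h' => simp only [add_mul, map_add, h, h']
    | tmul a b =>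
      induction y using TensorProduct.induction_on with
      | zero => simp
      | add x x' h h' => simp only [mul_add, map_add, h, h']
      | tmul c d => simp [l_r])

@[simp] theorem tmul_l (m : Mult k B) (n : Mult k C) (x : B) (y : C) :
    (tmul m n).l (x ⊗ₜ y) = m.l x ⊗ₜ n.l y := rfl
@[simp] theorem tmul_r (m : Mult k B) (n : Mult k C) (x : B) (y : C) :
    (tmul m n).r (x ⊗ₜ y) = m.r x ⊗ₜ n.r y := rfl

theorem tmul_mul (m m' : Mult k B) (n n' : Mult k C) :
    tmul (m * m') (n * n') = tmul m n * tmul m' n' :=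
  ext_lr (by ext; simp) (by ext; simp)

end Mult

/-- Isomorphisms of (not necessarily unital) algebras. -/
structure AlgIso (k B C : Type*) [Field k] [NonUnitalRing B] [Module k B] [NonUnitalRing C]
    [Module k C] extends B ≃ₗ[k] C where
  map_mul' : ∀ x y, toFun (x * y) = toFun x * toFun y

namespace AlgIso

theorem map_mul (e : AlgIso k B C) (x y : B) :
    e.toLinearEquiv (x * y) = e.toLinearEquiv x * e.toLinearEquiv y := e.map_mul' x y

theorem symm_mul (e : AlgIso k B C) (x y : C) :
    e.toLinearEquiv.symm (x * y) = e.toLinearEquiv.symm x * e.toLinearEquiv.symm y := by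
  apply e.toLinearEquiv.injective
  rw [map_mul]; simp

/-- The identity. -/
def refl (k B : Type*) [Field k] [NonUnitalRing B] [Module k B] : AlgIso k B B where
  toLinearEquiv := LinearEquiv.refl k B
  map_mul' _ _ := rfl

variable {B' C' : Type*}
  [NonUnitalRing B'] [Module k B'] [IsScalarTower k B' B'] [SMulCommClass k B' B']
  [NonUnitalRing C'] [Module k C'] [IsScalarTower k C' C'] [SMulCommClass k C' C']

theorem mul_of_tmul {f : B ⊗[k] C →ₗ[k] D}
    (h : ∀ a b c d, f ((a ⊗ₜ b) * (c ⊗ₜ d)) = f (a ⊗ₜ b) * f (c ⊗ₜ d)) (x y : B ⊗[k] C) :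
    f (x * y) = f x * f y := by
  induction x using TensorProduct.induction_on with
  | zero => simp
  | add x x' h h' => simp only [add_mul, map_add, h, h']
  | tmul a b =>
    induction y using TensorProduct.induction_on with
    | zero => simp
    | add x x' h h' => simp only [mul_add, map_add, h, h']
    | tmul c d => exact h a b c d

/-- The tensor product of two isomorphisms. -/
def tensor (e : AlgIso k B B') (f : AlgIso k C C') : AlgIso k (B ⊗[k] C) (B' ⊗[k] C') where
  toLinearEquiv := TensorProduct.congr e.toLinearEquiv f.toLinearEquiv
  map_mul' := mul_of_tmul (f := (TensorProduct.congr e.toLinearEquiv f.toLinearEquiv).toLinearMap)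
    (by intro a b c d; simp [map_mul])

/-- The flip map. -/
def comm (k B C : Type*) [Field k]
    [NonUnitalRing B] [Module k B] [IsScalarTower k B B] [SMulCommClass k B B]
    [NonUnitalRing C] [Module k C] [IsScalarTower k C C] [SMulCommClass k C C] :
    AlgIso k (B ⊗[k] C) (C ⊗[k] B) where
  toLinearEquiv := TensorProduct.comm k B C
  map_mul' := mul_of_tmul (f := (TensorProduct.comm k B C).toLinearMap)
    (by intro a b c d; simp)

/-- `(B ⊗ C) ⊗ D ≅ B ⊗ (C ⊗ D)`. -/
def assoc (k B C D : Type*) [Field k]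
    [NonUnitalRing B] [Module k B] [IsScalarTower k B B] [SMulCommClass k B B]
    [NonUnitalRing C] [Module k C] [IsScalarTower k C C] [SMulCommClass k C C]
    [NonUnitalRing D] [Module k D] [IsScalarTower k D D] [SMulCommClass k D D] :
    AlgIso k ((B ⊗[k] C) ⊗[k] D) (B ⊗[k] (C ⊗[k] D)) where
  toLinearEquiv := TensorProduct.assoc k B C D
  map_mul' := by
    refine mul_of_tmul (B := B ⊗[k] C) (C := D) (D := B ⊗[k] (C ⊗[k] D))
      (f := (TensorProduct.assoc k B C D).toLinearMap) ?_
    intro a b c d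
    induction a using TensorProduct.induction_on with
    | zero => simp
    | add x x' h h' => simp only [add_mul, map_add, h, h', TensorProduct.add_tmul]
    | tmul a a' =>
      induction c using TensorProduct.induction_on with
      | zero => simp
      | add x x' h h' => simp only [mul_add, map_add, h, h', TensorProduct.add_tmul]
      | tmul c c' => simp

/-- `B ⊗ (C ⊗ D) ≅ C ⊗ (B ⊗ D)`, exchanging the first two factors. -/
def leftComm (k B C D : Type*) [Field k]
    [NonUnitalRing B] [Module k B] [IsScalarTower k B B] [SMulCommClass k B B]
    [NonUnitalRing C] [Module k C] [IsScalarTower k C C] [SMulCommClass k C C]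
    [NonUnitalRing D] [Module k D] [IsScalarTower k D D] [SMulCommClass k D D] :
    AlgIso k (B ⊗[k] (C ⊗[k] D)) (C ⊗[k] (B ⊗[k] D)) where
  toLinearEquiv := TensorProduct.leftComm k B C D
  map_mul' := by
    refine mul_of_tmul (B := B) (C := C ⊗[k] D) (D := C ⊗[k] (B ⊗[k] D))
      (f := (TensorProduct.leftComm k B C D).toLinearMap) ?_
    intro a b c d
    induction b using TensorProduct.induction_on with
    | zero => simp
    | add x x' h h' => simp only [add_mul, map_add, h, h', TensorProduct.tmul_add]
    | tmul a a' =>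
      induction d using TensorProduct.induction_on with
      | zero => simp
      | add x x' h h' => simp only [mul_add, map_add, h, h', TensorProduct.tmul_add]
      | tmul c c' => simp

end AlgIso

/-- The isomorphism `M(B) → M(C)` extending an isomorphism `B ≅ C`. -/
def Mult.congr (e : AlgIso k B C) : Mult k B →ₗ[k] Mult k C where
  toFun m := Mult.mk (e.toLinearMap ∘ₗ m.l ∘ₗ e.toLinearEquiv.symm.toLinearMap)
    (e.toLinearMap ∘ₗ m.r ∘ₗ e.toLinearEquiv.symm.toLinearMap) (by
      intro x y
      apply e.toLinearEquiv.symm.injective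
      rw [e.symm_mul, e.symm_mul]
      simp [Mult.l_r])
  map_add' _ _ := Mult.ext_lr (by ext; simp) (by ext; simp)
  map_smul' _ _ := Mult.ext_lr (by ext; simp) (by ext; simp)

theorem Mult.congr_l (e : AlgIso k B C) (m : Mult k B) (x : C) :
    (Mult.congr e m).l x = e.toLinearEquiv (m.l (e.toLinearEquiv.symm x)) := rfl

theorem Mult.congr_r (e : AlgIso k B C) (m : Mult k B) (x : C) :
    (Mult.congr e m).r x = e.toLinearEquiv (m.r (e.toLinearEquiv.symm x)) := rfl

theorem Mult.congr_mul (e : AlgIso k B C) (m n : Mult k B) :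
    Mult.congr e (m * n) = Mult.congr e m * Mult.congr e n :=
  Mult.ext_lr (by ext; simp [Mult.congr_l]) (by ext; simp [Mult.congr_r])

variable {X Y X' Y' : Type*} [AddCommGroup X] [Module k X] [AddCommGroup Y] [Module k Y]
  [AddCommGroup X'] [Module k X'] [AddCommGroup Y'] [Module k Y']

/-- `act` makes `X` a left `B`-module which is unital (`B X = X`) and non-degenerate (`B x = 0`
only for `x = 0`). -/
structure IsUnitalModule (act : B →ₗ[k] X →ₗ[k] X) : Prop where
  mul_act : ∀ a b x, act (a * b) x = act a (act b x)
  unital : Submodule.span k {y | ∃ b x, act b x = y} = ⊤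
  nondeg : ∀ x, (∀ b, act b x = 0) → x = 0

theorem range_lift_eq {U V W : Type*} [AddCommGroup U] [Module k U] [AddCommGroup V] [Module k V]
    [AddCommGroup W] [Module k W] (f : U →ₗ[k] V →ₗ[k] W) :
    LinearMap.range (TensorProduct.lift f) = Submodule.span k {y | ∃ b x, f b x = y} := by
  rw [LinearMap.range_eq_map, ← TensorProduct.span_tmul_eq_top, Submodule.map_span]
  congr 1
  ext y
  constructor
  · rintro ⟨_, ⟨b, x, rfl⟩, rfl⟩
    exact ⟨b, x, by simp⟩
  · rintro ⟨b, x, rfl⟩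
    exact ⟨_, ⟨b, x, rfl⟩, by simp⟩

/-- The linear map `g` with `g (φ u) = ψ u`, for a surjective map `φ` with `ker φ ≤ ker ψ`. -/
def descend {U V W : Type*} [AddCommGroup U] [Module k U] [AddCommGroup V] [Module k V]
    [AddCommGroup W] [Module k W] (φ : U →ₗ[k] V) (ψ : U →ₗ[k] W)
    (hφ : LinearMap.range φ = ⊤) : V →ₗ[k] W :=
  ψ ∘ₗ (φ.exists_rightInverse_of_surjective hφ).choose

theorem descend_apply {U V W : Type*} [AddCommGroup U] [Module k U] [AddCommGroup V] [Module k V]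
    [AddCommGroup W] [Module k W] (φ : U →ₗ[k] V) (ψ : U →ₗ[k] W)
    (hφ : LinearMap.range φ = ⊤) (h : ∀ u, φ u = 0 → ψ u = 0) (u : U) :
    descend φ ψ hφ (φ u) = ψ u := by
  have hs := (φ.exists_rightInverse_of_surjective hφ).choose_spec
  rw [← sub_eq_zero]
  simp only [descend, LinearMap.comp_apply]
  rw [← map_sub]
  apply h
  rw [map_sub, sub_eq_zero]
  exact LinearMap.congr_fun hs (φ u)

namespace IsUnitalModule

variable {act : B →ₗ[k] X →ₗ[k] X} {act' : C →ₗ[k] Y →ₗ[k] Y} {act₂ : B →ₗ[k] Y →ₗ[k] Y}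

theorem induct (h : IsUnitalModule act) {p : X → Prop} (hact : ∀ b x, p (act b x))
    (hadd : ∀ x y, p x → p y → p (x + y)) (x : X) : p x := by
  have h0 : p 0 := by simpa using hact 0 0
  have hx : x ∈ LinearMap.range (TensorProduct.lift act) := by
    rw [range_lift_eq, h.unital]; trivial
  obtain ⟨u, rfl⟩ := hx
  induction u using TensorProduct.induction_on with
  | zero => simpa using h0
  | tmul b x => exact hact b x
  | add u v hu hv => rw [map_add]; exact hadd _ _ hu hv

/-- The extension of the module structure to the multiplier algebra: `m (b x) = (m b) x`. -/
def ext (h : IsUnitalModule act) (m : Mult k B) : X →ₗ[k] X :=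
  descend (TensorProduct.lift act) (TensorProduct.lift (act ∘ₗ m.l))
    (by rw [range_lift_eq, h.unital])

theorem ext_act (h : IsUnitalModule act) (m : Mult k B) (b : B) (x : X) :
    h.ext m (act b x) = act (m.l b) x := by
  have := descend_apply (TensorProduct.lift act) (TensorProduct.lift (act ∘ₗ m.l))
    (by rw [range_lift_eq, h.unital]) ?_ (b ⊗ₜ x)
  · simpa [ext] using this
  · intro u hu
    refine h.nondeg _ fun c => ?_
    have key : ∀ v : B ⊗[k] X, act c (TensorProduct.lift (act ∘ₗ m.l) v) =
        act (m.r c) (TensorProduct.lift act v) := by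
      intro v
      induction v using TensorProduct.induction_on with
      | zero => simp
      | tmul b x => simp [← h.mul_act, Mult.l_r]
      | add u v hu hv => simp only [map_add, hu, hv]
    rw [key, hu, map_zero]

theorem act_ext (h : IsUnitalModule act) (m : Mult k B) (b : B) (x : X) :
    act b (h.ext m x) = act (m.r b) x := by
  refine h.induct (p := fun x => act b (h.ext m x) = act (m.r b) x) ?_ ?_ x
  · intro c x; rw [ext_act, ← h.mul_act, ← h.mul_act, Mult.l_r]
  · intro x y hx hy; simp only [map_add, hx, hy]

theorem ext_unique (h : IsUnitalModule act) (m : Mult k B) (f : X →ₗ[k] X)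
    (hf : ∀ b x, f (act b x) = act (m.l b) x) (x : X) : h.ext m x = f x := by
  refine h.induct (p := fun x => h.ext m x = f x) ?_ ?_ x
  · intro c x; rw [ext_act, hf]
  · intro x y hx hy; simp only [map_add, hx, hy]

theorem ext_incl (h : IsUnitalModule act) (b : B) (x : X) : h.ext (Mult.incl b) x = act b x :=
  h.ext_unique _ _ (by simp [h.mul_act]) x

theorem ext_one (h : IsUnitalModule act) (x : X) : h.ext 1 x = x :=
  h.ext_unique _ LinearMap.id (by simp) x

theorem ext_mul (h : IsUnitalModule act) (m n : Mult k B) (x : X) :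
    h.ext (m * n) x = h.ext m (h.ext n x) :=
  h.ext_unique _ (h.ext m ∘ₗ h.ext n) (by simp [h.ext_act]) x

theorem ext_add (h : IsUnitalModule act) (m n : Mult k B) : h.ext (m + n) = h.ext m + h.ext n :=
  LinearMap.ext (h.ext_unique _ _ (by simp [h.ext_act]))

theorem ext_smul (h : IsUnitalModule act) (c : k) (m : Mult k B) : h.ext (c • m) = c • h.ext m :=
  LinearMap.ext (h.ext_unique _ _ (by simp [h.ext_act]))

theorem ext_map (h : IsUnitalModule act) (h' : IsUnitalModule act₂) (f : X →ₗ[k] Y)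
    (hf : ∀ b x, f (act b x) = act₂ b (f x)) (m : Mult k B) (x : X) :
    f (h.ext m x) = h'.ext m (f x) := by
  refine h.induct (p := fun x => f (h.ext m x) = h'.ext m (f x)) ?_ ?_ x
  · intro c x; rw [ext_act, hf, hf, ext_act]
  · intro x y hx hy; simp only [map_add, hx, hy]

end IsUnitalModule

theorem tensor_faithful_left {B : Type*} {f : B → X →ₗ[k] X} (hf : ∀ x, (∀ b, f b x = 0) → x = 0)
    (z : X ⊗[k] Y) (hz : ∀ b, TensorProduct.map (f b) LinearMap.id z = 0) : z = 0 := by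
  classical
  let ℬ := Module.Basis.ofVectorSpace k Y
  apply (TensorProduct.equivFinsuppOfBasisRight (M := X) ℬ).injective
  rw [map_zero]
  ext i
  refine hf _ fun b => ?_
  have key : ∀ v : X ⊗[k] Y, f b (TensorProduct.equivFinsuppOfBasisRight ℬ v i) =
      TensorProduct.equivFinsuppOfBasisRight ℬ (TensorProduct.map (f b) LinearMap.id v) i := by
    intro v
    induction v using TensorProduct.induction_on with
    | zero => simp
    | tmul b x => simp
    | add u v hu hv => simp only [map_add, Finsupp.add_apply, hu, hv]
  rw [key, hz]; simp

theorem tensor_faithful_right {C : Type*} {g : C → Y →ₗ[k] Y}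
    (hg : ∀ x, (∀ b, g b x = 0) → x = 0)
    (z : X ⊗[k] Y) (hz : ∀ b, TensorProduct.map LinearMap.id (g b) z = 0) : z = 0 := by
  apply (TensorProduct.comm k X Y).injective
  rw [map_zero]
  refine tensor_faithful_left hg _ fun b => ?_
  rw [TensorProduct.map_comm, hz, map_zero]

theorem tensor_faithful {B C : Type*} {f : B → X →ₗ[k] X} {g : C → Y →ₗ[k] Y}
    (hf : ∀ x, (∀ b, f b x = 0) → x = 0) (hg : ∀ x, (∀ b, g b x = 0) → x = 0)
    (z : X ⊗[k] Y) (hz : ∀ b c, TensorProduct.map (f b) (g c) z = 0) : z = 0 := by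
  refine tensor_faithful_right hg _ fun c => tensor_faithful_left hf _ fun b => ?_
  rw [← LinearMap.comp_apply, ← TensorProduct.map_comp]
  exact hz b c

theorem NondegMul.tensor (hB : NondegMul B) (hC : NondegMul C) : NondegMul (B ⊗[k] C) := by
  constructor
  · intro z hz
    refine tensor_faithful (f := fun b => LinearMap.mulRight k b)
      (g := fun b => LinearMap.mulRight k b) hB.1 hC.1 z fun b c => ?_
    rw [← hz (b ⊗ₜ c)]
    clear hz
    induction z using TensorProduct.induction_on with
    | zero => simp
    | tmul b x => simp
    | add u v hu hv => simp only [map_add, add_mul, hu, hv]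
  · intro z hz
    refine tensor_faithful (f := fun b => LinearMap.mulLeft k b)
      (g := fun b => LinearMap.mulLeft k b) hB.2 hC.2 z fun b c => ?_
    rw [← hz (b ⊗ₜ c)]
    clear hz
    induction z using TensorProduct.induction_on with
    | zero => simp
    | tmul b x => simp
    | add u v hu hv => simp only [map_add, mul_add, hu, hv]

/-- The action of `B ⊗ C` on `X ⊗ Y` with `(b ⊗ c) (x ⊗ y) = b x ⊗ c y`. -/
def tensorAct (act : B →ₗ[k] X →ₗ[k] X) (act' : C →ₗ[k] Y →ₗ[k] Y) :
    B ⊗[k] C →ₗ[k] X ⊗[k] Y →ₗ[k] X ⊗[k] Y :=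
  TensorProduct.lift ((TensorProduct.mapBilinear (.id k) X Y X Y).compl₁₂ act act')

@[simp] theorem tensorAct_tmul (act : B →ₗ[k] X →ₗ[k] X) (act' : C →ₗ[k] Y →ₗ[k] Y) (b : B) (c : C)
    : tensorAct act act' (b ⊗ₜ c) = TensorProduct.map (act b) (act' c) := rfl

theorem IsUnitalModule.tensor {act : B →ₗ[k] X →ₗ[k] X} {act' : C →ₗ[k] Y →ₗ[k] Y}
    (h : IsUnitalModule act) (h' : IsUnitalModule act') :
    IsUnitalModule (tensorAct act act') where
  mul_act := by
    intro a b z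
    induction a using TensorProduct.induction_on with
    | zero => simp
    | add u v hu hv => simp only [map_add, add_mul, hu, hv, LinearMap.add_apply]
    | tmul a a' =>
      induction b using TensorProduct.induction_on with
      | zero => simp
      | add u v hu hv => simp only [map_add, mul_add, hu, hv, LinearMap.add_apply]
      | tmul b b' =>
        induction z using TensorProduct.induction_on with
        | zero => simp
        | add u v hu hv => simp only [map_add, hu, hv]
        | tmul x y => simp [h.mul_act, h'.mul_act]
  unital := by
    rw [eq_top_iff]
    rintro z -
    induction z using TensorProduct.induction_on with
    | zero => exact zero_mem _
    | add u v hu hv => exact add_mem hu hv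
    | tmul x y =>
      refine h.induct (p := fun x => ∀ y, x ⊗ₜ[k] y ∈ _) ?_ ?_ x y
      · intro b x y
        refine h'.induct (p := fun y => act b x ⊗ₜ[k] y ∈ _) ?_ ?_ y
        · intro c y
          exact Submodule.subset_span ⟨b ⊗ₜ c, x ⊗ₜ y, by simp⟩
        · intro y y' hy hy'
          rw [TensorProduct.tmul_add]; exact add_mem hy hy'
      · intro x x' hx hx' y
        rw [TensorProduct.add_tmul]; exact add_mem (hx y) (hx' y)
  nondeg := by
    intro z hz
    exact tensor_faithful (f := fun b => act b) (g := fun b => act' b) h.nondeg h'.nondeg z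
      fun b c => hz (b ⊗ₜ c)

/-- Non-degenerate homomorphisms `f : B → M(C)`, i.e. `f(B) C = C` and `C f(B) = C`. -/
structure NondegHom (k B C : Type*) [Field k]
    [NonUnitalRing B] [Module k B] [IsScalarTower k B B] [SMulCommClass k B B]
    [NonUnitalRing C] [Module k C] [IsScalarTower k C C] [SMulCommClass k C C] where
  /-- the underlying linear map -/
  toLin : B →ₗ[k] Mult k C
  map_mul : ∀ a b, toLin (a * b) = toLin a * toLin b
  span_left : Submodule.span k {y | ∃ b c, (toLin b).l c = y} = ⊤
  span_right : Submodule.span k {y | ∃ b c, (toLin b).r c = y} = ⊤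

namespace NondegHom

/-- `C` as a left `B`-module through `f : B → M(C)`. -/
def leftAct (f : NondegHom k B C) : B →ₗ[k] C →ₗ[k] C where
  toFun b := (f.toLin b).l
  map_add' _ _ := by simp
  map_smul' _ _ := by simp

/-- `C` as a right `B`-module through `f : B → M(C)`. -/
def rightAct (f : NondegHom k B C) : B →ₗ[k] C →ₗ[k] C where
  toFun b := (f.toLin b).r
  map_add' _ _ := by simp
  map_smul' _ _ := by simp

@[simp] theorem leftAct_apply (f : NondegHom k B C) (b : B) : f.leftAct b = (f.toLin b).l := rfl
@[simp] theorem rightAct_apply (f : NondegHom k B C) (b : B) : f.rightAct b = (f.toLin b).r := rfl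

/-- The left multiplication by the extension of `f` to multipliers: `m (f(b) c) = f(m b) c`. -/
def extL (f : NondegHom k B C) (m : Mult k B) : C →ₗ[k] C :=
  descend (TensorProduct.lift f.leftAct) (TensorProduct.lift (f.leftAct ∘ₗ m.l))
    (by rw [range_lift_eq]; exact f.span_left)

/-- The right multiplication by the extension of `f` to multipliers: `(c f(b)) m = c f(b m)`. -/
def extR (f : NondegHom k B C) (m : Mult k B) : C →ₗ[k] C :=
  descend (TensorProduct.lift f.rightAct) (TensorProduct.lift (f.rightAct ∘ₗ m.r))
    (by rw [range_lift_eq]; exact f.span_right)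

theorem induct_left (f : NondegHom k B C) {p : C → Prop} (hact : ∀ b x, p ((f.toLin b).l x))
    (hadd : ∀ x y, p x → p y → p (x + y)) (x : C) : p x := by
  have h0 : p 0 := by simpa using hact 0 0
  have hx : x ∈ LinearMap.range (TensorProduct.lift f.leftAct) := by
    rw [range_lift_eq]; exact f.span_left.symm ▸ trivial
  obtain ⟨u, rfl⟩ := hx
  induction u using TensorProduct.induction_on with
  | zero => simpa using h0
  | tmul b x => exact hact b x
  | add u v hu hv => rw [map_add]; exact hadd _ _ hu hv

theorem induct_right (f : NondegHom k B C) {p : C → Prop} (hact : ∀ b x, p ((f.toLin b).r x))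
    (hadd : ∀ x y, p x → p y → p (x + y)) (x : C) : p x := by
  have h0 : p 0 := by simpa using hact 0 0
  have hx : x ∈ LinearMap.range (TensorProduct.lift f.rightAct) := by
    rw [range_lift_eq]; exact f.span_right.symm ▸ trivial
  obtain ⟨u, rfl⟩ := hx
  induction u using TensorProduct.induction_on with
  | zero => simpa using h0
  | tmul b x => exact hact b x
  | add u v hu hv => rw [map_add]; exact hadd _ _ hu hv

theorem eq_zero_of_mul (f : NondegHom k B C) (hC : NondegMul C) {x : C}
    (h : ∀ b, (f.toLin b).l x = 0) : x = 0 := by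
  refine hC.2 _ fun c => ?_
  refine f.induct_right (p := fun c => c * x = 0) ?_ ?_ c
  · intro b c; rw [← Mult.l_r, h, mul_zero]
  · intro x y hx hy; rw [add_mul, hx, hy, add_zero]

theorem eq_zero_of_mul' (f : NondegHom k B C) (hC : NondegMul C) {x : C}
    (h : ∀ b, (f.toLin b).r x = 0) : x = 0 := by
  refine hC.1 _ fun c => ?_
  refine f.induct_left (p := fun c => x * c = 0) ?_ ?_ c
  · intro b c; rw [Mult.l_r, h, zero_mul]
  · intro x y hx hy; rw [mul_add, hx, hy, add_zero]

theorem extL_apply (f : NondegHom k B C) (hC : NondegMul C) (m : Mult k B) (b : B) (c : C) :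
    f.extL m ((f.toLin b).l c) = (f.toLin (m.l b)).l c := by
  have := descend_apply (TensorProduct.lift f.leftAct) (TensorProduct.lift (f.leftAct ∘ₗ m.l))
    (by rw [range_lift_eq]; exact f.span_left) ?_ (b ⊗ₜ c)
  · simpa [extL] using this
  · intro u hu
    refine f.eq_zero_of_mul hC fun c => ?_
    have key : ∀ v : B ⊗[k] C, (f.toLin c).l (TensorProduct.lift (f.leftAct ∘ₗ m.l) v) =
        (f.toLin (m.r c)).l (TensorProduct.lift f.leftAct v) := by
      intro v
      induction v using TensorProduct.induction_on with
      | zero => simp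
      | tmul b x => simp [← Mult.l_mul, ← f.map_mul, Mult.l_r]
      | add u v hu hv => simp only [map_add, hu, hv]
    rw [key, hu, map_zero]

theorem extR_apply (f : NondegHom k B C) (hC : NondegMul C) (m : Mult k B) (b : B) (c : C) :
    f.extR m ((f.toLin b).r c) = (f.toLin (m.r b)).r c := by
  have := descend_apply (TensorProduct.lift f.rightAct) (TensorProduct.lift (f.rightAct ∘ₗ m.r))
    (by rw [range_lift_eq]; exact f.span_right) ?_ (b ⊗ₜ c)
  · simpa [extR] using this
  · intro u hu
    refine f.eq_zero_of_mul' hC fun c => ?_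
    have key : ∀ v : B ⊗[k] C, (f.toLin c).r (TensorProduct.lift (f.rightAct ∘ₗ m.r) v) =
        (f.toLin (m.l c)).r (TensorProduct.lift f.rightAct v) := by
      intro v
      induction v using TensorProduct.induction_on with
      | zero => simp
      | tmul b x => simp [← Mult.r_mul, ← f.map_mul, Mult.l_r]
      | add u v hu hv => simp only [map_add, hu, hv]
    rw [key, hu, map_zero]

/-- The extension `M(B) → M(C)` of a non-degenerate homomorphism `f : B → M(C)`. -/
def ext (f : NondegHom k B C) (hC : NondegMul C) (m : Mult k B) : Mult k C :=
  Mult.mk (f.extL m) (f.extR m) (by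
    intro x y
    refine f.induct_right (p := fun x => x * f.extL m y = f.extR m x * y) ?_ ?_ x
    · intro b x
      refine f.induct_left (p := fun y => (f.toLin b).r x * f.extL m y =
        f.extR m ((f.toLin b).r x) * y) ?_ ?_ y
      · intro c y
        rw [extL_apply f hC, extR_apply f hC, ← Mult.l_r, ← Mult.l_r, ← Mult.l_mul,
          ← Mult.l_mul, ← f.map_mul, ← f.map_mul, m.l_r]
      · intro y y' h h'; simp only [map_add, mul_add, h, h']
    · intro y y' h h'; simp only [map_add, add_mul, h, h'])

/-- The canonical embedding `B → M(B)` of an algebra with `B B = B`. -/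
def id (k : Type*) [Field k] (B : Type*)
    [NonUnitalRing B] [Module k B] [IsScalarTower k B B] [SMulCommClass k B B]
    (h : Submodule.span k {y : B | ∃ a b, a * b = y} = ⊤) : NondegHom k B B where
  toLin := Mult.incl
  map_mul := Mult.incl_mul
  span_left := h
  span_right := by
    rw [← h]; congr 1; ext y
    exact ⟨fun ⟨a, b, e⟩ => ⟨b, a, e⟩, fun ⟨a, b, e⟩ => ⟨b, a, e⟩⟩

variable {B' C' : Type*}
  [NonUnitalRing B'] [Module k B'] [IsScalarTower k B' B'] [SMulCommClass k B' B']
  [NonUnitalRing C'] [Module k C'] [IsScalarTower k C' C'] [SMulCommClass k C' C']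

/-- `f ⊗ g : B ⊗ B' → M(C ⊗ C')`. -/
def tensor (f : NondegHom k B C) (g : NondegHom k B' C') :
    NondegHom k (B ⊗[k] B') (C ⊗[k] C') where
  toLin := TensorProduct.lift (LinearMap.mk₂ k (fun b b' => Mult.tmul (f.toLin b) (g.toLin b'))
    (fun _ _ _ => Mult.ext_lr (by ext; simp [TensorProduct.add_tmul])
      (by ext; simp [TensorProduct.add_tmul]))
    (fun _ _ _ => Mult.ext_lr (by ext; simp [TensorProduct.smul_tmul'])
      (by ext; simp [TensorProduct.smul_tmul']))
    (fun _ _ _ => Mult.ext_lr (by ext; simp [TensorProduct.tmul_add])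
      (by ext; simp [TensorProduct.tmul_add]))
    (fun _ _ _ => Mult.ext_lr (by ext; simp) (by ext; simp)))
  map_mul := AlgIso.mul_of_tmul (by intro a b c d; simp [f.map_mul, g.map_mul, Mult.tmul_mul])
  span_left := by
    rw [eq_top_iff]
    rintro z -
    induction z using TensorProduct.induction_on with
    | zero => exact zero_mem _
    | add u v hu hv => exact add_mem hu hv
    | tmul x y =>
      refine f.induct_left (p := fun x => ∀ y, x ⊗ₜ[k] y ∈ _) ?_ ?_ x y
      · intro b x y
        refine g.induct_left (p := fun y => (f.toLin b).l x ⊗ₜ[k] y ∈ _) ?_ ?_ y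
        · intro c y
          exact Submodule.subset_span ⟨b ⊗ₜ c, x ⊗ₜ y, by simp⟩
        · intro y y' hy hy'
          rw [TensorProduct.tmul_add]; exact add_mem hy hy'
      · intro x x' hx hx' y
        rw [TensorProduct.add_tmul]; exact add_mem (hx y) (hx' y)
  span_right := by
    rw [eq_top_iff]
    rintro z -
    induction z using TensorProduct.induction_on with
    | zero => exact zero_mem _
    | add u v hu hv => exact add_mem hu hv
    | tmul x y =>
      refine f.induct_right (p := fun x => ∀ y, x ⊗ₜ[k] y ∈ _) ?_ ?_ x y
      · intro b x y
        refine g.induct_right (p := fun y => (f.toLin b).r x ⊗ₜ[k] y ∈ _) ?_ ?_ y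
        · intro c y
          exact Submodule.subset_span ⟨b ⊗ₜ c, x ⊗ₜ y, by simp⟩
        · intro y y' hy hy'
          rw [TensorProduct.tmul_add]; exact add_mem hy hy'
      · intro x x' hx hx' y
        rw [TensorProduct.add_tmul]; exact add_mem (hx y) (hx' y)

/-- The composite of `f : B → M(C)` with the isomorphism `M(C) → M(D)` given by `C ≅ D`. -/
def congr (f : NondegHom k B C) (e : AlgIso k C D) : NondegHom k B D where
  toLin := Mult.congr e ∘ₗ f.toLin
  map_mul a b := by simp [f.map_mul, Mult.congr_mul]
  span_left := by
    rw [eq_top_iff]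
    rintro z -
    obtain ⟨z, rfl⟩ := e.toLinearEquiv.surjective z
    refine f.induct_left (p := fun z => e.toLinearEquiv z ∈ _) ?_ ?_ z
    · intro b c
      exact Submodule.subset_span ⟨b, e.toLinearEquiv c, by simp [Mult.congr_l]⟩
    · intro x y hx hy; rw [map_add]; exact add_mem hx hy
  span_right := by
    rw [eq_top_iff]
    rintro z -
    obtain ⟨z, rfl⟩ := e.toLinearEquiv.surjective z
    refine f.induct_right (p := fun z => e.toLinearEquiv z ∈ _) ?_ ?_ z
    · intro b c
      exact Submodule.subset_span ⟨b, e.toLinearEquiv c, by simp [Mult.congr_r]⟩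
    · intro x y hx hy; rw [map_add]; exact add_mem hx hy

end NondegHom

/-- The `B`-module obtained from a unital `C`-module along `f : B → M(C)`. -/
def pullAct (f : NondegHom k B C) {act : C →ₗ[k] X →ₗ[k] X} (h : IsUnitalModule act) :
    B →ₗ[k] X →ₗ[k] X where
  toFun b := h.ext (f.toLin b)
  map_add' _ _ := by rw [map_add, h.ext_add]
  map_smul' _ _ := by rw [map_smul, h.ext_smul]; rfl

theorem pullAct_apply (f : NondegHom k B C) {act : C →ₗ[k] X →ₗ[k] X} (h : IsUnitalModule act)
    (b : B) (x : X) : pullAct f h b x = h.ext (f.toLin b) x := rfl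

theorem IsUnitalModule.pull (f : NondegHom k B C) {act : C →ₗ[k] X →ₗ[k] X}
    (h : IsUnitalModule act) : IsUnitalModule (pullAct f h) where
  mul_act a b x := by simp only [pullAct_apply, f.map_mul, h.ext_mul]
  unital := by
    rw [eq_top_iff]
    rintro x -
    refine h.induct (p := fun x => x ∈ _) ?_ (fun x y hx hy => add_mem hx hy) x
    intro c x
    refine f.induct_left (p := fun c => act c x ∈ _) ?_ ?_ c
    · intro b c
      exact Submodule.subset_span ⟨b, act c x, by rw [pullAct_apply, h.ext_act]⟩
    · intro c c' hc hc'
      rw [map_add]; exact add_mem hc hc'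
  nondeg := by
    intro x hx
    refine h.nondeg x fun c => ?_
    refine f.induct_right (p := fun c => act c x = 0) ?_ ?_ c
    · intro b c
      rw [← h.act_ext, ← pullAct_apply, hx, map_zero]
    · intro c c' hc hc'
      rw [map_add, LinearMap.add_apply, hc, hc', add_zero]

/-- `j : B → C` and `r : C → B` exhibit the algebra `B` as a direct factor of the algebra `C`. -/
structure IsFactor (j : B →ₗ[k] C) (r : C →ₗ[k] B) : Prop where
  map_mul : ∀ x y, j (x * y) = j x * j y
  retract : ∀ x, r (j x) = x
  mul_left : ∀ x y, j (r x * y) = x * j y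
  mul_right : ∀ x y, j (y * r x) = j y * x

theorem IsFactor.tensor {B' C' : Type*}
    [NonUnitalRing B'] [Module k B'] [IsScalarTower k B' B'] [SMulCommClass k B' B']
    [NonUnitalRing C'] [Module k C'] [IsScalarTower k C' C'] [SMulCommClass k C' C']
    {j : B →ₗ[k] C} {r : C →ₗ[k] B} {j' : B' →ₗ[k] C'} {r' : C' →ₗ[k] B'}
    (h : IsFactor j r) (h' : IsFactor j' r') :
    IsFactor (TensorProduct.map j j') (TensorProduct.map r r') where
  map_mul := AlgIso.mul_of_tmul (by intro a b c d; simp [h.map_mul, h'.map_mul])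
  retract x := by
    induction x using TensorProduct.induction_on with
    | zero => simp
    | tmul x y => simp [h.retract, h'.retract]
    | add x y hx hy => simp only [_root_.map_add, hx, hy]
  mul_left x y := by
    induction x using TensorProduct.induction_on with
    | zero => simp
    | add x y hx hy => simp only [_root_.map_add, add_mul, hx, hy]
    | tmul a b =>
      induction y using TensorProduct.induction_on with
      | zero => simp
      | add x y hx hy => simp only [_root_.map_add, mul_add, hx, hy]
      | tmul c d => simp [h.mul_left, h'.mul_left]
  mul_right x y := by
    induction x using TensorProduct.induction_on with
    | zero => simp
    | add x y hx hy => simp only [_root_.map_add, mul_add, hx, hy]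
    | tmul a b =>
      induction y using TensorProduct.induction_on with
      | zero => simp
      | add x y hx hy => simp only [_root_.map_add, add_mul, hx, hy]
      | tmul c d => simp [h.mul_right, h'.mul_right]

/-- The component in `M(B)` of a multiplier of `C`, for a direct factor `B` of `C`. -/
def Mult.restrict {j : B →ₗ[k] C} {r : C →ₗ[k] B} (h : IsFactor j r) : Mult k C →ₗ[k] Mult k B where
  toFun m := Mult.mk (r ∘ₗ m.l ∘ₗ j) (r ∘ₗ m.r ∘ₗ j) (by
    intro x y
    have hj : Function.Injective j := Function.LeftInverse.injective h.retract
    apply hj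
    simp [h.mul_left, h.mul_right, Mult.l_r])
  map_add' _ _ := Mult.ext_lr (by ext; simp) (by ext; simp)
  map_smul' _ _ := Mult.ext_lr (by ext; simp) (by ext; simp)

theorem Mult.restrict_l {j : B →ₗ[k] C} {r : C →ₗ[k] B} (h : IsFactor j r) (m : Mult k C) (x : B) :
    (Mult.restrict h m).l x = r (m.l (j x)) := rfl

theorem Mult.restrict_r {j : B →ₗ[k] C} {r : C →ₗ[k] B} (h : IsFactor j r) (m : Mult k C) (x : B) :
    (Mult.restrict h m).r x = r (m.r (j x)) := rfl

namespace IsFactor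

variable {j : B →ₗ[k] C} {r : C →ₗ[k] B}

theorem inj (h : IsFactor j r) : Function.Injective j :=
  Function.LeftInverse.injective h.retract

theorem nondeg (h : IsFactor j r) (hC : NondegMul C) : NondegMul B := by
  constructor
  · intro a ha
    apply h.inj
    rw [map_zero]
    exact hC.1 _ fun b => by rw [← h.mul_right, ha, map_zero]
  · intro a ha
    apply h.inj
    rw [map_zero]
    exact hC.2 _ fun b => by rw [← h.mul_left, ha, map_zero]

theorem r_mul (h : IsFactor j r) (hC : NondegMul C) (x y : C) : r (x * y) = r x * r y := by
  refine sub_eq_zero.1 ((h.nondeg hC).1 _ fun b => ?_)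
  apply h.inj
  rw [sub_mul, map_sub, h.mul_left, mul_assoc (r x), h.mul_left, h.mul_left, mul_assoc, sub_self,
    map_zero]

theorem restrict_mul (h : IsFactor j r) (hC : NondegMul C) (m n : Mult k C) :
    Mult.restrict h (m * n) = Mult.restrict h m * Mult.restrict h n := by
  refine Mult.ext_l (h.nondeg hC) fun x => ?_
  have key : n.l (j x) = j (r (n.l (j x))) := by
    refine sub_eq_zero.1 (hC.1 _ fun w => ?_)
    rw [sub_mul, ← h.mul_right, h.mul_left, ← n.l_mul_right hC, ← n.l_mul_right hC,
      ← h.mul_right, ← h.map_mul, sub_self]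
  simp only [Mult.l_mul, Mult.restrict_l]
  rw [← key]

theorem restrict_incl (h : IsFactor j r) (hC : NondegMul C) (c : C) :
    Mult.restrict h (Mult.incl c) = Mult.incl (r c) := by
  refine Mult.ext_l (h.nondeg hC) fun x => ?_
  simp [Mult.restrict_l, h.r_mul hC, h.retract]

end IsFactor

theorem Mult.restrict_tmul {B' C' : Type*}
    [NonUnitalRing B'] [Module k B'] [IsScalarTower k B' B'] [SMulCommClass k B' B']
    [NonUnitalRing C'] [Module k C'] [IsScalarTower k C' C'] [SMulCommClass k C' C']
    {j : B →ₗ[k] C} {r : C →ₗ[k] B} {j' : B' →ₗ[k] C'} {r' : C' →ₗ[k] B'}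
    (h : IsFactor j r) (h' : IsFactor j' r') (m : Mult k C) (n : Mult k C') :
    Mult.restrict (h.tensor h') (Mult.tmul m n) =
      Mult.tmul (Mult.restrict h m) (Mult.restrict h' n) :=
  Mult.ext_lr (by ext; simp [Mult.restrict_l]) (by ext; simp [Mult.restrict_r])

theorem Mult.restrict_one {j : B →ₗ[k] C} {r : C →ₗ[k] B} (h : IsFactor j r) :
    Mult.restrict h 1 = 1 :=
  Mult.ext_lr (by ext; simp [Mult.restrict_l, h.retract]) (by ext; simp [Mult.restrict_r, h.retract])

end Generic

/-! ## Multiplier Hopf algebras -/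

section Hopf

variable {k A : Type*} [Field k]
  [NonUnitalRing A] [Module k A] [IsScalarTower k A A] [SMulCommClass k A A]

/-- The multiplier `1 ⊗ b` of `A ⊗ A`. -/
def oneTmul (b : A) : Mult k (A ⊗[k] A) := Mult.tmul 1 (Mult.incl b)

/-- The multiplier `a ⊗ 1` of `A ⊗ A`. -/
def tmulOne (a : A) : Mult k (A ⊗[k] A) := Mult.tmul (Mult.incl a) 1

/-- `(A, Δ)` is a multiplier Hopf algebra: the product is non-degenerate, `Δ` is a homomorphism
such that `Δ(a)(1 ⊗ b)` and `(a ⊗ 1)Δ(b)` are in `A ⊗ A`, the resulting maps `T₁` and `T₂` on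
`A ⊗ A` are bijective, and `Δ` is coassociative:
`(a ⊗ 1 ⊗ 1)(Δ ⊗ ι)(Δ(b)(1 ⊗ c)) = (ι ⊗ Δ)((a ⊗ 1)Δ(b))(1 ⊗ 1 ⊗ c)`.
Since `(a ⊗ 1)Δ(x) = T₂(a ⊗ x)` and `Δ(y)(1 ⊗ c) = T₁(y ⊗ c)`, the two sides are
`(T₂ ⊗ ι)(a ⊗ T₁(b ⊗ c))` and `(ι ⊗ T₁)(T₂(a ⊗ b) ⊗ c)`. -/
structure IsMultiplierHopf (Δ : A →ₗ[k] Mult k (A ⊗[k] A)) : Prop where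
  nondeg : NondegMul A
  map_mul : ∀ a b, Δ (a * b) = Δ a * Δ b
  exists_T : ∃ T₁ T₂ : A ⊗[k] A →ₗ[k] A ⊗[k] A,
    (∀ a b, Mult.incl (T₁ (a ⊗ₜ b)) = Δ a * oneTmul b) ∧
    (∀ a b, Mult.incl (T₂ (a ⊗ₜ b)) = tmulOne a * Δ b) ∧
    Function.Bijective T₁ ∧ Function.Bijective T₂ ∧
    ∀ a b c : A,
      TensorProduct.map T₂ LinearMap.id ((TensorProduct.assoc k A A A).symm (a ⊗ₜ T₁ (b ⊗ₜ c))) =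
      (TensorProduct.assoc k A A A).symm
        (TensorProduct.map LinearMap.id T₁ (TensorProduct.assoc k A A A (T₂ (a ⊗ₜ b) ⊗ₜ c)))

/-- The co-opposite comultiplication. -/
def coop (Δ : A →ₗ[k] Mult k (A ⊗[k] A)) : A →ₗ[k] Mult k (A ⊗[k] A) :=
  Mult.congr (AlgIso.comm k A A) ∘ₗ Δ

/-- `ε` is a counit: `(ε ⊗ ι)(Δ(a)(1 ⊗ b)) = a b` and `(ι ⊗ ε)((a ⊗ 1)Δ(b)) = a b`. -/
def IsCounit (Δ : A →ₗ[k] Mult k (A ⊗[k] A)) (ε : A →ₗ[k] k) : Prop :=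
  (∀ a b z, Mult.incl z = Δ a * oneTmul b → TensorProduct.lid k A (ε.rTensor A z) = a * b) ∧
  (∀ a b z, Mult.incl z = tmulOne a * Δ b → TensorProduct.rid k A (ε.lTensor A z) = a * b)

theorem incl_injective (hA : NondegMul A) :
    Function.Injective (Mult.incl : A →ₗ[k] Mult k A) := by
  intro a b h
  refine sub_eq_zero.1 (hA.1 _ fun x => ?_)
  have := congrArg (fun m : Mult k A => m.l x) h
  simp only [Mult.incl_l] at this
  rw [sub_mul, this, sub_self]

namespace IsMultiplierHopf

variable {Δ : A →ₗ[k] Mult k (A ⊗[k] A)}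

/-- `T₁(a ⊗ b) = Δ(a)(1 ⊗ b)`. -/
def T₁ (h : IsMultiplierHopf Δ) : A ⊗[k] A →ₗ[k] A ⊗[k] A := h.exists_T.choose

/-- `T₂(a ⊗ b) = (a ⊗ 1)Δ(b)`. -/
def T₂ (h : IsMultiplierHopf Δ) : A ⊗[k] A →ₗ[k] A ⊗[k] A := h.exists_T.choose_spec.choose

theorem incl_T₁ (h : IsMultiplierHopf Δ) (a b : A) :
    Mult.incl (h.T₁ (a ⊗ₜ b)) = Δ a * oneTmul b := h.exists_T.choose_spec.choose_spec.1 a b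

theorem incl_T₂ (h : IsMultiplierHopf Δ) (a b : A) :
    Mult.incl (h.T₂ (a ⊗ₜ b)) = tmulOne a * Δ b := h.exists_T.choose_spec.choose_spec.2.1 a b

theorem T₁_bij (h : IsMultiplierHopf Δ) : Function.Bijective h.T₁ :=
  h.exists_T.choose_spec.choose_spec.2.2.1

theorem T₂_bij (h : IsMultiplierHopf Δ) : Function.Bijective h.T₂ :=
  h.exists_T.choose_spec.choose_spec.2.2.2.1

theorem coassoc (h : IsMultiplierHopf Δ) (a b c : A) :
    TensorProduct.map h.T₂ LinearMap.id
      ((TensorProduct.assoc k A A A).symm (a ⊗ₜ h.T₁ (b ⊗ₜ c))) =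
    (TensorProduct.assoc k A A A).symm
      (TensorProduct.map LinearMap.id h.T₁ (TensorProduct.assoc k A A A (h.T₂ (a ⊗ₜ b) ⊗ₜ c))) :=
  h.exists_T.choose_spec.choose_spec.2.2.2.2 a b c

theorem T₁_eq (h : IsMultiplierHopf Δ) {a b : A} {z : A ⊗[k] A}
    (hz : Mult.incl z = Δ a * oneTmul b) : z = h.T₁ (a ⊗ₜ b) :=
  incl_injective (h.nondeg.tensor h.nondeg) (hz.trans (h.incl_T₁ a b).symm)

theorem T₂_eq (h : IsMultiplierHopf Δ) {a b : A} {z : A ⊗[k] A}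
    (hz : Mult.incl z = tmulOne a * Δ b) : z = h.T₂ (a ⊗ₜ b) :=
  incl_injective (h.nondeg.tensor h.nondeg) (hz.trans (h.incl_T₂ a b).symm)

/-- The multiplication map `A ⊗ A → A`. -/
abbrev mulMap (k A : Type*) [Field k] [NonUnitalRing A] [Module k A] [IsScalarTower k A A]
    [SMulCommClass k A A] : A ⊗[k] A →ₗ[k] A := LinearMap.mul' k A

/-- Applying a map `f` on the last two factors: `(ι ⊗ m)(T₂ ⊗ ι)(a ⊗ w) = (a ⊗ 1) T₁(w)`. -/
theorem map_mul_T₂ (h : IsMultiplierHopf Δ) (a : A) (w : A ⊗[k] A) :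
    TensorProduct.map LinearMap.id (mulMap k A) (TensorProduct.assoc k A A A
      (TensorProduct.map h.T₂ LinearMap.id ((TensorProduct.assoc k A A A).symm (a ⊗ₜ w)))) =
    TensorProduct.map (LinearMap.mulLeft k a) LinearMap.id (h.T₁ w) := by
  induction w using TensorProduct.induction_on with
  | zero => simp
  | add u v hu hv => simp only [_root_.map_add, TensorProduct.tmul_add, hu, hv]
  | tmul x y =>
    apply incl_injective (k := k) (h.nondeg.tensor h.nondeg)
    have e1 : (Mult.incl (TensorProduct.map (LinearMap.mulLeft k a) LinearMap.id
        (h.T₁ (x ⊗ₜ[k] y))) : Mult k (A ⊗[k] A)) = tmulOne a * Mult.incl (h.T₁ (x ⊗ₜ[k] y)) := by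
      refine Mult.ext_l (h.nondeg.tensor h.nondeg) fun z => ?_
      simp only [Mult.l_mul, Mult.incl_l]
      generalize h.T₁ (x ⊗ₜ y) = t
      induction t using TensorProduct.induction_on with
      | zero => simp
      | add u v hu hv => simp only [_root_.map_add, add_mul, hu, hv]
      | tmul u v =>
        induction z using TensorProduct.induction_on with
        | zero => simp
        | add u v hu hv => simp only [_root_.map_add, mul_add, hu, hv]
        | tmul p q => simp [tmulOne, mul_assoc]
    have e2 : (Mult.incl (TensorProduct.map LinearMap.id (mulMap k A) (TensorProduct.assoc k A A A
        (h.T₂ (a ⊗ₜ x) ⊗ₜ y))) : Mult k (A ⊗[k] A)) = Mult.incl (h.T₂ (a ⊗ₜ x)) * oneTmul y := by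
      refine Mult.ext_l (h.nondeg.tensor h.nondeg) fun z => ?_
      simp only [Mult.l_mul, Mult.incl_l]
      generalize h.T₂ (a ⊗ₜ x) = t
      induction t using TensorProduct.induction_on with
      | zero => simp
      | add u v hu hv => simp only [_root_.map_add, TensorProduct.add_tmul, add_mul, hu, hv]
      | tmul u v =>
        induction z using TensorProduct.induction_on with
        | zero => simp
        | add u v hu hv => simp only [_root_.map_add, mul_add, hu, hv]
        | tmul p q => simp [oneTmul, mul_assoc]
    simp only [TensorProduct.assoc_symm_tmul, TensorProduct.map_tmul, LinearMap.id_apply]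
    rw [e1, e2, h.incl_T₁, h.incl_T₂, mul_assoc]

/-- Existence of the counit. -/
theorem exists_counit (h : IsMultiplierHopf Δ) : ∃ ε : A →ₗ[k] k, IsCounit Δ ε := by
  classical
  by_cases hA : ∀ x : A, x = 0
  · exact ⟨0, fun a b z _ => by rw [hA (a * b)]; exact hA _,
      fun a b z _ => by rw [hA (a * b)]; exact hA _⟩
  push Not at hA
  obtain ⟨x₀, hx₀⟩ := hA
  let e₁ := LinearEquiv.ofBijective h.T₁ h.T₁_bij
  let e₂ := LinearEquiv.ofBijective h.T₂ h.T₂_bij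
  have he₁ : ∀ z, h.T₁ (e₁.symm z) = z := e₁.apply_symm_apply
  have he₂ : ∀ z, h.T₂ (e₂.symm z) = z := e₂.apply_symm_apply
  -- `x ⊗ E(y)c = m T₂⁻¹(x ⊗ y) ⊗ c` where `E(y)c = m T₁⁻¹(y ⊗ c)`
  have key : ∀ (w : A ⊗[k] A) (c : A),
      TensorProduct.map LinearMap.id (mulMap k A ∘ₗ e₁.symm.toLinearMap)
        (TensorProduct.assoc k A A A (h.T₂ w ⊗ₜ c)) = mulMap k A w ⊗ₜ c := by
    intro w c
    induction w using TensorProduct.induction_on with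
    | zero => simp
    | add u v hu hv => simp only [_root_.map_add, TensorProduct.add_tmul, hu, hv]
    | tmul a b =>
      have h1 : ∀ w : A ⊗[k] A, TensorProduct.map LinearMap.id h.T₁ (TensorProduct.assoc k A A A
          (TensorProduct.map h.T₂ LinearMap.id ((TensorProduct.assoc k A A A).symm (a ⊗ₜ w)))) =
          TensorProduct.assoc k A A A (TensorProduct.map h.T₂ LinearMap.id
            ((TensorProduct.assoc k A A A).symm (a ⊗ₜ h.T₁ w))) := by
        intro w
        induction w using TensorProduct.induction_on with
        | zero => simp
        | add u v hu hv => simp only [_root_.map_add, TensorProduct.tmul_add, hu, hv]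
        | tmul x y => rw [h.coassoc]; simp
      have h2 := h1 (e₁.symm (b ⊗ₜ c))
      rw [he₁] at h2
      simp only [TensorProduct.assoc_symm_tmul, TensorProduct.map_tmul, LinearMap.id_apply] at h2
      have h3 := h.map_mul_T₂ a (e₁.symm (b ⊗ₜ c))
      rw [he₁] at h3
      rw [← h2, ← LinearMap.comp_apply, ← TensorProduct.map_comp, LinearMap.comp_assoc,
        show e₁.symm.toLinearMap ∘ₗ h.T₁ = LinearMap.id from
          LinearMap.ext fun z => e₁.symm_apply_apply z]
      simpa using h3
  have key' : ∀ x y c : A, x ⊗ₜ[k] mulMap k A (e₁.symm (y ⊗ₜ c)) =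
      mulMap k A (e₂.symm (x ⊗ₜ y)) ⊗ₜ[k] c := by
    intro x y c
    rw [← key, he₂]; simp
  obtain ⟨φ, hφ⟩ : ∃ φ : A →ₗ[k] k, φ x₀ = 1 := by
    have := (Module.forall_dual_apply_eq_zero_iff k x₀).not.2 hx₀
    push Not at this
    obtain ⟨f, hf⟩ := this
    exact ⟨(f x₀)⁻¹ • f, by simp [hf]⟩
  let ε : A →ₗ[k] k := φ ∘ₗ mulMap k A ∘ₗ e₂.symm.toLinearMap ∘ₗ TensorProduct.mk k A A x₀
  have hε : ∀ y c, mulMap k A (e₁.symm (y ⊗ₜ c)) = ε y • c := by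
    intro y c
    have := congrArg (fun t => TensorProduct.lid k A (φ.rTensor A t)) (key' x₀ y c)
    simpa [hφ, ε] using this
  have hε' : ∀ x y, mulMap k A (e₂.symm (x ⊗ₜ y)) = ε y • x := by
    intro x y
    have := key' x y x₀
    rw [hε] at this
    have := congrArg (fun t => TensorProduct.rid k A (φ.lTensor A t)) this
    simpa [hφ] using this.symm
  have H1 : ∀ z, TensorProduct.lid k A (ε.rTensor A z) = mulMap k A (e₁.symm z) := by
    intro z
    induction z using TensorProduct.induction_on with
    | zero => simp
    | add u v hu hv => simp only [_root_.map_add, hu, hv]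
    | tmul x y => rw [hε]; simp
  have H2 : ∀ z, TensorProduct.rid k A (ε.lTensor A z) = mulMap k A (e₂.symm z) := by
    intro z
    induction z using TensorProduct.induction_on with
    | zero => simp
    | add u v hu hv => simp only [_root_.map_add, hu, hv]
    | tmul x y => rw [hε']; simp
  refine ⟨ε, fun a b z hz => ?_, fun a b z hz => ?_⟩
  · rw [H1, h.T₁_eq hz, show e₁.symm (h.T₁ (a ⊗ₜ b)) = a ⊗ₜ b from e₁.symm_apply_apply _]
    simp
  · rw [H2, h.T₂_eq hz, show e₂.symm (h.T₂ (a ⊗ₜ b)) = a ⊗ₜ b from e₂.symm_apply_apply _]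
    simp

/-- The counit `ε` of a multiplier Hopf algebra. -/
def counit (h : IsMultiplierHopf Δ) : A →ₗ[k] k := h.exists_counit.choose

theorem isCounit (h : IsMultiplierHopf Δ) : IsCounit Δ h.counit := h.exists_counit.choose_spec

theorem counit_T₁ (h : IsMultiplierHopf Δ) (w : A ⊗[k] A) :
    TensorProduct.lid k A (h.counit.rTensor A (h.T₁ w)) = mulMap k A w := by
  induction w using TensorProduct.induction_on with
  | zero => simp
  | add u v hu hv => simp only [_root_.map_add, hu, hv]
  | tmul x y => rw [h.isCounit.1 x y _ (h.incl_T₁ x y)]; simp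

theorem counit_T₂ (h : IsMultiplierHopf Δ) (w : A ⊗[k] A) :
    TensorProduct.rid k A (h.counit.lTensor A (h.T₂ w)) = mulMap k A w := by
  induction w using TensorProduct.induction_on with
  | zero => simp
  | add u v hu hv => simp only [_root_.map_add, hu, hv]
  | tmul x y => rw [h.isCounit.2 x y _ (h.incl_T₂ x y)]; simp

/-- The counit is unique. -/
theorem counit_unique (h : IsMultiplierHopf Δ) (ε : A →ₗ[k] k) (hε : IsCounit Δ ε) :
    ε = h.counit := by
  ext x
  by_cases hx : x = 0
  · simp [hx]
  obtain ⟨w, hw⟩ := h.T₁_bij.2 (x ⊗ₜ x)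
  have key : ∀ w, TensorProduct.lid k A (ε.rTensor A (h.T₁ w)) = mulMap k A w := by
    intro w
    induction w using TensorProduct.induction_on with
    | zero => simp
    | add u v hu hv => simp only [_root_.map_add, hu, hv]
    | tmul x y => rw [hε.1 x y _ (h.incl_T₁ x y)]; simp
  have := (key w).trans (h.counit_T₁ w).symm
  rw [hw] at this
  simp only [LinearMap.rTensor_tmul, TensorProduct.lid_tmul] at this
  exact smul_left_injective k hx this

theorem counit_mul (h : IsMultiplierHopf Δ) (a b : A) :
    h.counit (a * b) = h.counit a * h.counit b := by
  by_cases hA : ∀ x : A, x = 0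
  · rw [hA (a * b), hA a]; simp
  push Not at hA
  obtain ⟨x₀, hx₀⟩ := hA
  -- `(ε ⊗ ι)(Δ(a) w) = a (ε ⊗ ι)(w)`
  have s1 : ∀ (a : A) (w : A ⊗[k] A), TensorProduct.lid k A (h.counit.rTensor A ((Δ a).l w)) =
      a * TensorProduct.lid k A (h.counit.rTensor A w) := by
    intro a w
    obtain ⟨v, rfl⟩ := h.T₁_bij.2 w
    rw [h.counit_T₁]
    induction v using TensorProduct.induction_on with
    | zero => simp
    | add u v hu hv => simp only [_root_.map_add, mul_add, hu, hv]
    | tmul x y =>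
      have : (Δ a).l (h.T₁ (x ⊗ₜ y)) = h.T₁ ((a * x) ⊗ₜ y) := by
        apply h.T₁_eq
        rw [h.map_mul, mul_assoc, ← h.incl_T₁]
        refine Mult.ext_l (h.nondeg.tensor h.nondeg) fun z => ?_
        simp [Mult.l_mul_right (h.nondeg.tensor h.nondeg)]
      rw [this, h.counit_T₁]
      simp [mul_assoc]
  have s2 : ∀ (w : A ⊗[k] A) (p : A),
      TensorProduct.lid k A (h.counit.rTensor A
        (TensorProduct.map (LinearMap.mulRight k p) LinearMap.id w)) =
      h.counit p • TensorProduct.lid k A (h.counit.rTensor A w) := by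
    intro w p
    obtain ⟨v, rfl⟩ := h.T₁_bij.2 w
    induction v using TensorProduct.induction_on with
    | zero => simp
    | add u v hu hv => simp only [_root_.map_add, smul_add, hu, hv]
    | tmul x y =>
      have : TensorProduct.map (LinearMap.mulRight k p) LinearMap.id (h.T₁ (x ⊗ₜ[k] y)) =
          (Δ x).l (p ⊗ₜ y) := by
        apply incl_injective (k := k) (h.nondeg.tensor h.nondeg)
        have e : (Mult.incl (TensorProduct.map (LinearMap.mulRight k p) LinearMap.id
            (h.T₁ (x ⊗ₜ[k] y))) : Mult k (A ⊗[k] A)) =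
            Mult.incl (h.T₁ (x ⊗ₜ[k] y)) * tmulOne p := by
          refine Mult.ext_l (h.nondeg.tensor h.nondeg) fun z => ?_
          simp only [Mult.l_mul, Mult.incl_l]
          generalize h.T₁ (x ⊗ₜ y) = t
          induction t using TensorProduct.induction_on with
          | zero => simp
          | add u v hu hv => simp only [_root_.map_add, add_mul, hu, hv]
          | tmul u v =>
            induction z using TensorProduct.induction_on with
            | zero => simp
            | add u v hu hv => simp only [_root_.map_add, mul_add, hu, hv]
            | tmul p q => simp [tmulOne, mul_assoc]
        rw [e, h.incl_T₁]
        refine Mult.ext_l (h.nondeg.tensor h.nondeg) fun z => ?_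
        simp only [Mult.l_mul, Mult.incl_l]
        rw [← Mult.l_mul_right (h.nondeg.tensor h.nondeg)]
        congr 1
        induction z using TensorProduct.induction_on with
        | zero => simp
        | add u v hu hv => simp only [_root_.map_add, mul_add, hu, hv]
        | tmul r q => simp [tmulOne, oneTmul]
      rw [this, s1, h.counit_T₁]
      simp [mul_smul_comm]
  have := s2 (a ⊗ₜ x₀) b
  simp only [TensorProduct.map_tmul, LinearMap.rTensor_tmul, TensorProduct.lid_tmul,
    LinearMap.mulRight_apply, LinearMap.id_apply, smul_smul] at this
  rw [mul_comm (h.counit a)]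
  exact smul_left_injective k hx₀ this

end IsMultiplierHopf

end Hopf

/-! ## Group-cograded multiplier Hopf algebras and multiplier Hopf `T`-coalgebras -/

/-- A `G`-cograded multiplier Hopf algebra `A = ⨁ A_p`: the `A_p = comp p` are non-trivial
subalgebras with `A_p A_q = 0` for `p ≠ q`, `Δ(A_{pq})(1 ⊗ A_q) = A_p ⊗ A_q` and
`(A_p ⊗ 1)Δ(A_{pq}) = A_p ⊗ A_q`. -/
structure GCogradedMHA (k G A : Type*) [Field k] [Group G] [DecidableEq G]
    [NonUnitalRing A] [Module k A] [IsScalarTower k A A] [SMulCommClass k A A] where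
  Δ : A →ₗ[k] Mult k (A ⊗[k] A)
  hopf : IsMultiplierHopf Δ
  comp : G → NonUnitalSubalgebra k A
  comp_ne_bot : ∀ p, comp p ≠ ⊥
  isInternal : DirectSum.IsInternal fun p => (comp p).toSubmodule
  mul_eq_zero : ∀ p q, p ≠ q → ∀ a ∈ comp p, ∀ b ∈ comp q, a * b = 0
  comul_left : ∀ p q,
    Submodule.span k {m | ∃ a ∈ comp (p * q), ∃ b ∈ comp q, Δ a * oneTmul b = m} =
    Submodule.span k {m | ∃ a ∈ comp p, ∃ b ∈ comp q, Mult.incl (a ⊗ₜ b) = m}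
  comul_right : ∀ p q,
    Submodule.span k {m | ∃ a ∈ comp p, ∃ b ∈ comp (p * q), tmulOne a * Δ b = m} =
    Submodule.span k {m | ∃ a ∈ comp p, ∃ b ∈ comp q, Mult.incl (a ⊗ₜ b) = m}

/-- A multiplier Hopf `T`-coalgebra: a `G`-cograded multiplier Hopf algebra which is regular (its
co-opposite comultiplication also gives a multiplier Hopf algebra) and is endowed with a crossing,
i.e. a homomorphism `π` from `G` to the algebra automorphisms of `A` that is compatible
with the comultiplication and the counit and maps `A_q` onto `A_{p q p⁻¹}`. -/
structure MultiplierHopfTCoalgebra (k G A : Type*) [Field k] [Group G] [DecidableEq G]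
    [NonUnitalRing A] [Module k A] [IsScalarTower k A A] [SMulCommClass k A A]
    extends GCogradedMHA k G A where
  regular : IsMultiplierHopf (coop Δ)
  π : G →* (A ≃ₗ[k] A)
  π_mul : ∀ p a b, π p (a * b) = π p a * π p b
  π_comp : ∀ p q, (comp q).toSubmodule.map (π p).toLinearMap = (comp (p * q * p⁻¹)).toSubmodule
  comul_π : ∀ p a, Δ (π p a) =
    Mult.congr (AlgIso.tensor ⟨π p, π_mul p⟩ ⟨π p, π_mul p⟩) (Δ a)
  counit_π : ∀ p a, hopf.counit (π p a) = hopf.counit a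

namespace GCogradedMHA

variable {k G A : Type*} [Field k] [Group G] [DecidableEq G]
  [NonUnitalRing A] [Module k A] [IsScalarTower k A A] [SMulCommClass k A A]
  (H : GCogradedMHA k G A)

/-- The algebra `A_p`. -/
abbrev C (p : G) : Type _ := ↥(H.comp p)

/-- The inclusion `A_p → A`. -/
def inc (p : G) : H.C p →ₗ[k] A where
  toFun x := x
  map_add' _ _ := rfl
  map_smul' _ _ := rfl

/-- The projection `A → A_p`. -/
def pr (p : G) : A →ₗ[k] H.C p :=
  ({ toFun := fun x => ⟨x.1, x.2⟩, map_add' := fun _ _ => rfl, map_smul' := fun _ _ => rfl } :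
      ↥(H.comp p).toSubmodule →ₗ[k] H.C p) ∘ₗ
    DirectSum.component k G (fun p => ↥(H.comp p).toSubmodule) p ∘ₗ
    (LinearEquiv.ofBijective (DirectSum.coeLinearMap fun p => (H.comp p).toSubmodule)
      H.isInternal).symm.toLinearMap

@[simp] theorem inc_apply {p : G} (x : H.C p) : H.inc p x = (x : A) := rfl

theorem pr_same {p : G} {a : A} (ha : a ∈ H.comp p) : H.pr p a = ⟨a, ha⟩ :=
  Subtype.ext (congrArg Subtype.val (H.isInternal.ofBijective_coeLinearMap_of_mem (x := a) ha))

theorem pr_ne {p q : G} {a : A} (ha : a ∈ H.comp p) (h : p ≠ q) : H.pr q a = 0 :=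
  Subtype.ext (congrArg Subtype.val (H.isInternal.ofBijective_coeLinearMap_of_mem_ne h ha))

theorem induct {P : A → Prop} (hp : ∀ p, ∀ a ∈ H.comp p, P a)
    (hadd : ∀ a b, P a → P b → P (a + b)) (a : A) : P a := by
  have : a ∈ ⨆ p, (H.comp p).toSubmodule := by
    rw [H.isInternal.submodule_iSup_eq_top]; trivial
  exact Submodule.iSup_induction _ (motive := P) this (fun p a ha => hp p a ha)
    (hp 1 0 (zero_mem _)) hadd

theorem isFactor (p : G) : IsFactor (H.inc p) (H.pr p) where
  map_mul _ _ := rfl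
  retract x := H.pr_same x.2
  mul_left x y := by
    refine H.induct (P := fun x => H.inc p (H.pr p x * y) = x * H.inc p y) ?_ ?_ x
    · intro q a ha
      by_cases h : q = p
      · subst h; rw [H.pr_same ha]; rfl
      · rw [H.pr_ne ha h, zero_mul, map_zero, inc_apply, H.mul_eq_zero q p h a ha y y.2]
    · intro a b ha hb; rw [map_add, add_mul, map_add, ha, hb, add_mul]
  mul_right x y := by
    refine H.induct (P := fun x => H.inc p (y * H.pr p x) = H.inc p y * x) ?_ ?_ x
    · intro q a ha
      by_cases h : q = p
      · subst h; rw [H.pr_same ha]; rfl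
      · rw [H.pr_ne ha h, mul_zero, map_zero, inc_apply, H.mul_eq_zero p q (Ne.symm h) y y.2 a ha]
    · intro a b ha hb; rw [map_add, mul_add, map_add, ha, hb, mul_add]

theorem nondegA (H : GCogradedMHA k G A) : NondegMul A := H.hopf.nondeg

theorem nondegAA (H : GCogradedMHA k G A) : NondegMul (A ⊗[k] A) := H.nondegA.tensor H.nondegA

theorem nondeg (p : G) : NondegMul (H.C p) := (H.isFactor p).nondeg H.nondegA

theorem nondeg₂ (p q : G) : NondegMul (H.C p ⊗[k] H.C q) := (H.nondeg p).tensor (H.nondeg q)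

theorem exists_ne_zero (p : G) : ∃ a ∈ H.comp p, a ≠ 0 := by
  by_contra! h
  exact H.comp_ne_bot p (le_bot_iff.1 fun a ha => (NonUnitalAlgebra.mem_bot (R := k)).2 (h a ha))

theorem exists_counit_eq_one (H : GCogradedMHA k G A) : ∃ a, H.hopf.counit a = 1 := by
  by_contra! h
  have h0 : H.hopf.counit = 0 := by
    ext x
    by_contra hx
    exact h ((H.hopf.counit x)⁻¹ • x) (by rw [map_smul, smul_eq_mul, inv_mul_cancel₀ hx])
  obtain ⟨a, -, ha⟩ := H.exists_ne_zero 1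
  refine ha (H.nondegA.1 a fun b => ?_)
  have := H.hopf.counit_T₁ (a ⊗ₜ b)
  rw [h0] at this
  simpa using this.symm

theorem span_mul_A (H : GCogradedMHA k G A) : Submodule.span k {y : A | ∃ a b, a * b = y} = ⊤ := by
  rw [eq_top_iff]
  rintro y -
  obtain ⟨a, ha⟩ := H.exists_counit_eq_one
  obtain ⟨w, hw⟩ := H.hopf.T₁_bij.2 (a ⊗ₜ y)
  have := H.hopf.counit_T₁ w
  rw [hw] at this
  simp only [LinearMap.rTensor_tmul, TensorProduct.lid_tmul, ha, one_smul] at this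
  rw [this]
  clear this hw
  induction w using TensorProduct.induction_on with
  | zero => simp
  | add u v hu hv => rw [map_add]; exact add_mem hu hv
  | tmul u v => exact Submodule.subset_span ⟨u, v, by simp⟩

theorem span_mul (p : G) : Submodule.span k {y : H.C p | ∃ a b, a * b = y} = ⊤ := by
  rw [eq_top_iff]
  rintro y -
  have hy : (y : A) ∈ Submodule.span k {y : A | ∃ a b, a * b = y} := by
    rw [H.span_mul_A]; trivial
  have := Submodule.mem_map_of_mem (f := H.pr p) hy
  rw [H.pr_same y.2, Submodule.map_span] at this
  refine Submodule.span_mono ?_ this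
  rintro _ ⟨_, ⟨a, b, rfl⟩, rfl⟩
  exact ⟨H.pr p a, H.pr p b, ((H.isFactor p).r_mul H.nondegA a b).symm⟩

theorem mul_induct (p : G) {P : H.C p → Prop} (hp : ∀ a b, P (a * b))
    (hadd : ∀ a b, P a → P b → P (a + b)) (a : H.C p) : P a := by
  have : a ∈ LinearMap.range (TensorProduct.lift (LinearMap.mul k (H.C p))) := by
    rw [range_lift_eq]
    exact (H.span_mul p).symm ▸ trivial
  obtain ⟨u, rfl⟩ := this
  induction u using TensorProduct.induction_on with
  | zero => simpa using hp 0 0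
  | tmul x y => exact hp x y
  | add u v hu hv => rw [map_add]; exact hadd _ _ hu hv

/-- The component `Δ_{s,t} : A → M(A_s ⊗ A_t)` of the comultiplication (it vanishes on `A_p` for
`p ≠ s t`). -/
def comul (s t : G) : A →ₗ[k] Mult k (H.C s ⊗[k] H.C t) :=
  Mult.restrict ((H.isFactor s).tensor (H.isFactor t)) ∘ₗ H.Δ

theorem comul_mul (s t : G) (a b : A) : H.comul s t (a * b) = H.comul s t a * H.comul s t b := by
  simp only [comul, LinearMap.comp_apply, H.hopf.map_mul]
  exact ((H.isFactor s).tensor (H.isFactor t)).restrict_mul H.nondegAA _ _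

/-- The projection `A ⊗ A → A_s ⊗ A_t`. -/
def pr₂ (s t : G) : A ⊗[k] A →ₗ[k] H.C s ⊗[k] H.C t := TensorProduct.map (H.pr s) (H.pr t)

theorem comul_oneTmul (s t : G) (a b : A) :
    H.comul s t a * Mult.tmul 1 (Mult.incl (H.pr t b)) =
      Mult.incl (H.pr₂ s t (H.hopf.T₁ (a ⊗ₜ b))) := by
  have h := (H.isFactor s).tensor (H.isFactor t)
  rw [pr₂, ← h.restrict_incl H.nondegAA, H.hopf.incl_T₁, h.restrict_mul H.nondegAA, oneTmul,
    Mult.restrict_tmul (H.isFactor s) (H.isFactor t), Mult.restrict_one, (H.isFactor t).restrict_incl H.nondegA]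
  rfl

theorem tmulOne_comul (s t : G) (a b : A) :
    Mult.tmul (Mult.incl (H.pr s a)) 1 * H.comul s t b =
      Mult.incl (H.pr₂ s t (H.hopf.T₂ (a ⊗ₜ b))) := by
  have h := (H.isFactor s).tensor (H.isFactor t)
  rw [pr₂, ← h.restrict_incl H.nondegAA, H.hopf.incl_T₂, h.restrict_mul H.nondegAA, tmulOne,
    Mult.restrict_tmul (H.isFactor s) (H.isFactor t), Mult.restrict_one, (H.isFactor s).restrict_incl H.nondegA]
  rfl

theorem T₁_mem {r t : G} {a b : A} (ha : a ∈ H.comp (r * t)) (hb : b ∈ H.comp t) :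
    H.hopf.T₁ (a ⊗ₜ b) ∈ Submodule.span k {z | ∃ x ∈ H.comp r, ∃ y ∈ H.comp t, x ⊗ₜ[k] y = z} := by
  have h1 : (Mult.incl (H.hopf.T₁ (a ⊗ₜ b)) : Mult k (A ⊗[k] A)) ∈ Submodule.map Mult.incl
      (Submodule.span k {z | ∃ x ∈ H.comp r, ∃ y ∈ H.comp t, x ⊗ₜ[k] y = z}) := by
    have h2 := H.comul_left r t
    rw [H.hopf.incl_T₁]
    have h3 : H.Δ a * oneTmul b ∈
        Submodule.span k {m | ∃ a ∈ H.comp r, ∃ b ∈ H.comp t, Mult.incl (a ⊗ₜ[k] b) = m} := by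
      rw [← h2]; exact Submodule.subset_span ⟨a, ha, b, hb, rfl⟩
    rw [Submodule.map_span]
    refine Submodule.span_mono ?_ h3
    rintro _ ⟨x, hx, y, hy, rfl⟩
    exact ⟨_, ⟨x, hx, y, hy, rfl⟩, rfl⟩
  obtain ⟨z, hz, e⟩ := h1
  rwa [← incl_injective (k := k) H.nondegAA e]

theorem comul_eq_zero {p s t : G} (h : p ≠ s * t) {a : A} (ha : a ∈ H.comp p) :
    H.comul s t a = 0 := by
  have h0 : ∀ b : H.C t, H.comul s t a * Mult.tmul 1 (Mult.incl b) = 0 := by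
    intro b
    have : H.pr t b = b := H.pr_same b.2
    rw [← this, comul_oneTmul]
    have hm := H.T₁_mem (r := p * t⁻¹) (t := t) (a := a) (b := b) (by simpa using ha) b.2
    have : H.pr₂ s t (H.hopf.T₁ (a ⊗ₜ b)) = 0 := by
      refine Submodule.span_induction (p := fun z _ => H.pr₂ s t z = 0) ?_ ?_ ?_ ?_ hm
      · rintro _ ⟨x, hx, y, hy, rfl⟩
        rw [pr₂, TensorProduct.map_tmul, H.pr_ne hx, TensorProduct.zero_tmul]
        rintro rfl; exact h (by simp)
      · exact map_zero _
      · intro x y _ _ hx hy; rw [map_add, hx, hy, add_zero]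
      · intro c x _ hx; rw [map_smul, hx, smul_zero]
    rw [this, map_zero]
  refine Mult.ext_l (H.nondeg₂ s t) fun z => ?_
  change _ = (0 : H.C s ⊗[k] H.C t)
  induction z using TensorProduct.induction_on with
  | zero => simp
  | add u v hu hv => rw [map_add, hu, hv, add_zero]
  | tmul x y =>
    refine H.mul_induct t (P := fun y => (H.comul s t a).l (x ⊗ₜ y) = 0) ?_ ?_ y
    · intro b y
      have := congrArg (fun m : Mult k (H.C s ⊗[k] H.C t) => m.l (x ⊗ₜ y)) (h0 b)
      simpa using this
    · intro y y' hy hy'; rw [TensorProduct.tmul_add, map_add, hy, hy', add_zero]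

theorem comul_pr {p s t : G} (h : s * t = p) (a : A) :
    H.comul s t (H.pr p a) = H.comul s t a := by
  refine H.induct (P := fun a => H.comul s t (H.pr p a) = H.comul s t a) ?_ ?_ a
  · intro q a ha
    by_cases hq : q = p
    · subst hq; rw [H.pr_same ha]
    · rw [H.pr_ne ha hq, H.comul_eq_zero (h ▸ hq) ha]; simp
  · intro a b ha hb; simp only [map_add, ← ha, ← hb]; simp

/-- `Δ_{s,t} : A_p → M(A_s ⊗ A_t)` for `p = s t`, as a non-degenerate homomorphism. -/
def comulHom {s t p : G} (h : s * t = p) : NondegHom k (H.C p) (H.C s ⊗[k] H.C t) where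
  toLin := H.comul s t ∘ₗ H.inc p
  map_mul a b := H.comul_mul s t a b
  span_left := by
    subst h
    rw [eq_top_iff]
    rintro z -
    have key : ∀ (x : H.C s) (y : H.C t) (w : H.C s ⊗[k] H.C t), (x ⊗ₜ y) * w ∈
        Submodule.span k {y | ∃ (b : H.C (s * t)) (c : _),
          ((H.comul s t ∘ₗ H.inc _) b).l c = y} := by
      intro x y w
      have h1 : (Mult.incl ((x : A) ⊗ₜ[k] (y : A)) : Mult k (A ⊗[k] A)) ∈
          Submodule.span k {m | ∃ a ∈ H.comp (s * t), ∃ b ∈ H.comp t, H.Δ a * oneTmul b = m} := by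
        rw [H.comul_left]; exact Submodule.subset_span ⟨x, x.2, y, y.2, rfl⟩
      let ev : Mult k (A ⊗[k] A) →ₗ[k] H.C s ⊗[k] H.C t :=
        { toFun := fun m => (Mult.restrict ((H.isFactor s).tensor (H.isFactor t)) m).l w
          map_add' := by simp
          map_smul' := by simp }
      have h2 := Submodule.mem_map_of_mem (f := ev) h1
      have h3 : ev (Mult.incl ((x : A) ⊗ₜ[k] (y : A))) = (x ⊗ₜ y) * w := by
        change (Mult.restrict ((H.isFactor s).tensor (H.isFactor t)) _).l w = _
        rw [((H.isFactor s).tensor (H.isFactor t)).restrict_incl H.nondegAA]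
        rw [Mult.incl_l, TensorProduct.map_tmul, H.pr_same x.2, H.pr_same y.2]
      rw [h3, Submodule.map_span] at h2
      refine Submodule.span_mono ?_ h2
      rintro _ ⟨_, ⟨a, ha, b, hb, rfl⟩, rfl⟩
      refine ⟨⟨a, ha⟩, (Mult.tmul 1 (Mult.incl (⟨b, hb⟩ : H.C t))).l w, ?_⟩
      change _ = (Mult.restrict ((H.isFactor s).tensor (H.isFactor t)) _).l w
      rw [((H.isFactor s).tensor (H.isFactor t)).restrict_mul H.nondegAA, oneTmul,
        Mult.restrict_tmul (H.isFactor s) (H.isFactor t), Mult.restrict_one, (H.isFactor t).restrict_incl H.nondegA,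
        H.pr_same hb]
      rfl
    induction z using TensorProduct.induction_on with
    | zero => exact zero_mem _
    | add u v hu hv => exact add_mem hu hv
    | tmul x y =>
      refine H.mul_induct s (P := fun x => ∀ y, x ⊗ₜ[k] y ∈ _) ?_ ?_ x y
      · intro x x' y
        refine H.mul_induct t (P := fun y => (x * x') ⊗ₜ[k] y ∈ _) ?_ ?_ y
        · intro y y'
          have := key x y (x' ⊗ₜ y')
          rwa [Algebra.TensorProduct.tmul_mul_tmul] at this
        · intro y y' hy hy'; rw [TensorProduct.tmul_add]; exact add_mem hy hy'
      · intro x x' hx hx' y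
        rw [TensorProduct.add_tmul]; exact add_mem (hx y) (hx' y)
  span_right := by
    subst h
    rw [eq_top_iff]
    rintro z -
    have key : ∀ (x : H.C s) (y : H.C t) (w : H.C s ⊗[k] H.C t), w * (x ⊗ₜ y) ∈
        Submodule.span k {y | ∃ (b : H.C (s * t)) (c : _),
          ((H.comul s t ∘ₗ H.inc _) b).r c = y} := by
      intro x y w
      have h1 : (Mult.incl ((x : A) ⊗ₜ[k] (y : A)) : Mult k (A ⊗[k] A)) ∈
          Submodule.span k {m | ∃ a ∈ H.comp s, ∃ b ∈ H.comp (s * t), tmulOne a * H.Δ b = m} := by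
        rw [H.comul_right]; exact Submodule.subset_span ⟨x, x.2, y, y.2, rfl⟩
      let ev : Mult k (A ⊗[k] A) →ₗ[k] H.C s ⊗[k] H.C t :=
        { toFun := fun m => (Mult.restrict ((H.isFactor s).tensor (H.isFactor t)) m).r w
          map_add' := by simp
          map_smul' := by simp }
      have h2 := Submodule.mem_map_of_mem (f := ev) h1
      have h3 : ev (Mult.incl ((x : A) ⊗ₜ[k] (y : A))) = w * (x ⊗ₜ y) := by
        change (Mult.restrict ((H.isFactor s).tensor (H.isFactor t)) _).r w = _
        rw [((H.isFactor s).tensor (H.isFactor t)).restrict_incl H.nondegAA]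
        rw [Mult.incl_r, TensorProduct.map_tmul, H.pr_same x.2, H.pr_same y.2]
      rw [h3, Submodule.map_span] at h2
      refine Submodule.span_mono ?_ h2
      rintro _ ⟨_, ⟨a, ha, b, hb, rfl⟩, rfl⟩
      refine ⟨⟨b, hb⟩, (Mult.tmul (Mult.incl (⟨a, ha⟩ : H.C s)) 1).r w, ?_⟩
      change _ = (Mult.restrict ((H.isFactor s).tensor (H.isFactor t)) _).r w
      rw [((H.isFactor s).tensor (H.isFactor t)).restrict_mul H.nondegAA, tmulOne,
        Mult.restrict_tmul (H.isFactor s) (H.isFactor t), Mult.restrict_one, (H.isFactor s).restrict_incl H.nondegA,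
        H.pr_same ha]
      rfl
    induction z using TensorProduct.induction_on with
    | zero => exact zero_mem _
    | add u v hu hv => exact add_mem hu hv
    | tmul x y =>
      refine H.mul_induct s (P := fun x => ∀ y, x ⊗ₜ[k] y ∈ _) ?_ ?_ x y
      · intro x x' y
        refine H.mul_induct t (P := fun y => (x * x') ⊗ₜ[k] y ∈ _) ?_ ?_ y
        · intro y y'
          have := key x' y' (x ⊗ₜ y)
          rwa [Algebra.TensorProduct.tmul_mul_tmul] at this
        · intro y y' hy hy'; rw [TensorProduct.tmul_add]; exact add_mem hy hy'
      · intro x x' hx hx' y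
        rw [TensorProduct.add_tmul]; exact add_mem (hx y) (hx' y)

@[simp] theorem comulHom_apply {s t p : G} (h : s * t = p) (a : H.C p) :
    (H.comulHom h).toLin a = H.comul s t a := rfl

/-- The counit vanishes on `A_p` for `p ≠ 1`. -/
theorem counit_eq_zero {p : G} (h : p ≠ 1) {a : A} (ha : a ∈ H.comp p) :
    H.hopf.counit a = 0 := by
  obtain ⟨b, hb, hb0⟩ := H.exists_ne_zero 1
  have h1 : (Mult.incl (a ⊗ₜ[k] b) : Mult k (A ⊗[k] A)) ∈
      Submodule.span k {m | ∃ a ∈ H.comp (p * 1), ∃ b ∈ H.comp 1, H.Δ a * oneTmul b = m} := by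
    rw [H.comul_left]; exact Submodule.subset_span ⟨a, ha, b, hb, rfl⟩
  have h2 : a ⊗ₜ[k] b ∈ Submodule.span k
      {z | ∃ a ∈ H.comp p, ∃ b ∈ H.comp 1, H.hopf.T₁ (a ⊗ₜ b) = z} := by
    have : (Mult.incl (a ⊗ₜ[k] b) : Mult k (A ⊗[k] A)) ∈ Submodule.map Mult.incl
        (Submodule.span k {z | ∃ a ∈ H.comp p, ∃ b ∈ H.comp 1, H.hopf.T₁ (a ⊗ₜ b) = z}) := by
      rw [Submodule.map_span]
      refine Submodule.span_mono ?_ h1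
      rintro _ ⟨x, hx, y, hy, rfl⟩
      exact ⟨_, ⟨x, by simpa using hx, y, hy, rfl⟩, H.hopf.incl_T₁ x y⟩
    obtain ⟨z, hz, e⟩ := this
    rwa [← incl_injective (k := k) H.nondegAA e]
  have h3 : TensorProduct.lid k A (H.hopf.counit.rTensor A (a ⊗ₜ b)) = 0 := by
    refine Submodule.span_induction
      (p := fun z _ => TensorProduct.lid k A (H.hopf.counit.rTensor A z) = 0) ?_ ?_ ?_ ?_ h2
    · rintro _ ⟨x, hx, y, hy, rfl⟩
      rw [H.hopf.counit_T₁]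
      simpa using H.mul_eq_zero p 1 h x hx y hy
    · simp
    · intro x y _ _ hx hy; simp only [map_add, hx, hy, add_zero]
    · intro c x _ hx; simp only [map_smul, hx, smul_zero]
  simp only [LinearMap.rTensor_tmul, TensorProduct.lid_tmul] at h3
  exact (smul_eq_zero.1 h3).resolve_right hb0

theorem counit_pr (a : A) : H.hopf.counit (H.pr 1 a) = H.hopf.counit a := by
  refine H.induct (P := fun a => H.hopf.counit (H.pr 1 a) = H.hopf.counit a) ?_ ?_ a
  · intro q a ha
    by_cases hq : q = 1
    · subst hq; rw [H.pr_same ha]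
    · rw [H.pr_ne ha hq, H.counit_eq_zero hq ha]; simp
  · intro a b ha hb; rw [map_add, NonUnitalSubalgebra.coe_add, map_add, ha, hb, map_add]

end GCogradedMHA

namespace MultiplierHopfTCoalgebra

variable {k G A : Type*} [Field k] [Group G] [DecidableEq G]
  [NonUnitalRing A] [Module k A] [IsScalarTower k A A] [SMulCommClass k A A]
  (H : MultiplierHopfTCoalgebra k G A)

theorem π_mem {q s t : G} (h : q * s * q⁻¹ = t) {a : A} (ha : a ∈ H.comp s) :
    H.π q a ∈ H.comp t := by
  have := H.π_comp q s
  rw [h] at this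
  exact this.le ⟨a, ha, rfl⟩

theorem π_inv_apply (q : G) (a : A) : H.π q⁻¹ (H.π q a) = a := by
  rw [← LinearEquiv.mul_apply, ← map_mul]; simp

theorem π_apply_inv (q : G) (a : A) : H.π q (H.π q⁻¹ a) = a := by
  rw [← LinearEquiv.mul_apply, ← map_mul]; simp

/-- The isomorphism `π_q : A_s → A_t` for `t = q s q⁻¹`. -/
def piIso (q : G) {s t : G} (h : q * s * q⁻¹ = t) : AlgIso k (H.C s) (H.C t) where
  toFun x := ⟨H.π q x, H.π_mem h x.2⟩
  invFun x := ⟨H.π q⁻¹ x, H.π_mem (by rw [← h]; group) x.2⟩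
  map_add' _ _ := by ext; simp
  map_smul' _ _ := by ext; simp
  left_inv x := by ext; simp
  right_inv x := by ext; simp
  map_mul' _ _ := by ext; simp [H.π_mul]

@[simp] theorem piIso_coe (q : G) {s t : G} (h : q * s * q⁻¹ = t) (x : H.C s) :
    ((H.piIso q h).toLinearEquiv x : A) = H.π q x := rfl

theorem pr_π (q : G) {s t : G} (h : q * s * q⁻¹ = t) (a : A) :
    H.pr t (H.π q a) = (H.piIso q h).toLinearEquiv (H.pr s a) := by
  refine H.induct (P := fun a => H.pr t (H.π q a) = (H.piIso q h).toLinearEquiv (H.pr s a)) ?_ ?_ a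
  · intro p a ha
    by_cases hp : p = s
    · subst hp; rw [H.pr_same ha, H.pr_same (H.π_mem h ha)]; rfl
    · rw [H.pr_ne ha hp, H.pr_ne (H.π_mem rfl ha), map_zero]
      rw [← h]; simpa using hp
  · intro a b ha hb; simp only [map_add, ha, hb]

theorem comul_pi (q : G) {s t s' t' : G} (hs : q * s * q⁻¹ = s') (ht : q * t * q⁻¹ = t') (a : A) :
    H.comul s' t' (H.π q a) =
      Mult.congr (AlgIso.tensor (H.piIso q hs) (H.piIso q ht)) (H.comul s t a) := by
  have hpr : ∀ z, TensorProduct.map (H.pr s') (H.pr t')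
      (TensorProduct.map (H.π q).toLinearMap (H.π q).toLinearMap z) =
      TensorProduct.map (H.piIso q hs).toLinearEquiv.toLinearMap
        (H.piIso q ht).toLinearEquiv.toLinearMap (TensorProduct.map (H.pr s) (H.pr t) z) := by
    intro z
    induction z using TensorProduct.induction_on with
    | zero => simp
    | add u v hu hv => simp only [map_add, hu, hv]
    | tmul x y => simp [H.pr_π q hs, H.pr_π q ht]
  have hsymm : ∀ z, (TensorProduct.congr (H.π q) (H.π q)).symm
      (TensorProduct.map (H.inc s') (H.inc t') z) =
      TensorProduct.map (H.inc s) (H.inc t)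
        (TensorProduct.congr (H.piIso q hs).toLinearEquiv (H.piIso q ht).toLinearEquiv |>.symm z) := by
    intro z
    obtain ⟨z, rfl⟩ := (TensorProduct.congr (H.piIso q hs).toLinearEquiv
      (H.piIso q ht).toLinearEquiv).surjective z
    rw [LinearEquiv.symm_apply_apply, LinearEquiv.symm_apply_eq]
    induction z using TensorProduct.induction_on with
    | zero => simp
    | add u v hu hv => simp only [map_add, hu, hv]
    | tmul x y => simp
  refine Mult.ext_l (H.nondeg₂ s' t') fun z => ?_
  have e1 : (H.comul s' t' (H.π q a)).l z = TensorProduct.map (H.pr s') (H.pr t')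
      (TensorProduct.map (H.π q).toLinearMap (H.π q).toLinearMap ((H.Δ a).l
        ((TensorProduct.congr (H.π q) (H.π q)).symm
          (TensorProduct.map (H.inc s') (H.inc t') z)))) := by
    change TensorProduct.map (H.pr s') (H.pr t') ((H.Δ (H.π q a)).l _) = _
    rw [H.comul_π]; rfl
  rw [e1, hpr, hsymm]
  rfl

end MultiplierHopfTCoalgebra

/-! ## Left `A`-`G`-modules -/

section DirectSumAct

variable {k B ι : Type*} [Field k] [DecidableEq ι]
  [NonUnitalRing B] [Module k B] [IsScalarTower k B B] [SMulCommClass k B B]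
  {X : ι → Type*} [∀ i, AddCommGroup (X i)] [∀ i, Module k (X i)]

/-- The direct sum of modules. -/
def directSumAct (act : ∀ i, B →ₗ[k] X i →ₗ[k] X i) : B →ₗ[k] (⨁ i, X i) →ₗ[k] (⨁ i, X i) where
  toFun b := DirectSum.lmap fun i => act i b
  map_add' _ _ := by ext; simp
  map_smul' _ _ := by ext; simp

@[simp] theorem directSumAct_lof (act : ∀ i, B →ₗ[k] X i →ₗ[k] X i) (b : B) (i : ι) (x : X i) :
    directSumAct act b (DirectSum.lof k ι X i x) = DirectSum.lof k ι X i (act i b x) := by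
  simp [directSumAct]

theorem IsUnitalModule.directSum {act : ∀ i, B →ₗ[k] X i →ₗ[k] X i}
    (h : ∀ i, IsUnitalModule (act i)) : IsUnitalModule (directSumAct act) where
  mul_act a b x := by
    have : directSumAct act (a * b) = directSumAct act a ∘ₗ directSumAct act b := by
      ext i x : 2
      simp [(h i).mul_act]
    rw [this]; rfl
  unital := by
    rw [eq_top_iff]
    rintro x -
    induction x using DirectSum.induction_on with
    | zero => exact zero_mem _
    | add x y hx hy => exact add_mem hx hy
    | of i x =>
      refine (h i).induct (p := fun x => DirectSum.lof k ι X i x ∈ _) ?_ ?_ x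
      · intro b x; exact Submodule.subset_span ⟨b, DirectSum.lof k ι X i x, by simp⟩
      · intro x y hx hy; rw [map_add]; exact add_mem hx hy
  nondeg x hx := by
    ext i : 1
    refine (h i).nondeg _ fun b => ?_
    have := congrArg (fun y => y i) (hx b)
    simpa [directSumAct] using this

end DirectSumAct

theorem IsUnitalModule.ext_map_congr {k B C X Y : Type*} [Field k]
    [NonUnitalRing B] [Module k B] [IsScalarTower k B B] [SMulCommClass k B B]
    [NonUnitalRing C] [Module k C] [IsScalarTower k C C] [SMulCommClass k C C]
    [AddCommGroup X] [Module k X] [AddCommGroup Y] [Module k Y]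
    {act : B →ₗ[k] X →ₗ[k] X} {act' : C →ₗ[k] Y →ₗ[k] Y}
    (h : IsUnitalModule act) (h' : IsUnitalModule act') (e : AlgIso k B C) (f : X →ₗ[k] Y)
    (hf : ∀ b x, f (act b x) = act' (e.toLinearEquiv b) (f x)) (m : Mult k B) (x : X) :
    f (h.ext m x) = h'.ext (Mult.congr e m) (f x) := by
  refine h.induct (p := fun x => f (h.ext m x) = h'.ext (Mult.congr e m) (f x)) ?_ ?_ x
  · intro c x
    rw [ext_act, hf, hf, ext_act, Mult.congr_l, LinearEquiv.symm_apply_apply]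
  · intro x y hx hy; simp only [map_add, hx, hy]

theorem IsUnitalModule.ext_tmul {k B C X Y : Type*} [Field k]
    [NonUnitalRing B] [Module k B] [IsScalarTower k B B] [SMulCommClass k B B]
    [NonUnitalRing C] [Module k C] [IsScalarTower k C C] [SMulCommClass k C C]
    [AddCommGroup X] [Module k X] [AddCommGroup Y] [Module k Y]
    {act : B →ₗ[k] X →ₗ[k] X} {act' : C →ₗ[k] Y →ₗ[k] Y}
    (h : IsUnitalModule act) (h' : IsUnitalModule act') (m : Mult k B) (n : Mult k C)
    (z : X ⊗[k] Y) :
    (h.tensor h').ext (Mult.tmul m n) z = TensorProduct.map (h.ext m) (h'.ext n) z := by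
  refine (h.tensor h').ext_unique _ _ (fun b z => ?_) z
  induction b using TensorProduct.induction_on with
  | zero => simp
  | add u v hu hv => simp only [map_add, LinearMap.add_apply, hu, hv]
  | tmul b c =>
    induction z using TensorProduct.induction_on with
    | zero => simp
    | add u v hu hv => simp only [map_add, hu, hv]
    | tmul x y => simp [h.ext_act, h'.ext_act]

section Modules

variable {k G A : Type u} [Field k] [Group G] [DecidableEq G]
  [NonUnitalRing A] [Module k A] [IsScalarTower k A A] [SMulCommClass k A A]

/-- A left `A`-`G`-module: a family `M_p` of unital (non-degenerate) left `A_p`-modules. -/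
structure AGModule (H : GCogradedMHA k G A) where
  carrier : G → Type u
  [addCommGroup : ∀ p, AddCommGroup (carrier p)]
  [module : ∀ p, Module k (carrier p)]
  act : ∀ p, H.C p →ₗ[k] carrier p →ₗ[k] carrier p
  unital : ∀ p, IsUnitalModule (act p)

attribute [instance] AGModule.addCommGroup AGModule.module

/-- The pairs `(s, t)` with `s t = p`. -/
abbrev Fib {G : Type u} [Group G] (p : G) := {x : G × G // x.1 * x.2 = p}

namespace AGModule

variable {H : GCogradedMHA k G A} (L M N : AGModule H)

/-- `M_s ⊗ N_t` is a unital `A_s ⊗ A_t`-module. -/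
theorem unital₂ (s t : G) : IsUnitalModule (tensorAct (M.act s) (N.act t)) :=
  (M.unital s).tensor (N.unital t)

/-- `M_s ⊗ N_t` as an `A_p`-module for `p = s t`: `a (m ⊗ n) = a₍₁,s₎ m ⊗ a₍₂,t₎ n`, that is,
`Δ_{s,t}(a) ∈ M(A_s ⊗ A_t)` acts on the unital `A_s ⊗ A_t`-module `M_s ⊗ N_t`. -/
def pairAct {s t p : G} (h : s * t = p) :
    H.C p →ₗ[k] M.carrier s ⊗[k] N.carrier t →ₗ[k] M.carrier s ⊗[k] N.carrier t :=
  pullAct (H.comulHom h) (M.unital₂ N s t)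

theorem pairAct_apply {s t p : G} (h : s * t = p) (a : H.C p)
    (z : M.carrier s ⊗[k] N.carrier t) :
    M.pairAct N h a z = (M.unital₂ N s t).ext (H.comul s t a) z := rfl

theorem pairAct_unital {s t p : G} (h : s * t = p) : IsUnitalModule (M.pairAct N h) :=
  (M.unital₂ N s t).pull _

/-- The tensor product `(M ⊗ N)_p = ⨁_{s t = p} M_s ⊗ N_t`. -/
def tensor : AGModule H where
  carrier p := ⨁ x : Fib p, M.carrier x.1.1 ⊗[k] N.carrier x.1.2
  act _ := directSumAct fun x => M.pairAct N x.2
  unital _ := IsUnitalModule.directSum fun x => M.pairAct_unital N x.2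

/-- The inclusion of the summand `M_s ⊗ N_t` in `(M ⊗ N)_p`. -/
def tmk {s t p : G} (h : s * t = p) :
    M.carrier s ⊗[k] N.carrier t →ₗ[k] (M.tensor N).carrier p :=
  DirectSum.lof k (Fib p) (fun x => M.carrier x.1.1 ⊗[k] N.carrier x.1.2) ⟨(s, t), h⟩

variable {M N} in
/-- The linear map on `(M ⊗ N)_p` with given restrictions to the summands. -/
def tdesc {p : G} {W : Type*} [AddCommGroup W] [Module k W]
    (f : ∀ s t : G, s * t = p → M.carrier s ⊗[k] N.carrier t →ₗ[k] W) :
    (M.tensor N).carrier p →ₗ[k] W :=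
  DirectSum.toModule k (Fib p) W fun x => f x.1.1 x.1.2 x.2

@[simp] theorem tdesc_tmk {p : G} {W : Type*} [AddCommGroup W] [Module k W]
    (f : ∀ s t : G, s * t = p → M.carrier s ⊗[k] N.carrier t →ₗ[k] W) {s t : G} (h : s * t = p)
    (z : M.carrier s ⊗[k] N.carrier t) : tdesc f (M.tmk N h z) = f s t h z :=
  DirectSum.toModule_lof k (ι := Fib p) (φ := fun x => f x.1.1 x.1.2 x.2) ⟨(s, t), h⟩ z

variable {M N} in
theorem tensor_ext {p : G} {W : Type*} [AddCommGroup W] [Module k W]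
    {f g : (M.tensor N).carrier p →ₗ[k] W}
    (h : ∀ (s t : G) (h : s * t = p) m n, f (M.tmk N h (m ⊗ₜ n)) = g (M.tmk N h (m ⊗ₜ n))) :
    f = g := by
  refine DirectSum.linearMap_ext k (ι := Fib p) fun x => ?_
  obtain ⟨⟨s, t⟩, hx⟩ := x
  exact TensorProduct.ext' fun m n => h s t hx m n

theorem act_tmk {s t p : G} (h : s * t = p) (a : H.C p) (z : M.carrier s ⊗[k] N.carrier t) :
    (M.tensor N).act p a (M.tmk N h z) = M.tmk N h (M.pairAct N h a z) :=
  directSumAct_lof (X := fun x : Fib p => M.carrier x.1.1 ⊗[k] N.carrier x.1.2)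
    (fun x => M.pairAct N x.2) a ⟨(s, t), h⟩ z

/-- `Δ(b) (x ⊗ c y) = (Δ(b)(1 ⊗ c)) (x ⊗ y)`. -/
theorem ext_comul_tmul {X Y : Type*} [AddCommGroup X] [Module k X] [AddCommGroup Y] [Module k Y]
    {s t : G} {act : H.C s →ₗ[k] X →ₗ[k] X} {act' : H.C t →ₗ[k] Y →ₗ[k] Y}
    (h : IsUnitalModule act) (h' : IsUnitalModule act') (b c : A) (x : X) (y : Y) :
    (h.tensor h').ext (H.comul s t b) (x ⊗ₜ act' (H.pr t c) y) =
      tensorAct act act' (H.pr₂ s t (H.hopf.T₁ (b ⊗ₜ c))) (x ⊗ₜ y) := by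
  rw [← (h.tensor h').ext_incl, ← H.comul_oneTmul, IsUnitalModule.ext_mul, h.ext_tmul h']
  simp [h.ext_one, h'.ext_incl]

/-- `(a ⊗ 1) (Δ(b) z) = ((a ⊗ 1)Δ(b)) z`. -/
theorem tmul_ext_comul {X Y : Type*} [AddCommGroup X] [Module k X] [AddCommGroup Y] [Module k Y]
    {s t : G} {act : H.C s →ₗ[k] X →ₗ[k] X} {act' : H.C t →ₗ[k] Y →ₗ[k] Y}
    (h : IsUnitalModule act) (h' : IsUnitalModule act') (a b : A) (z : X ⊗[k] Y) :
    TensorProduct.map (act (H.pr s a)) LinearMap.id ((h.tensor h').ext (H.comul s t b) z) =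
      tensorAct act act' (H.pr₂ s t (H.hopf.T₂ (a ⊗ₜ b))) z := by
  rw [← (h.tensor h').ext_incl, ← H.tmulOne_comul, IsUnitalModule.ext_mul, h.ext_tmul h']
  congr 2
  · ext x; rw [h.ext_incl]
  · ext x; rw [h'.ext_one]; rfl

/-- Coassociativity on modules. -/
theorem assoc_pairAct {X Y Z : Type*} [AddCommGroup X] [Module k X] [AddCommGroup Y] [Module k Y]
    [AddCommGroup Z] [Module k Z] {q r t s u : G} (hs : q * r = s) (hu : r * t = u)
    {actX : H.C q →ₗ[k] X →ₗ[k] X} {actY : H.C r →ₗ[k] Y →ₗ[k] Y} {actZ : H.C t →ₗ[k] Z →ₗ[k] Z}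
    (hX : IsUnitalModule actX) (hY : IsUnitalModule actY) (hZ : IsUnitalModule actZ) (a : A)
    (w : (X ⊗[k] Y) ⊗[k] Z) :
    TensorProduct.assoc k X Y Z
      ((((hX.tensor hY).pull (H.comulHom hs)).tensor hZ).ext (H.comul s t a) w) =
    (hX.tensor ((hY.tensor hZ).pull (H.comulHom hu))).ext (H.comul q u a)
      (TensorProduct.assoc k X Y Z w) := by
  induction w using TensorProduct.induction_on with
  | zero => simp
  | add w w' h h' => simp only [map_add, h, h']
  | tmul v z =>
    refine hZ.induct (p := fun z => TensorProduct.assoc k X Y Z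
      ((((hX.tensor hY).pull (H.comulHom hs)).tensor hZ).ext (H.comul s t a) (v ⊗ₜ z)) =
      (hX.tensor ((hY.tensor hZ).pull (H.comulHom hu))).ext (H.comul q u a)
      (TensorProduct.assoc k X Y Z (v ⊗ₜ z))) ?_ ?_ z
    swap
    · intro z z' h h'; simp only [TensorProduct.tmul_add, map_add, h, h']
    intro c z
    have hc : H.pr t (c : A) = c := H.pr_same c.2
    rw [← sub_eq_zero]
    refine tensor_faithful_left (f := fun p => actX p) hX.nondeg _ fun p => ?_
    have hp : H.pr q (p : A) = p := H.pr_same p.2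
    rw [map_sub, sub_eq_zero]
    -- the action of `A ⊗ A ⊗ A` on `v ⊗ z`
    let Ξ : (A ⊗[k] A) ⊗[k] A →ₗ[k] X ⊗[k] (Y ⊗[k] Z) :=
      (TensorProduct.assoc k X Y Z).toLinearMap ∘ₗ
        (LinearMap.applyₗ (v ⊗ₜ[k] z)) ∘ₗ tensorAct (tensorAct actX actY) actZ ∘ₗ
        TensorProduct.map (H.pr₂ q r) (H.pr t)
    have hL : ∀ ζ : A ⊗[k] A, TensorProduct.map (actX p) LinearMap.id
        (TensorProduct.assoc k X Y Z (tensorAct (pullAct (H.comulHom hs) (hX.tensor hY)) actZ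
          (H.pr₂ s t ζ) (v ⊗ₜ z))) =
        Ξ (TensorProduct.map H.hopf.T₂ LinearMap.id
          ((TensorProduct.assoc k A A A).symm ((p : A) ⊗ₜ ζ))) := by
      intro ζ
      induction ζ using TensorProduct.induction_on with
      | zero => simp
      | add w w' h h' => simp only [map_add, LinearMap.add_apply, TensorProduct.tmul_add, h, h']
      | tmul b c' =>
        have e1 : ∀ y : (X ⊗[k] Y), TensorProduct.map (actX p) LinearMap.id
            (TensorProduct.assoc k X Y Z (y ⊗ₜ actZ (H.pr t c') z)) =
            TensorProduct.assoc k X Y Z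
              (TensorProduct.map (actX p) LinearMap.id y ⊗ₜ actZ (H.pr t c') z) := by
          intro y
          induction y using TensorProduct.induction_on with
          | zero => simp
          | add w w' h h' => simp only [map_add, TensorProduct.add_tmul, h, h']
          | tmul x y => simp
        simp only [GCogradedMHA.pr₂, TensorProduct.map_tmul, tensorAct_tmul, Ξ,
          LinearMap.comp_apply, TensorProduct.assoc_symm_tmul, LinearMap.applyₗ_apply_apply,
          LinearMap.id_apply, LinearEquiv.coe_coe]
        rw [e1, pullAct_apply, GCogradedMHA.comulHom_apply, H.comul_pr hs]
        have := tmul_ext_comul hX hY p b v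
        rw [hp] at this
        rw [this]
        rfl
    have hR : ∀ η : A ⊗[k] A,
        tensorAct actX (pullAct (H.comulHom hu) (hY.tensor hZ)) (H.pr₂ q u η)
          (TensorProduct.assoc k X Y Z (v ⊗ₜ actZ c z)) =
        Ξ ((TensorProduct.assoc k A A A).symm (TensorProduct.map LinearMap.id H.hopf.T₁
          (TensorProduct.assoc k A A A (η ⊗ₜ (c : A))))) := by
      intro η
      induction η using TensorProduct.induction_on with
      | zero => simp
      | add w w' h h' => simp only [map_add, LinearMap.add_apply, TensorProduct.add_tmul, h, h']
      | tmul b b' =>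
        have e2 : ∀ τ : A ⊗[k] A, ∀ v : X ⊗[k] Y,
            TensorProduct.map (actX (H.pr q b)) (tensorAct actY actZ (H.pr₂ r t τ))
              (TensorProduct.assoc k X Y Z (v ⊗ₜ z)) =
            TensorProduct.assoc k X Y Z (tensorAct (tensorAct actX actY) actZ
              (TensorProduct.map (H.pr₂ q r) (H.pr t)
                ((TensorProduct.assoc k A A A).symm (b ⊗ₜ τ))) (v ⊗ₜ z)) := by
          intro τ v
          induction τ using TensorProduct.induction_on with
          | zero => simp
          | add w w' h h' => simp only [map_add, TensorProduct.tmul_add, TensorProduct.map_add_right,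
              LinearMap.add_apply, h, h']
          | tmul b₁ c₁ =>
            induction v using TensorProduct.induction_on with
            | zero => simp
            | add w w' h h' => simp only [map_add, TensorProduct.add_tmul, h, h']
            | tmul x y => simp [GCogradedMHA.pr₂]
        have e3 : ∀ v : X ⊗[k] Y,
            TensorProduct.map (actX (H.pr q b))
              (pullAct (H.comulHom hu) (hY.tensor hZ) (H.pr u b'))
              (TensorProduct.assoc k X Y Z (v ⊗ₜ actZ c z)) =
            TensorProduct.map (actX (H.pr q b))
              (tensorAct actY actZ (H.pr₂ r t (H.hopf.T₁ (b' ⊗ₜ (c : A)))))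
              (TensorProduct.assoc k X Y Z (v ⊗ₜ z)) := by
          intro v
          induction v using TensorProduct.induction_on with
          | zero => simp
          | add w w' h h' => simp only [map_add, TensorProduct.add_tmul, h, h']
          | tmul x y =>
            simp only [TensorProduct.assoc_tmul, TensorProduct.map_tmul]
            rw [pullAct_apply, GCogradedMHA.comulHom_apply, H.comul_pr hu]
            have := ext_comul_tmul hY hZ b' c y z
            rw [hc] at this
            rw [this]
        simp only [TensorProduct.assoc_tmul, TensorProduct.map_tmul, LinearMap.id_apply]
        refine Eq.trans (e3 v) (e2 _ v)
    have h1 := ext_comul_tmul ((hX.tensor hY).pull (H.comulHom hs)) hZ a c v z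
    have h2 := tmul_ext_comul hX ((hY.tensor hZ).pull (H.comulHom hu)) p a
      (TensorProduct.assoc k X Y Z (v ⊗ₜ actZ c z))
    rw [hc] at h1
    rw [hp] at h2
    rw [h1, h2, hL, hR, H.hopf.coassoc]

end AGModule

end Modules

namespace AGModule

variable {k G A : Type u} [Field k] [Group G] [DecidableEq G]
  [NonUnitalRing A] [Module k A] [IsScalarTower k A A] [SMulCommClass k A A]
  {H : GCogradedMHA k G A}

section TensorApp

variable {M M' N N' : AGModule H}

/-- The tensor product of two families of linear maps. -/
def tensorApp (f : ∀ p, M.carrier p →ₗ[k] M'.carrier p) (g : ∀ p, N.carrier p →ₗ[k] N'.carrier p)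
    (p : G) : (M.tensor N).carrier p →ₗ[k] (M'.tensor N').carrier p :=
  tdesc fun s t h => M'.tmk N' h ∘ₗ TensorProduct.map (f s) (g t)

theorem tensorApp_tmk (f : ∀ p, M.carrier p →ₗ[k] M'.carrier p)
    (g : ∀ p, N.carrier p →ₗ[k] N'.carrier p) {s t p : G} (h : s * t = p)
    (z : M.carrier s ⊗[k] N.carrier t) :
    tensorApp f g p (M.tmk N h z) = M'.tmk N' h (TensorProduct.map (f s) (g t) z) :=
  tdesc_tmk _ _ _ _ _

theorem tensorApp_act (f : ∀ p, M.carrier p →ₗ[k] M'.carrier p)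
    (g : ∀ p, N.carrier p →ₗ[k] N'.carrier p)
    (hf : ∀ p (a : H.C p) m, f p (M.act p a m) = M'.act p a (f p m))
    (hg : ∀ p (a : H.C p) n, g p (N.act p a n) = N'.act p a (g p n)) (p : G) (a : H.C p) (x) :
    tensorApp f g p ((M.tensor N).act p a x) = (M'.tensor N').act p a (tensorApp f g p x) := by
  refine LinearMap.congr_fun (f := tensorApp f g p ∘ₗ (M.tensor N).act p a)
    (g := (M'.tensor N').act p a ∘ₗ tensorApp f g p) (tensor_ext fun s t h m n => ?_) x
  rw [LinearMap.comp_apply, LinearMap.comp_apply, act_tmk, tensorApp_tmk, tensorApp_tmk, act_tmk]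
  congr 1
  refine IsUnitalModule.ext_map (M.unital₂ N s t) (M'.unital₂ N' s t) _ (fun b z => ?_) _ _
  induction b using TensorProduct.induction_on with
  | zero => simp
  | add u v hu hv => simp only [map_add, LinearMap.add_apply, hu, hv]
  | tmul b c =>
    induction z using TensorProduct.induction_on with
    | zero => simp
    | add u v hu hv => simp only [map_add, hu, hv]
    | tmul x y => simp [hf, hg]

end TensorApp

/-! ### The associativity constraint -/

section Assoc

variable (L M N : AGModule H)

/-- `(l ⊗ m) ⊗ n ↦ l ⊗ (m ⊗ n)`. -/
def assocApp (p : G) :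
    ((L.tensor M).tensor N).carrier p →ₗ[k] (L.tensor (M.tensor N)).carrier p :=
  tdesc (M := (L.tensor M)) (N := N) fun _ t h =>
    TensorProduct.lift (tdesc fun q r h' => TensorProduct.curry
      (L.tmk (M.tensor N) (s := q) (t := r * t) (by rw [← mul_assoc, h', h]) ∘ₗ
        (M.tmk N rfl).lTensor (L.carrier q) ∘ₗ
        (TensorProduct.assoc k (L.carrier q) (M.carrier r) (N.carrier t)).toLinearMap))

/-- `l ⊗ (m ⊗ n) ↦ (l ⊗ m) ⊗ n`. -/
def assocInvApp (p : G) :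
    (L.tensor (M.tensor N)).carrier p →ₗ[k] ((L.tensor M).tensor N).carrier p :=
  tdesc (M := L) (N := (M.tensor N)) fun q _ h =>
    TensorProduct.lift (LinearMap.flip (tdesc fun r t h' => LinearMap.flip (TensorProduct.curry
      ((L.tensor M).tmk N (s := q * r) (t := t) (by rw [mul_assoc, h', h]) ∘ₗ
        (L.tmk M rfl).rTensor (N.carrier t) ∘ₗ
        (TensorProduct.assoc k (L.carrier q) (M.carrier r) (N.carrier t)).symm.toLinearMap))))

variable {L M N}

theorem assocApp_tmk' {p q r s t u : G} (hs : q * r = s) (h : s * t = p) (hu : r * t = u)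
    (h' : q * u = p) (z : (L.carrier q ⊗[k] M.carrier r) ⊗[k] N.carrier t) :
    assocApp L M N p ((L.tensor M).tmk N h
      ((L.tmk M hs).rTensor (N.carrier t) z)) =
    L.tmk (M.tensor N) h' ((M.tmk N hu).lTensor (L.carrier q)
      (TensorProduct.assoc k _ _ _ z)) := by
  subst hu
  rw [assocApp, tdesc_tmk]
  induction z using TensorProduct.induction_on with
  | zero => simp
  | add u v hu hv => simp only [map_add, hu, hv]
  | tmul x n =>
    rw [LinearMap.rTensor_tmul, TensorProduct.lift.tmul]
    erw [tdesc_tmk]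
    rfl

theorem assocApp_tmk {p q r s t u : G} (hs : q * r = s) (h : s * t = p) (hu : r * t = u)
    (h' : q * u = p) (l : L.carrier q) (m : M.carrier r) (n : N.carrier t) :
    assocApp L M N p ((L.tensor M).tmk N h (L.tmk M hs (l ⊗ₜ m) ⊗ₜ n)) =
    L.tmk (M.tensor N) h' (l ⊗ₜ M.tmk N hu (m ⊗ₜ n)) :=
  assocApp_tmk' hs h hu h' ((l ⊗ₜ m) ⊗ₜ n)

theorem assocInvApp_tmk {p q r s t u : G} (hs : q * r = s) (h : s * t = p) (hu : r * t = u)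
    (h' : q * u = p) (l : L.carrier q) (m : M.carrier r) (n : N.carrier t) :
    assocInvApp L M N p
      (L.tmk (M.tensor N) h' (l ⊗ₜ M.tmk N hu (m ⊗ₜ n))) =
    (L.tensor M).tmk N h (L.tmk M hs (l ⊗ₜ m) ⊗ₜ n) := by
  subst hs
  rw [assocInvApp, tdesc_tmk]
  rw [TensorProduct.lift.tmul, LinearMap.flip_apply]
  erw [tdesc_tmk]
  rfl

theorem tensor_ext₃ {p : G} {W : Type*} [AddCommGroup W] [Module k W]
    {f g : ((L.tensor M).tensor N).carrier p →ₗ[k] W}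
    (h : ∀ (q r s t : G) (hs : q * r = s) (h : s * t = p) l m n,
      f ((L.tensor M).tmk N h (L.tmk M hs (l ⊗ₜ m) ⊗ₜ n)) =
      g ((L.tensor M).tmk N h (L.tmk M hs (l ⊗ₜ m) ⊗ₜ n))) : f = g := by
  refine tensor_ext (M := (L.tensor M)) fun s t hst x n => ?_
  refine LinearMap.congr_fun (f := f ∘ₗ (L.tensor M).tmk N hst ∘ₗ
    (TensorProduct.mk k _ _).flip n) (g := g ∘ₗ (L.tensor M).tmk N hst ∘ₗ
    (TensorProduct.mk k _ _).flip n) ?_ x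
  exact tensor_ext (M := L) fun q r hs l m => h q r s t hs hst l m n

theorem tensor_ext₃' {p : G} {W : Type*} [AddCommGroup W] [Module k W]
    {f g : (L.tensor (M.tensor N)).carrier p →ₗ[k] W}
    (h : ∀ (q r t u : G) (hu : r * t = u) (h : q * u = p) l m n,
      f (L.tmk (M.tensor N) h (l ⊗ₜ M.tmk N hu (m ⊗ₜ n))) =
      g (L.tmk (M.tensor N) h (l ⊗ₜ M.tmk N hu (m ⊗ₜ n)))) : f = g := by
  refine tensor_ext (N := (M.tensor N)) fun s t hst l x => ?_
  refine LinearMap.congr_fun (f := f ∘ₗ L.tmk (M.tensor N) hst ∘ₗ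
    TensorProduct.mk k _ _ l) (g := g ∘ₗ L.tmk (M.tensor N) hst ∘ₗ
    TensorProduct.mk k _ _ l) ?_ x
  exact tensor_ext (M := M) fun r t' hu m n => h s r t' t hu hst l m n

theorem tensor_ext₄ {P : AGModule H} {p : G} {W : Type*} [AddCommGroup W] [Module k W]
    {f g : (((L.tensor M).tensor N).tensor P).carrier p →ₗ[k] W}
    (h : ∀ (a b e c s d : G) (hab : a * b = e) (hec : e * c = s) (hsd : s * d = p) l m n z,
      f (((L.tensor M).tensor N).tmk P hsd
        ((L.tensor M).tmk N hec (L.tmk M hab (l ⊗ₜ m) ⊗ₜ n) ⊗ₜ z)) =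
      g (((L.tensor M).tensor N).tmk P hsd
        ((L.tensor M).tmk N hec (L.tmk M hab (l ⊗ₜ m) ⊗ₜ n) ⊗ₜ z))) : f = g := by
  refine tensor_ext fun s d hsd x z => ?_
  refine LinearMap.congr_fun (f := f ∘ₗ ((L.tensor M).tensor N).tmk P hsd ∘ₗ
    (TensorProduct.mk k _ _).flip z) (g := g ∘ₗ ((L.tensor M).tensor N).tmk P hsd ∘ₗ
    (TensorProduct.mk k _ _).flip z) ?_ x
  exact tensor_ext₃ fun a b e c hab hec l m n => h a b e c s d hab hec hsd l m n z

variable (L M N)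

theorem assocInvApp_assocApp (p : G) (x) : assocInvApp L M N p (assocApp L M N p x) = x := by
  refine LinearMap.congr_fun (f := assocInvApp L M N p ∘ₗ assocApp L M N p) (g := .id)
    (tensor_ext₃ fun q r s t hs h l m n => ?_) x
  have h' : q * (r * t) = p := by rw [← mul_assoc, hs, h]
  rw [LinearMap.comp_apply, assocApp_tmk hs h rfl h', assocInvApp_tmk hs h rfl h']
  rfl

theorem assocApp_assocInvApp (p : G) (x) : assocApp L M N p (assocInvApp L M N p x) = x := by
  refine LinearMap.congr_fun (f := assocApp L M N p ∘ₗ assocInvApp L M N p) (g := .id)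
    (tensor_ext₃' fun q r t u hu h l m n => ?_) x
  have h' : (q * r) * t = p := by rw [mul_assoc, hu, h]
  rw [LinearMap.comp_apply, assocInvApp_tmk rfl h' hu h, assocApp_tmk rfl h' hu h]
  rfl

theorem assocApp_act (p : G) (a : H.C p) (x) :
    assocApp L M N p (((L.tensor M).tensor N).act p a x) =
      (L.tensor (M.tensor N)).act p a (assocApp L M N p x) := by
  refine LinearMap.congr_fun (f := assocApp L M N p ∘ₗ ((L.tensor M).tensor N).act p a)
    (g := (L.tensor (M.tensor N)).act p a ∘ₗ assocApp L M N p)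
    (tensor_ext₃ fun q r s t hs h l m n => ?_) x
  have h' : q * (r * t) = p := by rw [← mul_assoc, hs, h]
  rw [LinearMap.comp_apply, LinearMap.comp_apply, assocApp_tmk hs h rfl h']
  have e1 := act_tmk (L.tensor M) N h a
    ((L.tmk M hs).rTensor (N.carrier t) ((l ⊗ₜ m) ⊗ₜ n))
  have e2 : (L.tensor M).pairAct N h a
      ((L.tmk M hs).rTensor (N.carrier t) ((l ⊗ₜ m) ⊗ₜ n)) =
      (L.tmk M hs).rTensor (N.carrier t)
        ((((L.unital₂ M q r).pull (H.comulHom hs)).tensor (N.unital t)).ext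
          (H.comul s t a) ((l ⊗ₜ m) ⊗ₜ n)) := by
    symm
    refine IsUnitalModule.ext_map (((L.unital₂ M q r).pull (H.comulHom hs)).tensor (N.unital t)) ((L.tensor M).unital₂ N s t) _ (fun b z => ?_) _ _
    induction b using TensorProduct.induction_on with
    | zero => simp
    | add u v hu hv => simp only [map_add, LinearMap.add_apply, hu, hv]
    | tmul b c =>
      induction z using TensorProduct.induction_on with
      | zero => simp
      | add u v hu hv => simp only [map_add, hu, hv]
      | tmul x y =>
        simp only [tensorAct_tmul, TensorProduct.map_tmul, LinearMap.rTensor_tmul]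
        congr 1
        exact (act_tmk L M hs b x).symm
  have e3 := act_tmk L (M.tensor N) h' a
    ((M.tmk N rfl).lTensor (L.carrier q) (l ⊗ₜ (m ⊗ₜ n)))
  have e4 : L.pairAct (M.tensor N) h' a
      ((M.tmk N rfl).lTensor (L.carrier q) (l ⊗ₜ (m ⊗ₜ n))) =
      (M.tmk N rfl).lTensor (L.carrier q)
        (((L.unital q).tensor ((M.unital₂ N r t).pull (H.comulHom rfl))).ext
          (H.comul q (r * t) a) (l ⊗ₜ (m ⊗ₜ n))) := by
    symm
    refine IsUnitalModule.ext_map ((L.unital q).tensor ((M.unital₂ N r t).pull (H.comulHom rfl))) (L.unital₂ (M.tensor N) q (r * t)) _ (fun b z => ?_) _ _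
    induction b using TensorProduct.induction_on with
    | zero => simp
    | add u v hu hv => simp only [map_add, LinearMap.add_apply, hu, hv]
    | tmul b c =>
      induction z using TensorProduct.induction_on with
      | zero => simp
      | add u v hu hv => simp only [map_add, hu, hv]
      | tmul x y =>
        simp only [tensorAct_tmul, TensorProduct.map_tmul, LinearMap.lTensor_tmul]
        congr 1
        exact (act_tmk M N rfl c y).symm
  refine (congrArg (assocApp L M N p) (e1.trans (congrArg _ e2))).trans ?_
  refine Eq.trans ?_ (e3.trans (congrArg _ e4)).symm
  rw [assocApp_tmk' hs h rfl h']
  congr 2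
  exact assoc_pairAct hs rfl (L.unital q) (M.unital r) (N.unital t) a _

end Assoc

/-! ### The unit object -/

section Unit

/-- The component `K_p` of the unit object: `K_1 = k` and `K_p = 0` for `p ≠ 1`. -/
abbrev unitComp (k : Type u) {G : Type u} [Field k] [Group G] (p : G) : Submodule k k where
  carrier := {x | p ≠ 1 → x = 0}
  zero_mem' _ := rfl
  add_mem' hx hy h := by rw [hx h, hy h, add_zero]
  smul_mem' c x hx h := by rw [hx h, smul_zero]

variable (H) in
/-- The unit object: `a κ = ε(a) κ`. -/
def unitMod : AGModule H where
  carrier p := unitComp k p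
  act p := (LinearMap.lsmul k (unitComp k p)).comp (H.hopf.counit ∘ₗ H.inc p)
  unital p :=
    { mul_act := fun a b x => by
        have : H.hopf.counit ((a * b : H.C p) : A) = H.hopf.counit a * H.hopf.counit b :=
          H.hopf.counit_mul a b
        change H.hopf.counit ((a * b : H.C p) : A) • x =
          H.hopf.counit (a : A) • H.hopf.counit (b : A) • x
        rw [this, mul_smul]
      unital := by
        rw [eq_top_iff]
        rintro x -
        by_cases hp : p = 1
        · subst hp
          obtain ⟨a, ha⟩ := H.exists_counit_eq_one
          rw [← H.counit_pr] at ha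
          exact Submodule.subset_span ⟨H.pr 1 a, x, by simp [ha]⟩
        · have : x = 0 := Subtype.ext (x.2 hp)
          rw [this]; exact zero_mem _
      nondeg := fun x hx => by
        by_cases hp : p = 1
        · subst hp
          obtain ⟨a, ha⟩ := H.exists_counit_eq_one
          rw [← H.counit_pr] at ha
          simpa [ha] using hx (H.pr 1 a)
        · exact Subtype.ext (x.2 hp) }

variable (H) in
/-- The element `1 ∈ K_1 = k`. -/
def unitElem : (unitMod H).carrier 1 := (⟨1, fun h => absurd rfl h⟩ : unitComp k (1 : G))

variable (H) in
/-- The inclusion `K_p → k`. -/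
def unitVal (p : G) : (unitMod H).carrier p →ₗ[k] k := (unitComp k p).subtype

@[simp] theorem unitVal_unitElem : unitVal H 1 (unitElem H) = 1 := rfl

theorem unitMod_act (p : G) (a : H.C p) (x : (unitMod H).carrier p) :
    (unitMod H).act p a x = H.hopf.counit (a : A) • x := rfl

theorem unit_eq_zero {p : G} (hp : p ≠ 1) (x : (unitMod H).carrier p) : x = 0 :=
  Subtype.ext (Subtype.property (p := fun x => x ∈ unitComp k p) x hp)

theorem unit_eq_smul (x : (unitMod H).carrier 1) : x = unitVal H 1 x • unitElem H :=
  Subtype.ext (mul_one (unitVal H 1 x)).symm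

variable (M : AGModule H)

/-- The identity map `M_t → M_p` for `t = p`. -/
def castMap {t p : G} (h : t = p) : M.carrier t →ₗ[k] M.carrier p := h ▸ LinearMap.id

@[simp] theorem castMap_rfl {p : G} (h : p = p) (m : M.carrier p) : M.castMap h m = m := rfl

/-- `κ ⊗ m ↦ κ m`. -/
def leftUnitorApp (p : G) : ((unitMod H).tensor M).carrier p →ₗ[k] M.carrier p :=
  tdesc fun s _ h => if hs : s = 1 then
    TensorProduct.lift ((LinearMap.lsmul k (M.carrier p)).compl₂
      (M.castMap (by rw [← h, hs, one_mul])) ∘ₗ unitVal H s) else 0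

/-- `m ⊗ κ ↦ κ m`. -/
def rightUnitorApp (p : G) : (M.tensor (unitMod H)).carrier p →ₗ[k] M.carrier p :=
  tdesc fun _ t h => if ht : t = 1 then
    TensorProduct.lift (((LinearMap.lsmul k (M.carrier p)).compl₂
      (M.castMap (by rw [← h, ht, mul_one])) ∘ₗ unitVal H t).flip) else 0

/-- `m ↦ 1 ⊗ m`. -/
def leftUnitorInvApp (p : G) : M.carrier p →ₗ[k] ((unitMod H).tensor M).carrier p :=
  (unitMod H).tmk M (one_mul p) ∘ₗ TensorProduct.mk k _ _ (unitElem H)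

/-- `m ↦ m ⊗ 1`. -/
def rightUnitorInvApp (p : G) : M.carrier p →ₗ[k] (M.tensor (unitMod H)).carrier p :=
  M.tmk (unitMod H) (mul_one p) ∘ₗ (TensorProduct.mk k _ _).flip (unitElem H)

theorem leftUnitorInvApp_apply (p : G) (m : M.carrier p) :
    M.leftUnitorInvApp p m = (unitMod H).tmk M (one_mul p) (unitElem H ⊗ₜ m) := rfl

theorem rightUnitorInvApp_apply (p : G) (m : M.carrier p) :
    M.rightUnitorInvApp p m = M.tmk (unitMod H) (mul_one p) (m ⊗ₜ unitElem H) := rfl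

theorem leftUnitorApp_tmk (p : G) (x : (unitMod H).carrier 1) (h : 1 * p = p) (m : M.carrier p) :
    M.leftUnitorApp p ((unitMod H).tmk M h (x ⊗ₜ m)) = unitVal H 1 x • m := by
  rw [leftUnitorApp, tdesc_tmk, dif_pos rfl]
  rfl

theorem rightUnitorApp_tmk (p : G) (x : (unitMod H).carrier 1) (h : p * 1 = p) (m : M.carrier p) :
    M.rightUnitorApp p (M.tmk (unitMod H) h (m ⊗ₜ x)) = unitVal H 1 x • m := by
  rw [rightUnitorApp, tdesc_tmk, dif_pos rfl]
  rfl

variable {M}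

theorem unit_tensor_ext {p : G} {W : Type*} [AddCommGroup W] [Module k W]
    {f g : ((unitMod H).tensor M).carrier p →ₗ[k] W}
    (h : ∀ m, f ((unitMod H).tmk M (one_mul p) (unitElem H ⊗ₜ m)) =
      g ((unitMod H).tmk M (one_mul p) (unitElem H ⊗ₜ m))) : f = g := by
  refine tensor_ext (M := unitMod H) fun s t hst x m => ?_
  by_cases hs : s = 1
  · subst hs
    obtain rfl : t = p := by rw [← hst, one_mul]
    generalize hc : unitVal H 1 x = c
    rw [unit_eq_smul x, hc]
    rw [← TensorProduct.smul_tmul', map_smul, map_smul, map_smul]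
    exact congrArg _ (h m)
  · rw [unit_eq_zero hs x]
    simp only [TensorProduct.zero_tmul, map_zero]

theorem tensor_unit_ext {p : G} {W : Type*} [AddCommGroup W] [Module k W]
    {f g : (M.tensor (unitMod H)).carrier p →ₗ[k] W}
    (h : ∀ m, f (M.tmk (unitMod H) (mul_one p) (m ⊗ₜ unitElem H)) =
      g (M.tmk (unitMod H) (mul_one p) (m ⊗ₜ unitElem H))) : f = g := by
  refine tensor_ext (N := unitMod H) fun s t hst m x => ?_
  by_cases ht : t = 1
  · subst ht
    obtain rfl : s = p := by rw [← hst, mul_one]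
    generalize hc : unitVal H 1 x = c
    rw [unit_eq_smul x, hc]
    rw [TensorProduct.tmul_smul, map_smul, map_smul, map_smul]
    exact congrArg _ (h m)
  · rw [unit_eq_zero ht x]
    simp only [TensorProduct.tmul_zero, map_zero]

theorem tensor_unit_tensor_ext {N : AGModule H} {p : G} {W : Type*} [AddCommGroup W] [Module k W]
    {f g : ((M.tensor (unitMod H)).tensor N).carrier p →ₗ[k] W}
    (h : ∀ (s t : G) (hst : s * t = p) m n,
      f ((M.tensor (unitMod H)).tmk N hst
        (M.tmk (unitMod H) (mul_one s) (m ⊗ₜ unitElem H) ⊗ₜ n)) =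
      g ((M.tensor (unitMod H)).tmk N hst
        (M.tmk (unitMod H) (mul_one s) (m ⊗ₜ unitElem H) ⊗ₜ n))) : f = g := by
  refine tensor_ext fun s t hst x n => ?_
  refine LinearMap.congr_fun (f := f ∘ₗ (M.tensor (unitMod H)).tmk N hst ∘ₗ
    (TensorProduct.mk k _ _).flip n) (g := g ∘ₗ (M.tensor (unitMod H)).tmk N hst ∘ₗ
    (TensorProduct.mk k _ _).flip n) ?_ x
  exact tensor_unit_ext fun m => h s t hst m n

variable (M)

theorem leftUnitorInvApp_leftUnitorApp (p : G) (x) :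
    M.leftUnitorInvApp p (M.leftUnitorApp p x) = x := by
  refine LinearMap.congr_fun (f := M.leftUnitorInvApp p ∘ₗ M.leftUnitorApp p) (g := .id)
    (unit_tensor_ext fun m => ?_) x
  rw [LinearMap.comp_apply, leftUnitorApp_tmk, unitVal_unitElem, one_smul]
  rfl

theorem leftUnitorApp_leftUnitorInvApp (p : G) (m) :
    M.leftUnitorApp p (M.leftUnitorInvApp p m) = m := by
  rw [leftUnitorInvApp_apply, leftUnitorApp_tmk, unitVal_unitElem, one_smul]

theorem rightUnitorInvApp_rightUnitorApp (p : G) (x) :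
    M.rightUnitorInvApp p (M.rightUnitorApp p x) = x := by
  refine LinearMap.congr_fun (f := M.rightUnitorInvApp p ∘ₗ M.rightUnitorApp p) (g := .id)
    (tensor_unit_ext fun m => ?_) x
  rw [LinearMap.comp_apply, rightUnitorApp_tmk, unitVal_unitElem, one_smul]
  rfl

theorem rightUnitorApp_rightUnitorInvApp (p : G) (m) :
    M.rightUnitorApp p (M.rightUnitorInvApp p m) = m := by
  rw [rightUnitorInvApp_apply, rightUnitorApp_tmk, unitVal_unitElem, one_smul]

/-- `(ε ⊗ ι)Δ(a) = a` on modules. -/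
theorem unit_pairAct (p : G) (a : H.C p) (m : M.carrier p) :
    (unitMod H).pairAct M (one_mul p) a (unitElem H ⊗ₜ m) = unitElem H ⊗ₜ M.act p a m := by
  refine (M.unital p).induct (p := fun m => (unitMod H).pairAct M (one_mul p) a
    (unitElem H ⊗ₜ m) = unitElem H ⊗ₜ M.act p a m) (fun c m => ?_) (fun m m' h h' => ?_) m
  · have hc : H.pr p (c : A) = c := H.pr_same c.2
    have h1 := ext_comul_tmul ((unitMod H).unital 1) (M.unital p) a c (unitElem H) m
    rw [hc] at h1
    refine h1.trans ?_
    rw [← (M.unital p).mul_act]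
    have h2 : ∀ w : A ⊗[k] A,
        tensorAct ((unitMod H).act 1) (M.act p) (H.pr₂ 1 p w) (unitElem H ⊗ₜ m) =
        unitElem H ⊗ₜ M.act p (H.pr p (TensorProduct.lid k A (H.hopf.counit.rTensor A w))) m := by
      intro w
      induction w using TensorProduct.induction_on with
      | zero => simp
      | add u v hu hv =>
        simp only [map_add, LinearMap.add_apply, hu, hv, TensorProduct.tmul_add]
      | tmul u v =>
        rw [GCogradedMHA.pr₂, TensorProduct.map_tmul, tensorAct_tmul, TensorProduct.map_tmul,
          unitMod_act, H.counit_pr, LinearMap.rTensor_tmul, TensorProduct.lid_tmul, map_smul,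
          map_smul, LinearMap.smul_apply, TensorProduct.tmul_smul, TensorProduct.smul_tmul']
    rw [h2, H.hopf.counit_T₁]
    have h3 : H.pr p ((a : A) * (c : A)) = a * c := H.pr_same (a * c).2
    simp [h3]
  · simp only [TensorProduct.tmul_add, map_add, h, h']

/-- `(ι ⊗ ε)Δ(a) = a` on modules. -/
theorem pairAct_unit (p : G) (a : H.C p) (m : M.carrier p) :
    M.pairAct (unitMod H) (mul_one p) a (m ⊗ₜ unitElem H) = M.act p a m ⊗ₜ unitElem H := by
  rw [← sub_eq_zero]
  refine tensor_faithful_left (f := fun b => M.act p b) (M.unital p).nondeg _ fun b => ?_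
  have hb : H.pr p (b : A) = b := H.pr_same b.2
  rw [map_sub, sub_eq_zero]
  have h1 := tmul_ext_comul (M.unital p) ((unitMod H).unital 1) b a (m ⊗ₜ unitElem H)
  rw [hb] at h1
  refine h1.trans ?_
  rw [TensorProduct.map_tmul, ← (M.unital p).mul_act]
  have h2 : ∀ w : A ⊗[k] A,
      tensorAct (M.act p) ((unitMod H).act 1) (H.pr₂ p 1 w) (m ⊗ₜ unitElem H) =
      M.act p (H.pr p (TensorProduct.rid k A (H.hopf.counit.lTensor A w))) m ⊗ₜ unitElem H := by
    intro w
    induction w using TensorProduct.induction_on with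
    | zero => simp
    | add u v hu hv =>
      simp only [map_add, LinearMap.add_apply, hu, hv, TensorProduct.add_tmul]
    | tmul u v =>
      rw [GCogradedMHA.pr₂, TensorProduct.map_tmul, tensorAct_tmul, TensorProduct.map_tmul,
        unitMod_act, H.counit_pr, LinearMap.lTensor_tmul, TensorProduct.rid_tmul, map_smul,
        map_smul, LinearMap.smul_apply, TensorProduct.tmul_smul, TensorProduct.smul_tmul']
  rw [h2, H.hopf.counit_T₂]
  have h3 : H.pr p ((b : A) * (a : A)) = b * a := H.pr_same (b * a).2
  simp [h3]

theorem leftUnitorApp_act (p : G) (a : H.C p) (x) :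
    M.leftUnitorApp p (((unitMod H).tensor M).act p a x) = M.act p a (M.leftUnitorApp p x) := by
  refine LinearMap.congr_fun (f := M.leftUnitorApp p ∘ₗ ((unitMod H).tensor M).act p a)
    (g := M.act p a ∘ₗ M.leftUnitorApp p) (unit_tensor_ext fun m => ?_) x
  rw [LinearMap.comp_apply, LinearMap.comp_apply, act_tmk, unit_pairAct, leftUnitorApp_tmk,
    leftUnitorApp_tmk, map_smul]

theorem rightUnitorApp_act (p : G) (a : H.C p) (x) :
    M.rightUnitorApp p ((M.tensor (unitMod H)).act p a x) = M.act p a (M.rightUnitorApp p x) := by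
  refine LinearMap.congr_fun (f := M.rightUnitorApp p ∘ₗ (M.tensor (unitMod H)).act p a)
    (g := M.act p a ∘ₗ M.rightUnitorApp p) (tensor_unit_ext fun m => ?_) x
  rw [LinearMap.comp_apply, LinearMap.comp_apply, act_tmk, pairAct_unit, rightUnitorApp_tmk,
    rightUnitorApp_tmk, map_smul]

end Unit

end AGModule

/-! ## The monoidal category of crossed left `A`-`G`-modules -/

section Crossed

variable {k G A : Type u} [Field k] [Group G] [DecidableEq G]
  [NonUnitalRing A] [Module k A] [IsScalarTower k A A] [SMulCommClass k A A]

/-- A crossed left `A`-`G`-module.  The map `π_{M,q} : M_s → M_{q s q⁻¹}` is given for all `t` with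
a proof of `q s q⁻¹ = t`, as a map `M_s → M_t`. -/
structure CrossedModule (H : MultiplierHopfTCoalgebra k G A)
    extends AGModule H.toGCogradedMHA where
  π : ∀ (q : G) {s t : G}, q * s * q⁻¹ = t → carrier s →ₗ[k] carrier t
  π_bijective : ∀ (q : G) {s t : G} (h : q * s * q⁻¹ = t), Function.Bijective (π q h)
  π_act : ∀ (q : G) {s t : G} (h : q * s * q⁻¹ = t) (a : H.C s) (m : carrier s),
    π q h (act s a m) = act t ((H.piIso q h).toLinearEquiv a) (π q h m)
  π_comp : ∀ (p q : G) {r s t : G} (h : q * r * q⁻¹ = s) (h' : p * s * p⁻¹ = t)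
    (h'' : p * q * r * (p * q)⁻¹ = t) (m : carrier r), π p h' (π q h m) = π (p * q) h'' m

namespace CrossedModule

open AGModule

variable {H : MultiplierHopfTCoalgebra k G A}

theorem π_one (M : CrossedModule H) {s : G} (h : 1 * s * 1⁻¹ = s) (m : M.carrier s) :
    M.π 1 h m = m := by
  apply (M.π_bijective 1 h).1
  rw [M.π_comp 1 1 h h (by simp)]
  congr 2
  simp

/-- Morphisms of crossed left `A`-`G`-modules. -/
@[ext]
structure Hom (M N : CrossedModule H) where
  app : ∀ p, M.carrier p →ₗ[k] N.carrier p
  app_act : ∀ p (a : H.C p) m, app p (M.act p a m) = N.act p a (app p m)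
  app_π : ∀ (q : G) {s t : G} (h : q * s * q⁻¹ = t) m, app t (M.π q h m) = N.π q h (app s m)

instance : Category (CrossedModule H) where
  Hom := Hom
  id M := ⟨fun _ => LinearMap.id, fun _ _ _ => rfl, fun _ _ _ _ _ => rfl⟩
  comp f g := ⟨fun p => g.app p ∘ₗ f.app p, fun p a m => by simp [f.app_act, g.app_act],
    fun q s t h m => by simp [f.app_π, g.app_π]⟩

@[simp] theorem id_app (M : CrossedModule H) (p : G) : Hom.app (𝟙 M) p = LinearMap.id := rfl
@[simp] theorem comp_app {L M N : CrossedModule H} (f : L ⟶ M) (g : M ⟶ N) (p : G) :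
    Hom.app (f ≫ g) p = Hom.app g p ∘ₗ Hom.app f p := rfl

theorem hom_ext {M N : CrossedModule H} {f g : M ⟶ N} (h : ∀ p, Hom.app f p = Hom.app g p) :
    f = g := Hom.ext (funext h)

/-- A bijective morphism is an isomorphism. -/
def mkIso {M N : CrossedModule H} (f : M ⟶ N) (g : ∀ p, N.carrier p →ₗ[k] M.carrier p)
    (h : ∀ p m, g p (Hom.app f p m) = m) (h' : ∀ p n, Hom.app f p (g p n) = n) : M ≅ N where
  hom := f
  inv := ⟨g, fun p a m => by
      apply Function.LeftInverse.injective (h p)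
      rw [h', Hom.app_act, h'],
    fun q s t e m => by
      apply Function.LeftInverse.injective (h t)
      rw [h', Hom.app_π, h']⟩
  hom_inv_id := hom_ext fun p => LinearMap.ext (h p)
  inv_hom_id := hom_ext fun p => LinearMap.ext (h' p)

/-! ### Tensor products -/

section Tensor

variable (M N : CrossedModule H)

theorem conj_mul {q s t p p' : G} (h : q * p * q⁻¹ = p') (hst : s * t = p) :
    (q * s * q⁻¹) * (q * t * q⁻¹) = p' := by
  rw [← h, ← hst]; group

/-- `π_{M ⊗ N, q}`, which is `π_{M,q} ⊗ π_{N,q}` on `M_s ⊗ N_t`. -/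
def tensorπ (q : G) {p p' : G} (h : q * p * q⁻¹ = p') :
    (M.toAGModule.tensor N.toAGModule).carrier p →ₗ[k]
      (M.toAGModule.tensor N.toAGModule).carrier p' :=
  tdesc fun _ _ hst => M.tmk N.toAGModule (conj_mul h hst) ∘ₗ
    TensorProduct.map (M.π q rfl) (N.π q rfl)

theorem tensorπ_tmk' (q : G) {p p' s t s' t' : G} (h : q * p * q⁻¹ = p') (hst : s * t = p)
    (hs : q * s * q⁻¹ = s') (ht : q * t * q⁻¹ = t') (hst' : s' * t' = p')
    (z : M.carrier s ⊗[k] N.carrier t) :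
    tensorπ M N q h (M.tmk N.toAGModule hst z) =
      M.tmk N.toAGModule hst' (TensorProduct.map (M.π q hs) (N.π q ht) z) := by
  subst hs ht
  rw [tensorπ, tdesc_tmk]
  rfl

theorem tensorπ_tmk (q : G) {p p' s t s' t' : G} (h : q * p * q⁻¹ = p') (hst : s * t = p)
    (hs : q * s * q⁻¹ = s') (ht : q * t * q⁻¹ = t') (hst' : s' * t' = p')
    (m : M.carrier s) (n : N.carrier t) :
    tensorπ M N q h (M.tmk N.toAGModule hst (m ⊗ₜ n)) =
      M.tmk N.toAGModule hst' (M.π q hs m ⊗ₜ N.π q ht n) :=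
  tensorπ_tmk' M N q h hst hs ht hst' _

theorem tensorπ_comp (p q : G) {r s t : G} (h : q * r * q⁻¹ = s) (h' : p * s * p⁻¹ = t)
    (h'' : p * q * r * (p * q)⁻¹ = t) (x) :
    tensorπ M N p h' (tensorπ M N q h x) = tensorπ M N (p * q) h'' x := by
  have : tensorπ M N p h' ∘ₗ tensorπ M N q h = tensorπ M N (p * q) h'' := by
    refine tensor_ext fun u v huv m n => ?_
    rw [LinearMap.comp_apply, tensorπ_tmk M N q h huv rfl rfl (conj_mul h huv),
      tensorπ_tmk M N p h' _ rfl rfl (conj_mul h' (conj_mul h huv)),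
      tensorπ_tmk M N (p * q) h'' huv (s' := p * (q * u * q⁻¹) * p⁻¹)
        (t' := p * (q * v * q⁻¹) * p⁻¹) (by group) (by group) (conj_mul h' (conj_mul h huv)),
      M.π_comp, N.π_comp]
  exact LinearMap.congr_fun this x

theorem tensorπ_one {p : G} (h : 1 * p * 1⁻¹ = p) (x) : tensorπ M N 1 h x = x := by
  have : tensorπ M N 1 h = LinearMap.id := by
    refine tensor_ext fun u v huv m n => ?_
    rw [tensorπ_tmk M N 1 h huv (s' := u) (t' := v) (by simp) (by simp) huv, π_one, π_one]
    rfl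
  exact LinearMap.congr_fun this x

/-- The tensor product of two crossed modules. -/
def tensorObj : CrossedModule H where
  toAGModule := M.toAGModule.tensor N.toAGModule
  π := tensorπ M N
  π_bijective q s t h := by
    have h' : q⁻¹ * t * q⁻¹⁻¹ = s := by rw [← h]; group
    refine Function.bijective_iff_has_inverse.2 ⟨tensorπ M N q⁻¹ h', fun x => ?_, fun x => ?_⟩
    · rw [tensorπ_comp M N q⁻¹ q h h' (by group)]
      have : ∀ (e : G) (he : e = 1) (h : e * s * e⁻¹ = s), tensorπ M N e h x = x := by
        rintro _ rfl h; exact tensorπ_one M N h x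
      exact this _ (by group) _
    · rw [tensorπ_comp M N q q⁻¹ h' h (by group)]
      have : ∀ (e : G) (he : e = 1) (h : e * t * e⁻¹ = t), tensorπ M N e h x = x := by
        rintro _ rfl h; exact tensorπ_one M N h x
      exact this _ (by group) _
  π_act q p p' h a x := by
    have : tensorπ M N q h ∘ₗ (M.toAGModule.tensor N.toAGModule).act p a =
        (M.toAGModule.tensor N.toAGModule).act p' ((H.piIso q h).toLinearEquiv a) ∘ₗ
          tensorπ M N q h := by
      refine tensor_ext fun s t hst m n => ?_
      rw [LinearMap.comp_apply, LinearMap.comp_apply, act_tmk,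
        tensorπ_tmk' M N q h hst rfl rfl (conj_mul h hst),
        tensorπ_tmk' M N q h hst rfl rfl (conj_mul h hst), act_tmk]
      congr 1
      rw [pairAct_apply, pairAct_apply, H.piIso_coe, H.comul_pi q rfl rfl]
      refine IsUnitalModule.ext_map_congr _ _ _ _ (fun b z => ?_) _ _
      induction b using TensorProduct.induction_on with
      | zero => simp
      | add u v hu hv => simp only [map_add, LinearMap.add_apply, hu, hv]
      | tmul b c =>
        induction z using TensorProduct.induction_on with
        | zero => simp
        | add u v hu hv => simp only [map_add, hu, hv]
        | tmul x y => simp [AlgIso.tensor, M.π_act, N.π_act]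
    exact LinearMap.congr_fun this x
  π_comp p q _ _ _ h h' h'' x := tensorπ_comp M N p q h h' h'' x

variable {M N} {M' N' : CrossedModule H}

/-- The tensor product of two morphisms. -/
def tensorHom (f : M ⟶ M') (g : N ⟶ N') : tensorObj M N ⟶ tensorObj M' N' where
  app p := tensorApp (Hom.app f) (Hom.app g) p
  app_act p a x := tensorApp_act _ _ (Hom.app_act f) (Hom.app_act g) p a x
  app_π q p p' h x := by
    refine LinearMap.congr_fun (f := tensorApp (Hom.app f) (Hom.app g) p' ∘ₗ tensorπ M N q h)
      (g := tensorπ M' N' q h ∘ₗ tensorApp (Hom.app f) (Hom.app g) p)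
      (tensor_ext fun s t hst m n => ?_) x
    rw [LinearMap.comp_apply, LinearMap.comp_apply,
      tensorπ_tmk M N q h hst rfl rfl (conj_mul h hst), tensorApp_tmk, tensorApp_tmk,
      TensorProduct.map_tmul, TensorProduct.map_tmul,
      tensorπ_tmk M' N' q h hst rfl rfl (conj_mul h hst), Hom.app_π, Hom.app_π]

theorem tensorHom_tmk (f : M ⟶ M') (g : N ⟶ N') {s t p : G} (h : s * t = p)
    (m : M.carrier s) (n : N.carrier t) :
    Hom.app (tensorHom f g) p (M.tmk N.toAGModule h (m ⊗ₜ n)) =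
      M'.tmk N'.toAGModule h (Hom.app f s m ⊗ₜ Hom.app g t n) :=
  tensorApp_tmk _ _ _ _

end Tensor

section Assoc

variable (L M N : CrossedModule H)

/-- The associativity constraint as a morphism. -/
def assocHom : tensorObj (tensorObj L M) N ⟶ tensorObj L (tensorObj M N) where
  app := assocApp L.toAGModule M.toAGModule N.toAGModule
  app_act p a x := assocApp_act _ _ _ p a x
  app_π g p p' hg x := by
    refine LinearMap.congr_fun (f := assocApp L.toAGModule M.toAGModule N.toAGModule p' ∘ₗ (tensorObj (tensorObj L M) N).π g hg)
      (g := (tensorObj L (tensorObj M N)).π g hg ∘ₗ assocApp L.toAGModule M.toAGModule N.toAGModule p)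
      (tensor_ext₃ fun q r s t hs h l m n => ?_) x
    have h' : q * (r * t) = p := by rw [← mul_assoc, hs, h]
    have e1 := tensorπ_tmk (tensorObj L M) N g hg h rfl rfl (conj_mul hg h)
      (L.tmk M.toAGModule hs (l ⊗ₜ m)) n
    have e2 := tensorπ_tmk L M g rfl hs rfl rfl (conj_mul rfl hs) l m
    have e3 := tensorπ_tmk L (tensorObj M N) g hg h' rfl rfl (conj_mul hg h')
      l (M.tmk N.toAGModule rfl (m ⊗ₜ n))
    have e4 := tensorπ_tmk M N g rfl (rfl : r * t = r * t) rfl rfl (conj_mul rfl rfl) m n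
    have e5 := assocApp_tmk (L := L.toAGModule) (M := M.toAGModule) (N := N.toAGModule)
      hs h rfl h' l m n
    refine (congrArg (assocApp L.toAGModule M.toAGModule N.toAGModule p') (e1.trans ?_)).trans
      ((assocApp_tmk (conj_mul rfl hs) (conj_mul hg h) (conj_mul rfl rfl) (conj_mul hg h')
        (L.π g rfl l) (M.π g rfl m) (N.π g rfl n)).trans (Eq.trans ?_
          ((congrArg ((tensorObj L (tensorObj M N)).π g hg) e5).trans e3).symm))
    · exact congrArg (fun y => (tensorObj L M).tmk N.toAGModule (conj_mul hg h)
        (y ⊗ₜ N.π g rfl n)) e2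
    · exact congrArg (fun y => L.tmk (tensorObj M N).toAGModule (conj_mul hg h')
        (L.π g rfl l ⊗ₜ y)) e4.symm

/-- The associativity constraint. -/
def assocIso : tensorObj (tensorObj L M) N ≅ tensorObj L (tensorObj M N) :=
  mkIso (assocHom L M N) (assocInvApp L.toAGModule M.toAGModule N.toAGModule)
    (assocInvApp_assocApp _ _ _) (assocApp_assocInvApp _ _ _)


end Assoc

section Unit

/-- The unit object with `π_{K,q}` the identity of `k` (and zero on the zero components). -/
def unitπ (H : MultiplierHopfTCoalgebra k G A) (q : G) {s t : G} (h : q * s * q⁻¹ = t) :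
    (unitMod H.toGCogradedMHA).carrier s →ₗ[k] (unitMod H.toGCogradedMHA).carrier t :=
  (unitVal H.toGCogradedMHA s).codRestrict (unitComp k t) fun x ht =>
    Subtype.property (p := fun x => x ∈ unitComp k s) x fun hs => ht (by rw [← h, hs]; simp)

theorem unitπ_val (q : G) {s t : G} (h : q * s * q⁻¹ = t)
    (x : (unitMod H.toGCogradedMHA).carrier s) :
    unitVal H.toGCogradedMHA t (unitπ H q h x) = unitVal H.toGCogradedMHA s x := rfl

theorem unitπ_unitElem (q : G) (h : q * 1 * q⁻¹ = 1) :
    unitπ H q h (unitElem H.toGCogradedMHA) = unitElem H.toGCogradedMHA := rfl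

variable (H) in
/-- The unit crossed module. -/
def unitObj : CrossedModule H where
  toAGModule := unitMod H.toGCogradedMHA
  π := unitπ H
  π_bijective q s t h := by
    have h' : q⁻¹ * t * q⁻¹⁻¹ = s := by rw [← h]; group
    exact Function.bijective_iff_has_inverse.2
      ⟨unitπ H q⁻¹ h', fun _ => Subtype.ext rfl, fun _ => Subtype.ext rfl⟩
  π_act q s t h a x := by
    rw [unitMod_act, unitMod_act, H.piIso_coe, H.counit_π, map_smul]
  π_comp _ _ _ _ _ _ _ _ _ := rfl

variable (M : CrossedModule H)

/-- The left unit constraint. -/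
def leftUnitorIso : tensorObj (unitObj H) M ≅ M :=
  mkIso
    { app := leftUnitorApp M.toAGModule
      app_act := fun p a x => leftUnitorApp_act _ p a x
      app_π := fun q p p' h x => by
        refine LinearMap.congr_fun
          (f := leftUnitorApp M.toAGModule p' ∘ₗ tensorπ (unitObj H) M q h)
          (g := M.π q h ∘ₗ leftUnitorApp M.toAGModule p) (unit_tensor_ext fun m => ?_) x
        have e := tensorπ_tmk (unitObj H) M q h (one_mul p) (s' := 1) (by simp) h (one_mul p')
          (unitElem H.toGCogradedMHA) m
        refine (congrArg (leftUnitorApp M.toAGModule p') e).trans ?_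
        refine (leftUnitorApp_tmk _ _ _ _ _).trans ?_
        refine Eq.trans ?_ (congrArg (M.π q h) (leftUnitorApp_tmk M.toAGModule p
          (unitElem H.toGCogradedMHA) (one_mul p) m)).symm
        exact (map_smul (M.π q h) (1 : k) m).symm }
    (leftUnitorInvApp M.toAGModule) (leftUnitorInvApp_leftUnitorApp _)
    (leftUnitorApp_leftUnitorInvApp _)

/-- The right unit constraint. -/
def rightUnitorIso : tensorObj M (unitObj H) ≅ M :=
  mkIso
    { app := rightUnitorApp M.toAGModule
      app_act := fun p a x => rightUnitorApp_act _ p a x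
      app_π := fun q p p' h x => by
        refine LinearMap.congr_fun
          (f := rightUnitorApp M.toAGModule p' ∘ₗ tensorπ M (unitObj H) q h)
          (g := M.π q h ∘ₗ rightUnitorApp M.toAGModule p) (tensor_unit_ext fun m => ?_) x
        have e := tensorπ_tmk M (unitObj H) q h (mul_one p) (t' := 1) h (by simp) (mul_one p')
          m (unitElem H.toGCogradedMHA)
        refine (congrArg (rightUnitorApp M.toAGModule p') e).trans ?_
        refine (rightUnitorApp_tmk _ _ _ _ _).trans ?_
        refine Eq.trans ?_ (congrArg (M.π q h) (rightUnitorApp_tmk M.toAGModule p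
          (unitElem H.toGCogradedMHA) (mul_one p) m)).symm
        exact (map_smul (M.π q h) (1 : k) m).symm }
    (rightUnitorInvApp M.toAGModule) (rightUnitorInvApp_rightUnitorApp _)
    (rightUnitorApp_rightUnitorInvApp _)

end Unit

/-! ### The monoidal structure -/

instance : MonoidalCategoryStruct (CrossedModule H) where
  tensorObj := tensorObj
  tensorHom := tensorHom
  whiskerLeft X _ _ f := tensorHom (𝟙 X) f
  whiskerRight f Y := tensorHom f (𝟙 Y)
  tensorUnit := unitObj H
  associator := assocIso
  leftUnitor := leftUnitorIso
  rightUnitor := rightUnitorIso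

theorem assocHom_tmk (L M N : CrossedModule H) {p q r s t u : G} (hs : q * r = s) (h : s * t = p)
    (hu : r * t = u) (h' : q * u = p) (l : L.carrier q) (m : M.carrier r) (n : N.carrier t) :
    Hom.app (assocHom L M N) p ((tensorObj L M).tmk N.toAGModule h
      ((L.tmk M.toAGModule hs (l ⊗ₜ m) : (tensorObj L M).carrier s) ⊗ₜ n)) =
    L.tmk (tensorObj M N).toAGModule h'
      (l ⊗ₜ (M.tmk N.toAGModule hu (m ⊗ₜ n) : (tensorObj M N).carrier u)) :=
  assocApp_tmk hs h hu h' l m n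

instance : MonoidalCategory (CrossedModule H) := MonoidalCategory.ofTensorHom
  (id_tensorHom_id := fun M N => hom_ext fun p => tensor_ext fun s t h m n =>
    tensorHom_tmk (𝟙 M) (𝟙 N) h m n)
  (id_tensorHom := fun _ _ _ _ => rfl)
  (tensorHom_id := fun _ _ => rfl)
  (tensorHom_comp_tensorHom := fun f₁ f₂ g₁ g₂ => hom_ext fun p => tensor_ext fun s t h m n => by
    have a1 := tensorHom_tmk f₁ f₂ h m n
    have a2 := tensorHom_tmk g₁ g₂ h (Hom.app f₁ s m) (Hom.app f₂ t n)
    have a3 := tensorHom_tmk (f₁ ≫ g₁) (f₂ ≫ g₂) h m n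
    exact (congrArg (Hom.app (tensorHom g₁ g₂) p) a1).trans (a2.trans a3.symm))
  (associator_naturality := fun {X₁ X₂ X₃ Y₁ Y₂ Y₃} f₁ f₂ f₃ =>
    hom_ext fun p => tensor_ext₃ fun q r s t hs h l m n => by
    have h' : q * (r * t) = p := by rw [← mul_assoc, hs, h]
    have a1 := tensorHom_tmk (tensorHom f₁ f₂) f₃ h (X₁.tmk X₂.toAGModule hs (l ⊗ₜ m)) n
    have a2 := tensorHom_tmk f₁ f₂ hs l m
    have a3 := assocHom_tmk Y₁ Y₂ Y₃ hs h rfl h' (Hom.app f₁ q l) (Hom.app f₂ r m) (Hom.app f₃ t n)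
    have b1 := assocHom_tmk X₁ X₂ X₃ hs h rfl h' l m n
    have b2 := tensorHom_tmk f₁ (tensorHom f₂ f₃) h' l (X₂.tmk X₃.toAGModule rfl (m ⊗ₜ n))
    have b3 := tensorHom_tmk f₂ f₃ rfl m n
    refine (congrArg (Hom.app (assocHom Y₁ Y₂ Y₃) p) (a1.trans (congrArg (fun z => (tensorObj Y₁ Y₂).tmk Y₃.toAGModule h
      (z ⊗ₜ Hom.app f₃ t n)) a2))).trans (a3.trans ?_)
    exact ((congrArg (Hom.app (tensorHom f₁ (tensorHom f₂ f₃)) p) b1).trans (b2.trans (congrArg (fun z => Y₁.tmk (tensorObj Y₂ Y₃).toAGModule h'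
      (Hom.app f₁ q l ⊗ₜ z)) b3))).symm)
  (leftUnitor_naturality := fun {X Y} f => hom_ext fun p => unit_tensor_ext fun m => by
    have a1 := tensorHom_tmk (𝟙 (unitObj H)) f (one_mul p) (unitElem H.toGCogradedMHA) m
    have a2 := leftUnitorApp_tmk Y.toAGModule p (unitElem H.toGCogradedMHA) (one_mul p)
      (Hom.app f p m)
    have b1 := leftUnitorApp_tmk X.toAGModule p (unitElem H.toGCogradedMHA) (one_mul p) m
    rw [unitVal_unitElem, one_smul] at a2 b1
    refine (congrArg (leftUnitorApp Y.toAGModule p) a1).trans (a2.trans ?_)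
    exact (congrArg (Hom.app f p) b1).symm)
  (rightUnitor_naturality := fun {X Y} f => hom_ext fun p => tensor_unit_ext fun m => by
    have a1 := tensorHom_tmk f (𝟙 (unitObj H)) (mul_one p) m (unitElem H.toGCogradedMHA)
    have a2 := rightUnitorApp_tmk Y.toAGModule p (unitElem H.toGCogradedMHA) (mul_one p)
      (Hom.app f p m)
    have b1 := rightUnitorApp_tmk X.toAGModule p (unitElem H.toGCogradedMHA) (mul_one p) m
    rw [unitVal_unitElem, one_smul] at a2 b1
    refine (congrArg (rightUnitorApp Y.toAGModule p) a1).trans (a2.trans ?_)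
    exact (congrArg (Hom.app f p) b1).symm)
  (pentagon := fun W X Y Z => hom_ext fun p =>
    tensor_ext₄ fun a b e c s d hab hec hsd w x y z => by
    have hbc : a * (b * c) = s := by rw [← mul_assoc, hab, hec]
    have h1 : b * c * d = b * (c * d) := mul_assoc _ _ _
    have h2 : a * (b * (c * d)) = p := by rw [← h1, ← mul_assoc, hbc, hsd]
    have h3 : e * (c * d) = p := by rw [← mul_assoc, hec, hsd]
    have a1 := tensorHom_tmk (assocHom W X Y) (𝟙 Z) hsd
      ((tensorObj W X).tmk Y.toAGModule hec ((W.tmk X.toAGModule hab (w ⊗ₜ x) :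
        (tensorObj W X).carrier e) ⊗ₜ y)) z
    have a2 := assocHom_tmk W X Y hab hec rfl hbc w x y
    have a3 := assocHom_tmk W (tensorObj X Y) Z hbc hsd h1 h2 w
      (X.tmk Y.toAGModule rfl (x ⊗ₜ y)) z
    have a4 := tensorHom_tmk (𝟙 W) (assocHom X Y Z) h2 w
      ((tensorObj X Y).tmk Z.toAGModule h1 ((X.tmk Y.toAGModule rfl (x ⊗ₜ y) :
        (tensorObj X Y).carrier (b * c)) ⊗ₜ z))
    have a5 := assocHom_tmk X Y Z rfl h1 rfl rfl x y z
    have b1 := assocHom_tmk (tensorObj W X) Y Z hec hsd rfl h3 (W.tmk X.toAGModule hab (w ⊗ₜ x)) y z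
    have b2 := assocHom_tmk W X (tensorObj Y Z) hab h3 rfl h2 w x (Y.tmk Z.toAGModule rfl (y ⊗ₜ z))
    refine (congrArg (fun v => Hom.app (tensorHom (𝟙 W) (assocHom X Y Z)) p
      (Hom.app (assocHom W (tensorObj X Y) Z) p v)) (a1.trans (congrArg
        (fun v => (tensorObj W (tensorObj X Y)).tmk Z.toAGModule hsd (v ⊗ₜ z)) a2))).trans ?_
    refine (congrArg (Hom.app (tensorHom (𝟙 W) (assocHom X Y Z)) p) a3).trans ?_
    refine (a4.trans (congrArg (fun v => W.tmk (tensorObj X (tensorObj Y Z)).toAGModule h2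
      (w ⊗ₜ v)) a5)).trans ?_
    exact ((congrArg (Hom.app (assocHom W X (tensorObj Y Z)) p) b1).trans b2).symm)
  (triangle := fun X Y => hom_ext fun p => tensor_unit_tensor_ext fun s d hsd x y => by
    have a1 := assocHom_tmk X (unitObj H) Y (mul_one s) hsd (one_mul d) hsd x
      (unitElem H.toGCogradedMHA) y
    have a2 := tensorHom_tmk (𝟙 X) (leftUnitorIso Y).hom hsd x
      ((unitObj H).tmk Y.toAGModule (one_mul d) (unitElem H.toGCogradedMHA ⊗ₜ y))
    have a3 := leftUnitorApp_tmk Y.toAGModule d (unitElem H.toGCogradedMHA) (one_mul d) y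
    have b1 := tensorHom_tmk (rightUnitorIso X).hom (𝟙 Y) hsd
      (X.tmk (unitObj H).toAGModule (mul_one s) (x ⊗ₜ unitElem H.toGCogradedMHA)) y
    have b2 := rightUnitorApp_tmk X.toAGModule s (unitElem H.toGCogradedMHA) (mul_one s) x
    rw [unitVal_unitElem, one_smul] at a3 b2
    refine (congrArg (Hom.app (tensorHom (𝟙 X) (leftUnitorIso Y).hom) p) a1).trans ?_
    refine (a2.trans (congrArg (fun v => X.tmk Y.toAGModule hsd (x ⊗ₜ v)) a3)).trans ?_
    exact (b1.trans (congrArg (fun v => X.tmk Y.toAGModule hsd (v ⊗ₜ y)) b2)).symm)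

end CrossedModule

end Crossed

/-! ## The braiding and quasitriangular structures -/

section Quasitriangular

variable {k G A : Type u} [Field k] [Group G] [DecidableEq G]
  [NonUnitalRing A] [Module k A] [IsScalarTower k A A] [SMulCommClass k A A]
  (H : MultiplierHopfTCoalgebra k G A)

section Braid

variable {H} (R : ∀ p q : G, Mult k (H.C p ⊗[k] H.C q)) (M N : CrossedModule H)

/-- `c_{M_s, N_t}(m ⊗ n) = (π_{N,s} ⊗ ι) τ (R_{s,t} · (m ⊗ n))`, a map
`M_s ⊗ N_t → N_{s t s⁻¹} ⊗ M_s`. -/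
def braidComp (s t : G) :
    M.carrier s ⊗[k] N.carrier t →ₗ[k] N.carrier (s * t * s⁻¹) ⊗[k] M.carrier s :=
  TensorProduct.map (N.π s rfl) LinearMap.id ∘ₗ
    (TensorProduct.comm k (M.carrier s) (N.carrier t)).toLinearMap ∘ₗ
    (M.unital₂ N.toAGModule s t).ext (R s t)

/-- `c_{M,N} : (M ⊗ N)_p → (N ⊗ M)_p`, the direct sum of the `c_{M_s, N_t}` with `s t = p`. -/
def braid (p : G) : (MonoidalCategory.tensorObj M N).carrier p →ₗ[k]
    (MonoidalCategory.tensorObj N M).carrier p :=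
  AGModule.tdesc (M := M.toAGModule) (N := N.toAGModule) fun s t h =>
    N.tmk M.toAGModule (show s * t * s⁻¹ * s = p by rw [inv_mul_cancel_right, h]) ∘ₗ
      braidComp R M N s t

end Braid

/-- `Δ̃_{r,s} : A_{s r} → M(A_r ⊗ A_s)`, `a ↦ (π_{s⁻¹} ⊗ ι)Δ_{s r s⁻¹, s}(a)`, the component of the
deformed comultiplication. -/
def comulTilde (r s : G) : NondegHom k (H.C (s * r)) (H.C r ⊗[k] H.C s) :=
  (H.comulHom (s := s * r * s⁻¹) (t := s) (inv_mul_cancel_right (s * r) s)).congr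
    (AlgIso.tensor (H.piIso s⁻¹ (show s⁻¹ * (s * r * s⁻¹) * s⁻¹⁻¹ = r by group))
      (AlgIso.refl k (H.C s)))

theorem nondeg₃ (r s t : G) : NondegMul (H.C r ⊗[k] (H.C s ⊗[k] H.C t)) :=
  (H.nondeg r).tensor (H.nondeg₂ s t)

/-- `R₁₂` in `M(A_r ⊗ A_s ⊗ A_t)` for `R ∈ M(A_r ⊗ A_s)`. -/
def leg₁₂ (r s t : G) (R : Mult k (H.C r ⊗[k] H.C s)) :
    Mult k (H.C r ⊗[k] (H.C s ⊗[k] H.C t)) :=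
  Mult.congr (AlgIso.assoc k (H.C r) (H.C s) (H.C t)) (Mult.tmul R 1)

/-- `R₂₃` in `M(A_r ⊗ A_s ⊗ A_t)` for `R ∈ M(A_s ⊗ A_t)`. -/
def leg₂₃ (r s t : G) (R : Mult k (H.C s ⊗[k] H.C t)) :
    Mult k (H.C r ⊗[k] (H.C s ⊗[k] H.C t)) :=
  Mult.tmul 1 R

/-- `R₁₃` in `M(A_r ⊗ A_s ⊗ A_t)` for `R ∈ M(A_r ⊗ A_t)`. -/
def leg₁₃ (r s t : G) (R : Mult k (H.C r ⊗[k] H.C t)) :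
    Mult k (H.C r ⊗[k] (H.C s ⊗[k] H.C t)) :=
  Mult.congr (AlgIso.leftComm k (H.C s) (H.C r) (H.C t)) (Mult.tmul 1 R)

/-- `(ι ⊗ Δ_{s,t})(R)` for `R ∈ M(A_r ⊗ A_{st})`. -/
def idTensorComul (r s t : G) (R : Mult k (H.C r ⊗[k] H.C (s * t))) :
    Mult k (H.C r ⊗[k] (H.C s ⊗[k] H.C t)) :=
  ((NondegHom.id k (H.C r) (H.span_mul r)).tensor (H.comulHom rfl)).ext (nondeg₃ H r s t) R

/-- `(Δ̃_{r,s} ⊗ ι)(R)` for `R ∈ M(A_{sr} ⊗ A_t)`. -/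
def comulTildeTensorId (r s t : G) (R : Mult k (H.C (s * r) ⊗[k] H.C t)) :
    Mult k (H.C r ⊗[k] (H.C s ⊗[k] H.C t)) :=
  Mult.congr (AlgIso.assoc k (H.C r) (H.C s) (H.C t))
    (((comulTilde H r s).tensor (NondegHom.id k (H.C t) (H.span_mul t))).ext
      ((H.nondeg₂ r s).tensor (H.nondeg t)) R)

/-- The family `R = (R_{p,q})` of multipliers is a quasitriangular structure on `A`: every
`R_{p,q}` is invertible, and `(π_q ⊗ π_q)(R) = R`, `R Δ(a) = Δ̃^{cop}(a) R`,
`(ι ⊗ Δ)(R) = R₁₃ R₁₂` and `(Δ̃ ⊗ ι)(R) = R₁₃ R₂₃` hold in every component. -/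
structure IsQuasitriangular (R : ∀ p q : G, Mult k (H.C p ⊗[k] H.C q)) : Prop where
  isUnit : ∀ s t, IsUnit (R s t)
  invariant : ∀ q s t : G,
    Mult.congr (AlgIso.tensor (H.piIso q (s := s) rfl) (H.piIso q (s := t) rfl)) (R s t) =
      R (q * s * q⁻¹) (q * t * q⁻¹)
  mul_comul : ∀ (s t : G) (a : H.C (s * t)),
    R s t * H.comul s t a =
      Mult.congr (AlgIso.comm k (H.C t) (H.C s)) ((comulTilde H t s).toLin a) * R s t
  comul_right : ∀ r s t : G,
    idTensorComul H r s t (R r (s * t)) = leg₁₃ H r s t (R r t) * leg₁₂ H r s t (R r s)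
  comul_left : ∀ r s t : G,
    comulTildeTensorId H r s t (R (s * r) t) = leg₁₃ H r s t (R r t) * leg₂₃ H r s t (R s t)

end Quasitriangular

end

end TCoalg

/-!
The maps `c_{M,N}` are, on each summand, the bijection `m ⊗ n ↦ π_s n ⊗ m` after the action of
`R_{s,t}`.  Hence every axiom of a braiding compares the actions of two multipliers, followed by the
same injective map: compatibility with the crossing compares `(π_q ⊗ π_q)(R_{s,t})` with
`R_{qsq⁻¹,qtq⁻¹}` (`π_braid_tmk`, `braid_π_tmk`), linearity over `A` compares `R Δ(a)` with
`τ(Δ̃(a)) R` (`braid_act_tmk`, `act_braid_tmk`), and the two hexagons compare `(ι ⊗ Δ)(R)` with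
`R₁₃ R₁₂` and `(Δ̃ ⊗ ι)(R)` with `R₁₃ R₂₃` (`hexagon_forward_left`, `hexagon_forward_right`,
`hexagon_reverse_left`, `hexagon_reverse_right`).  So a quasitriangular structure gives a braiding.

Conversely, the algebras `A_p` form a crossed module under left multiplication, on which a multiplier
is determined by its action; evaluated there, the axioms of the braiding give the four identities of
a quasitriangular structure.  What remains is the invertibility of `R_{s,t}` as a multiplier.  Since
the braiding is an isomorphism, left multiplication by `R_{s,t}` is bijective, and it suffices that
right multiplication by it is surjective (`Mult.isUnit_of_bijective`).  The braiding with the unit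
object gives `(ι ⊗ ε)(R_{r,1}) = 1` and `(ε ⊗ ι)(R_{1,t}) = 1`.  Therefore the identities for
`(ι ⊗ Δ)(R_{r,1})` and `(Δ̃ ⊗ ι)(R_{1,t})`, contracted with the antipode `S`, say that
`R_{r,t} = (ι ⊗ S)(R_{r,t⁻¹}⁻¹)` and that `(S π_s ⊗ ι)(R_{s⁻¹,t})` is a left inverse of `R_{s,t}`,
with the reservation that `S` has values in `M(A)` and is not defined on multipliers of `A ⊗ A`.  The
first identity, read with the inverse of the left multiplication, shows that `(1 ⊗ c) R_{r,t} (a ⊗ 1)`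
lies in `A_r ⊗ A_t` (`exists_eq_mul_of_braided`); `S π_s ⊗ ι` can be applied to such elements, and
the second identity then gives the surjectivity (`r_surjective_of_braided`).
-/

namespace TCoalg

noncomputable section

set_option linter.unusedSectionVars false

/-! ### Extended module structures and multipliers -/

section Generic

variable {k : Type*} [Field k]
variable {B C D : Type*}
  [NonUnitalRing B] [Module k B] [IsScalarTower k B B] [SMulCommClass k B B]
  [NonUnitalRing C] [Module k C] [IsScalarTower k C C] [SMulCommClass k C C]
  [NonUnitalRing D] [Module k D] [IsScalarTower k D D] [SMulCommClass k D D]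
variable {X Y Z W : Type*} [AddCommGroup X] [Module k X] [AddCommGroup Y] [Module k Y]
  [AddCommGroup Z] [Module k Z] [AddCommGroup W] [Module k W]

theorem IsUnitalModule.comp_ext {actX : B →ₗ[k] X →ₗ[k] X} {actX' : B →ₗ[k] X →ₗ[k] X}
    (h : IsUnitalModule actX) (h' : IsUnitalModule actX') (e : actX = actX') (m : Mult k B) :
    h.ext m = h'.ext m := by subst e; rfl

/-- If `f` is linear along `e` and `g` is linear along `e'`, then `f ⊗ g` is linear along
`e ⊗ e'`. -/
theorem tensorAct_intertwine {B' C' : Type*}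
    [NonUnitalRing B'] [Module k B'] [IsScalarTower k B' B'] [SMulCommClass k B' B']
    [NonUnitalRing C'] [Module k C'] [IsScalarTower k C' C'] [SMulCommClass k C' C']
    {actX : B →ₗ[k] X →ₗ[k] X} {actY : C →ₗ[k] Y →ₗ[k] Y}
    {actZ : B' →ₗ[k] Z →ₗ[k] Z} {actW : C' →ₗ[k] W →ₗ[k] W}
    (e : B →ₗ[k] B') (e' : C →ₗ[k] C') (f : X →ₗ[k] Z) (g : Y →ₗ[k] W)
    (hf : ∀ b x, f (actX b x) = actZ (e b) (f x)) (hg : ∀ c y, g (actY c y) = actW (e' c) (g y))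
    (b : B ⊗[k] C) (z : X ⊗[k] Y) :
    TensorProduct.map f g (tensorAct actX actY b z) =
      tensorAct actZ actW (TensorProduct.map e e' b) (TensorProduct.map f g z) := by
  induction b using TensorProduct.induction_on with
  | zero => simp
  | add u v hu hv => simp only [map_add, LinearMap.add_apply, hu, hv]
  | tmul b c =>
    induction z using TensorProduct.induction_on with
    | zero => simp
    | add u v hu hv => simp only [map_add, hu, hv]
    | tmul x y => simp [hf, hg]

theorem tensorAct_comm {actX : B →ₗ[k] X →ₗ[k] X} {actY : C →ₗ[k] Y →ₗ[k] Y}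
    (b : B ⊗[k] C) (z : X ⊗[k] Y) :
    TensorProduct.comm k X Y (tensorAct actX actY b z) =
      tensorAct actY actX (TensorProduct.comm k B C b) (TensorProduct.comm k X Y z) := by
  induction b using TensorProduct.induction_on with
  | zero => simp
  | add u v hu hv => simp only [map_add, LinearMap.add_apply, hu, hv]
  | tmul b c =>
    induction z using TensorProduct.induction_on with
    | zero => simp
    | add u v hu hv => simp only [map_add, hu, hv]
    | tmul x y => simp

theorem tensorAct_assoc {actX : B →ₗ[k] X →ₗ[k] X} {actY : C →ₗ[k] Y →ₗ[k] Y}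
    {actZ : D →ₗ[k] Z →ₗ[k] Z} (b : (B ⊗[k] C) ⊗[k] D) (z : (X ⊗[k] Y) ⊗[k] Z) :
    TensorProduct.assoc k X Y Z (tensorAct (tensorAct actX actY) actZ b z) =
      tensorAct actX (tensorAct actY actZ) (TensorProduct.assoc k B C D b)
        (TensorProduct.assoc k X Y Z z) := by
  have : ∀ b z, (TensorProduct.assoc k X Y Z).toLinearMap
      (tensorAct (tensorAct actX actY) actZ b z) =
      tensorAct actX (tensorAct actY actZ) (TensorProduct.assoc k B C D b)
        (TensorProduct.assoc k X Y Z z) := by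
    intro b
    refine LinearMap.congr_fun (f := (TensorProduct.assoc k X Y Z).toLinearMap ∘ₗ
      tensorAct (tensorAct actX actY) actZ b) (g := tensorAct actX (tensorAct actY actZ)
        (TensorProduct.assoc k B C D b) ∘ₗ (TensorProduct.assoc k X Y Z).toLinearMap) ?_
    refine TensorProduct.ext_threefold fun x y z => ?_
    induction b using TensorProduct.induction_on with
    | zero => simp
    | add u v hu hv =>
      simp only [LinearMap.comp_apply, LinearEquiv.coe_coe] at hu hv ⊢
      simp only [map_add, LinearMap.add_apply, hu, hv]
    | tmul b d =>
      induction b using TensorProduct.induction_on with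
      | zero => simp
      | add u v hu hv =>
        simp only [LinearMap.comp_apply, LinearEquiv.coe_coe] at hu hv ⊢
        simp only [map_add, TensorProduct.add_tmul, LinearMap.add_apply, hu, hv]
      | tmul b c => simp
  exact this b z

theorem tensorAct_leftComm {actX : B →ₗ[k] X →ₗ[k] X} {actY : C →ₗ[k] Y →ₗ[k] Y}
    {actZ : D →ₗ[k] Z →ₗ[k] Z} (b : B ⊗[k] (C ⊗[k] D)) (z : X ⊗[k] (Y ⊗[k] Z)) :
    TensorProduct.leftComm k X Y Z (tensorAct actX (tensorAct actY actZ) b z) =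
      tensorAct actY (tensorAct actX actZ) (TensorProduct.leftComm k B C D b)
        (TensorProduct.leftComm k X Y Z z) := by
  induction z using TensorProduct.induction_on with
  | zero => simp
  | add u v hu hv => simp only [map_add, hu, hv]
  | tmul x z =>
    induction z using TensorProduct.induction_on with
    | zero => simp
    | add u v hu hv => simp only [map_add, TensorProduct.tmul_add, hu, hv]
    | tmul y z =>
      induction b using TensorProduct.induction_on with
      | zero => simp
      | add u v hu hv => simp only [map_add, LinearMap.add_apply, hu, hv]
      | tmul b d =>
        induction d using TensorProduct.induction_on with
        | zero => simp
        | add u v hu hv => simp only [map_add, TensorProduct.tmul_add, LinearMap.add_apply, hu, hv]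
        | tmul c d => simp

theorem NondegHom.ext_mul_toLin (f : NondegHom k B C) (hC : NondegMul C) (m : Mult k B) (b : B) :
    f.ext hC m * f.toLin b = f.toLin (m.l b) :=
  Mult.ext_l hC fun x => f.extL_apply hC m b x

/-- The extension to `M(B)` of the pull-back of a `C`-module along `f : B → M(C)` is the pull-back
along the extension `M(B) → M(C)` of `f`. -/
theorem IsUnitalModule.ext_pull (f : NondegHom k B C) (hC : NondegMul C)
    {act : C →ₗ[k] X →ₗ[k] X} (h : IsUnitalModule act) (m : Mult k B) (x : X) :
    (h.pull f).ext m x = h.ext (f.ext hC m) x := by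
  refine (h.pull f).ext_unique _ _ (fun b x => ?_) x
  rw [pullAct_apply, pullAct_apply, ← h.ext_mul, f.ext_mul_toLin]

theorem pullAct_tensor {B' C' : Type*}
    [NonUnitalRing B'] [Module k B'] [IsScalarTower k B' B'] [SMulCommClass k B' B']
    [NonUnitalRing C'] [Module k C'] [IsScalarTower k C' C'] [SMulCommClass k C' C']
    (f : NondegHom k B C) (g : NondegHom k B' C')
    {actX : C →ₗ[k] X →ₗ[k] X} {actY : C' →ₗ[k] Y →ₗ[k] Y}
    (hX : IsUnitalModule actX) (hY : IsUnitalModule actY) :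
    tensorAct (pullAct f hX) (pullAct g hY) = pullAct (f.tensor g) (hX.tensor hY) := by
  refine TensorProduct.ext' fun b b' => LinearMap.ext fun z => ?_
  rw [pullAct_apply]
  exact (hX.ext_tmul hY _ _ z).symm

theorem pullAct_id (hB : Submodule.span k {y : B | ∃ a b, a * b = y} = ⊤)
    {act : B →ₗ[k] X →ₗ[k] X} (h : IsUnitalModule act) :
    pullAct (NondegHom.id k B hB) h = act :=
  LinearMap.ext fun b => LinearMap.ext fun x => h.ext_incl b x

/-- For `g : C → M(D)` and a `D`-module `Y`, the action of `M(B ⊗ C)` on `X ⊗ Y` is given by the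
extension `M(B ⊗ C) → M(B ⊗ D)` of `ι ⊗ g`. -/
theorem IsUnitalModule.ext_id_tensor_pull (hB : Submodule.span k {y : B | ∃ a b, a * b = y} = ⊤)
    (g : NondegHom k C D) (hBD : NondegMul (B ⊗[k] D))
    {actX : B →ₗ[k] X →ₗ[k] X} {actY : D →ₗ[k] Y →ₗ[k] Y}
    (hX : IsUnitalModule actX) (hY : IsUnitalModule actY) (m : Mult k (B ⊗[k] C)) (z : X ⊗[k] Y) :
    (hX.tensor (hY.pull g)).ext m z =
      (hX.tensor hY).ext (((NondegHom.id k B hB).tensor g).ext hBD m) z := by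
  rw [← IsUnitalModule.ext_pull]
  refine LinearMap.congr_fun (IsUnitalModule.comp_ext _ _ ?_ m) z
  rw [← pullAct_tensor _ _ hX hY, pullAct_id]

theorem IsUnitalModule.ext_pull_tensor_id (hB : Submodule.span k {y : B | ∃ a b, a * b = y} = ⊤)
    (g : NondegHom k C D) (hBD : NondegMul (D ⊗[k] B))
    {actX : B →ₗ[k] X →ₗ[k] X} {actY : D →ₗ[k] Y →ₗ[k] Y}
    (hX : IsUnitalModule actX) (hY : IsUnitalModule actY) (m : Mult k (C ⊗[k] B)) (z : Y ⊗[k] X) :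
    ((hY.pull g).tensor hX).ext m z =
      (hY.tensor hX).ext ((g.tensor (NondegHom.id k B hB)).ext hBD m) z := by
  rw [← IsUnitalModule.ext_pull]
  refine LinearMap.congr_fun (IsUnitalModule.comp_ext _ _ ?_ m) z
  rw [← pullAct_tensor _ _ hY hX, pullAct_id]

section Legs

variable {actX : B →ₗ[k] X →ₗ[k] X} {actY : C →ₗ[k] Y →ₗ[k] Y} {actZ : D →ₗ[k] Z →ₗ[k] Z}
  (hX : IsUnitalModule actX) (hY : IsUnitalModule actY) (hZ : IsUnitalModule actZ)

theorem IsUnitalModule.ext_congr_comm (m : Mult k (B ⊗[k] C)) (z : X ⊗[k] Y) :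
    (hY.tensor hX).ext (Mult.congr (AlgIso.comm k B C) m) (TensorProduct.comm k X Y z) =
      TensorProduct.comm k X Y ((hX.tensor hY).ext m z) :=
  ((hX.tensor hY).ext_map_congr (hY.tensor hX) (AlgIso.comm k B C)
    (TensorProduct.comm k X Y).toLinearMap tensorAct_comm m z).symm

theorem IsUnitalModule.ext_congr_assoc (m : Mult k ((B ⊗[k] C) ⊗[k] D)) (z : (X ⊗[k] Y) ⊗[k] Z) :
    (hX.tensor (hY.tensor hZ)).ext (Mult.congr (AlgIso.assoc k B C D) m)
      (TensorProduct.assoc k X Y Z z) =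
      TensorProduct.assoc k X Y Z (((hX.tensor hY).tensor hZ).ext m z) :=
  (((hX.tensor hY).tensor hZ).ext_map_congr (hX.tensor (hY.tensor hZ)) (AlgIso.assoc k B C D)
    (TensorProduct.assoc k X Y Z).toLinearMap tensorAct_assoc m z).symm

theorem IsUnitalModule.ext_congr_leftComm (m : Mult k (B ⊗[k] (C ⊗[k] D)))
    (z : X ⊗[k] (Y ⊗[k] Z)) :
    (hY.tensor (hX.tensor hZ)).ext (Mult.congr (AlgIso.leftComm k B C D) m)
      (TensorProduct.leftComm k X Y Z z) =
      TensorProduct.leftComm k X Y Z ((hX.tensor (hY.tensor hZ)).ext m z) :=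
  ((hX.tensor (hY.tensor hZ)).ext_map_congr (hY.tensor (hX.tensor hZ)) (AlgIso.leftComm k B C D)
    (TensorProduct.leftComm k X Y Z).toLinearMap tensorAct_leftComm m z).symm

end Legs

/-- An algebra with `B B = B` and non-degenerate product, as a module over itself. -/
theorem isUnitalModule_mul (hB : NondegMul B)
    (h : Submodule.span k {y : B | ∃ a b, a * b = y} = ⊤) :
    IsUnitalModule (LinearMap.mul k B) where
  mul_act a b x := by simp [mul_assoc]
  unital := h
  nondeg x hx := hB.2 x hx

/-- On the algebra itself, a multiplier acts by its left multiplication. -/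
theorem IsUnitalModule.ext_eq_l (hB : NondegMul B) {act : B →ₗ[k] B →ₗ[k] B}
    (h : IsUnitalModule act) (hact : ∀ b x, act b x = b * x) (m : Mult k B) (x : B) :
    h.ext m x = m.l x :=
  h.ext_unique m m.l (fun b x => by rw [hact, hact, Mult.l_mul_right hB]) x

theorem tensorAct_mul {actX : B →ₗ[k] B →ₗ[k] B} {actY : C →ₗ[k] C →ₗ[k] C}
    (hX : ∀ b x, actX b x = b * x) (hY : ∀ b x, actY b x = b * x) (b x : B ⊗[k] C) :
    tensorAct actX actY b x = b * x := by
  induction b using TensorProduct.induction_on with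
  | zero => simp
  | add u v hu hv => simp only [map_add, LinearMap.add_apply, add_mul, hu, hv]
  | tmul b c =>
    induction x using TensorProduct.induction_on with
    | zero => simp
    | add u v hu hv => simp only [map_add, mul_add, hu, hv]
    | tmul x y => simp [hX, hY]

/-- The left multiplication of a multiplier of `C` preserves the direct factor `B`. -/
theorem IsFactor.j_restrict_l {j : B →ₗ[k] C} {r : C →ₗ[k] B} (h : IsFactor j r)
    (hC : NondegMul C) (m : Mult k C) (x : B) : j ((Mult.restrict h m).l x) = m.l (j x) := by
  rw [Mult.restrict_l]
  refine (sub_eq_zero.1 (hC.1 _ fun w => ?_)).symm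
  rw [sub_mul, ← h.mul_right, h.mul_left, ← m.l_mul_right hC, ← m.l_mul_right hC,
    ← h.mul_right, ← h.map_mul, sub_self]

/-- A multiplier whose left multiplication is bijective and whose right multiplication is
surjective is invertible.  (The bijectivity of the left multiplication alone is not sufficient: its
inverse need not have a companion right multiplication.) -/
theorem Mult.isUnit_of_bijective (hB : NondegMul B) (m : Mult k B) (hl : Function.Bijective m.l)
    (hr : Function.Surjective m.r) : IsUnit m := by
  have hri : Function.Injective m.r := by
    refine (injective_iff_map_eq_zero m.r).2 fun x hx => hB.1 _ fun y => ?_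
    obtain ⟨z, rfl⟩ := hl.2 y
    rw [m.l_r, hx, zero_mul]
  let el := LinearEquiv.ofBijective m.l hl
  let er := LinearEquiv.ofBijective m.r ⟨hri, hr⟩
  have h1 : ∀ x, m.l (el.symm x) = x := el.apply_symm_apply
  have h2 : ∀ x, m.r (er.symm x) = x := er.apply_symm_apply
  have h1' : ∀ x, el.symm (m.l x) = x := el.symm_apply_apply
  let n : Mult k B := Mult.mk el.symm.toLinearMap er.symm.toLinearMap (by
    intro x y
    change x * el.symm y = er.symm x * y
    rw [← h1 y, h1', m.l_r, h2])
  exact ⟨⟨m, n, Mult.ext_l hB h1, Mult.ext_l hB h1'⟩, rfl⟩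

end Generic

section Crossed

variable {k G A : Type u} [Field k] [Group G] [DecidableEq G]
  [NonUnitalRing A] [Module k A] [IsScalarTower k A A] [SMulCommClass k A A]

/-! ### The components of the maps `c` -/

namespace AGModule

variable {H : GCogradedMHA k G A} (M N : AGModule H)

theorem tmk_injective {s t p : G} (h : s * t = p) : Function.Injective (M.tmk N h) :=
  DirectSum.of_injective (β := fun x : Fib p => M.carrier x.1.1 ⊗[k] N.carrier x.1.2) ⟨(s, t), h⟩

/-- The projection of `(M ⊗ N)_p` on the summand `M_s ⊗ N_t`. -/
def tproj {s t p : G} (h : s * t = p) :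
    (M.tensor N).carrier p →ₗ[k] M.carrier s ⊗[k] N.carrier t :=
  DirectSum.component k (Fib p) (fun x => M.carrier x.1.1 ⊗[k] N.carrier x.1.2) ⟨(s, t), h⟩

theorem tproj_tmk {s t p : G} (h : s * t = p) (z : M.carrier s ⊗[k] N.carrier t) :
    M.tproj N h (M.tmk N h z) = z :=
  DirectSum.component.lof_self k (M := fun x : Fib p => M.carrier x.1.1 ⊗[k] N.carrier x.1.2)
    ⟨(s, t), h⟩ z

theorem tproj_tmk_ne {s t s' t' p : G} (h : s * t = p) (h' : s' * t' = p) (hs : s' ≠ s)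
    (z : M.carrier s' ⊗[k] N.carrier t') : M.tproj N h (M.tmk N h' z) = 0 := by
  refine (DirectSum.component.of k
    (M := fun x : Fib p => M.carrier x.1.1 ⊗[k] N.carrier x.1.2)
    ⟨(s, t), h⟩ ⟨(s', t'), h'⟩ z).trans (dif_neg fun e => hs ?_)
  exact congrArg (fun x : Fib p => x.1.1) e

end AGModule

namespace CrossedModule

open AGModule

variable {H : MultiplierHopfTCoalgebra k G A} (R : ∀ p q : G, Mult k (H.C p ⊗[k] H.C q))

section Components

variable (M N : CrossedModule H)

/-- The isomorphism `m ⊗ n ↦ π_{N,s} n ⊗ m` from `M_s ⊗ N_t` to `N_u ⊗ M_s`, where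
`u = s t s⁻¹`. -/
def twist {s t u : G} (h : s * t * s⁻¹ = u) :
    M.carrier s ⊗[k] N.carrier t →ₗ[k] N.carrier u ⊗[k] M.carrier s :=
  TensorProduct.map (N.π s h) LinearMap.id ∘ₗ
    (TensorProduct.comm k (M.carrier s) (N.carrier t)).toLinearMap

@[simp] theorem twist_tmul {s t u : G} (h : s * t * s⁻¹ = u) (m : M.carrier s) (n : N.carrier t) :
    twist M N h (m ⊗ₜ n) = N.π s h n ⊗ₜ m := rfl

/-- The isomorphism `π_{M,q} : M_s → M_t`, where `t = q s q⁻¹`. -/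
def πEquiv (q : G) {s t : G} (h : q * s * q⁻¹ = t) : M.carrier s ≃ₗ[k] M.carrier t :=
  LinearEquiv.ofBijective (M.π q h) (M.π_bijective q h)

theorem twist_bijective {s t u : G} (h : s * t * s⁻¹ = u) :
    Function.Bijective (twist M N h) :=
  ((TensorProduct.comm k (M.carrier s) (N.carrier t)) ≪≫ₗ
    TensorProduct.congr (N.πEquiv s h) (LinearEquiv.refl k _)).bijective

/-- The maps `c` are `twist` after the action of `R`. -/
theorem braid_tmk {s t u p : G} (h : s * t = p) (hu : s * t * s⁻¹ = u) (h' : u * s = p)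
    (z : M.carrier s ⊗[k] N.carrier t) :
    braid R M N p (M.tmk N.toAGModule h z) =
      N.tmk M.toAGModule h' (twist M N hu ((M.unital₂ N.toAGModule s t).ext (R s t) z)) := by
  subst hu
  exact tdesc_tmk _ _ _ _ _

theorem conj_mul_self {s t p : G} (h : s * t = p) : s * t * s⁻¹ * s = p := by
  rw [inv_mul_cancel_right, h]

/-! ### Linearity of the maps `c` -/

/-- The map `π_{N,s} ⊗ ι` from `N_t ⊗ M_s`, on which `A_{st}` acts through `Δ̃_{t,s}`, to
`N_{sts⁻¹} ⊗ M_s`, on which it acts through `Δ`, is linear. -/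
theorem pairAct_map_π {s t u : G} (hu : s * t * s⁻¹ = u) (h' : u * s = s * t)
    (a : H.C (s * t)) (z : N.carrier t ⊗[k] M.carrier s) :
    N.pairAct M.toAGModule h' a (TensorProduct.map (N.π s hu) LinearMap.id z) =
      TensorProduct.map (N.π s hu) LinearMap.id
        (pullAct (comulTilde H t s) (N.unital₂ M.toAGModule t s) a z) := by
  subst hu
  rw [pairAct_apply]
  let e' : AlgIso k (H.C t) (H.C (s * t * s⁻¹)) := H.piIso s rfl
  have key := ((N.unital t).tensor (M.unital s)).ext_map_congr (N.unital₂ M.toAGModule _ s)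
    (AlgIso.tensor e' (AlgIso.refl k (H.C s)))
    (TensorProduct.map (N.π s rfl) LinearMap.id)
    (tensorAct_intertwine _ _ _ _ (N.π_act s rfl) fun _ _ => rfl)
    ((comulTilde H t s).toLin a) z
  refine Eq.trans ?_ key.symm
  congr 2
  -- applying `π_s ⊗ ι` to `Δ̃` undoes the `π_{s⁻¹} ⊗ ι` in its definition
  refine Mult.ext_l (H.nondeg₂ _ _) fun x => ?_
  have e1 : ∀ x, (TensorProduct.congr e'.toLinearEquiv (LinearEquiv.refl k (H.C s)))
      (TensorProduct.congr (H.piIso s⁻¹ (s := s * t * s⁻¹) (t := t) (by group)).toLinearEquiv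
        (LinearEquiv.refl k (H.C s)) x) = x := by
    intro x
    induction x using TensorProduct.induction_on with
    | zero => simp
    | add u v hu hv => simp only [map_add, hu, hv]
    | tmul x y =>
      simp only [TensorProduct.congr_tmul, LinearEquiv.refl_apply]
      congr 1
      exact Subtype.ext (H.π_apply_inv s _)
  have e2 : (TensorProduct.congr (H.piIso s⁻¹ (s := s * t * s⁻¹) (t := t) (by group)).toLinearEquiv
        (LinearEquiv.refl k (H.C s))).symm
      ((TensorProduct.congr e'.toLinearEquiv (LinearEquiv.refl k (H.C s))).symm x) = x := by
    rw [LinearEquiv.symm_apply_eq, LinearEquiv.symm_apply_eq, e1]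
  refine (e1 _).symm.trans ?_
  refine congrArg (fun w => TensorProduct.congr e'.toLinearEquiv (LinearEquiv.refl k (H.C s))
    (TensorProduct.congr (H.piIso s⁻¹ (s := s * t * s⁻¹) (t := t) (by group)).toLinearEquiv
        (LinearEquiv.refl k (H.C s)) ((H.comul (s * t * s⁻¹) s a).l w))) e2.symm

/-- `twist` transforms the action of `τ(Δ̃_{t,s}(a))` into the action of `a` on `N_u ⊗ M_s`. -/
theorem twist_pairAct {s t p u : G} (h : s * t = p) (hu : s * t * s⁻¹ = u) (h' : u * s = p)
    (a : H.C p) (z : M.carrier s ⊗[k] N.carrier t) :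
    N.pairAct M.toAGModule h' a (twist M N hu z) =
      twist M N hu ((M.unital₂ N.toAGModule s t).ext (Mult.congr (AlgIso.comm k (H.C t) (H.C s))
        ((comulTilde H t s).toLin (⟨a, by rw [h]; exact a.2⟩ : H.C (s * t)))) z) := by
  subst h
  obtain ⟨z, rfl⟩ := (TensorProduct.comm k (N.carrier t) (M.carrier s)).surjective z
  rw [IsUnitalModule.ext_congr_comm (N.unital t) (M.unital s)]
  have e : ∀ w, twist M N hu (TensorProduct.comm k (N.carrier t) (M.carrier s) w) =
      TensorProduct.map (N.π s hu) LinearMap.id w := by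
    intro w
    induction w using TensorProduct.induction_on with
    | zero => simp
    | add u v hu hv => simp only [map_add, hu, hv]
    | tmul x y => simp
  rw [e, e, pairAct_map_π]
  rfl

theorem act_braid_tmk {s t p u : G} (h : s * t = p) (hu : s * t * s⁻¹ = u) (h' : u * s = p)
    (a : H.C p) (z : M.carrier s ⊗[k] N.carrier t) :
    (N.toAGModule.tensor M.toAGModule).act p a (braid R M N p (M.tmk N.toAGModule h z)) =
      N.tmk M.toAGModule h' (twist M N hu ((M.unital₂ N.toAGModule s t).ext
        (Mult.congr (AlgIso.comm k (H.C t) (H.C s))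
          ((comulTilde H t s).toLin (⟨a, by rw [h]; exact a.2⟩ : H.C (s * t))) * R s t) z)) := by
  refine (congrArg _ (braid_tmk R M N h hu h' z)).trans ((act_tmk _ _ _ _ _).trans ?_)
  rw [twist_pairAct M N h hu h', IsUnitalModule.ext_mul]

theorem braid_act_tmk {s t p u : G} (h : s * t = p) (hu : s * t * s⁻¹ = u) (h' : u * s = p)
    (a : H.C p) (z : M.carrier s ⊗[k] N.carrier t) :
    braid R M N p ((M.toAGModule.tensor N.toAGModule).act p a (M.tmk N.toAGModule h z)) =
      N.tmk M.toAGModule h' (twist M N hu ((M.unital₂ N.toAGModule s t).ext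
        (R s t * H.comul s t a) z)) := by
  refine (congrArg (braid R M N p) (act_tmk _ _ h a z)).trans ?_
  rw [braid_tmk R M N h hu h', IsUnitalModule.ext_mul]
  rfl

/-! ### Compatibility of the maps `c` with the crossing -/

theorem map_π_ext (q : G) {s t s' t' : G} (hs : q * s * q⁻¹ = s') (ht : q * t * q⁻¹ = t')
    (m : Mult k (H.C s ⊗[k] H.C t)) (z : M.carrier s ⊗[k] N.carrier t) :
    TensorProduct.map (M.π q hs) (N.π q ht) ((M.unital₂ N.toAGModule s t).ext m z) =
      (M.unital₂ N.toAGModule s' t').ext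
        (Mult.congr (AlgIso.tensor (H.piIso q hs) (H.piIso q ht)) m)
        (TensorProduct.map (M.π q hs) (N.π q ht) z) :=
  IsUnitalModule.ext_map_congr _ _ (AlgIso.tensor (H.piIso q hs) (H.piIso q ht)) _
    (tensorAct_intertwine _ _ _ _ (M.π_act q hs) (N.π_act q ht)) m z

theorem map_π_twist (q : G) {s t u s' t' u' : G} (hu : s * t * s⁻¹ = u) (hs : q * s * q⁻¹ = s')
    (ht : q * t * q⁻¹ = t') (hu' : s' * t' * s'⁻¹ = u') (hq : q * u * q⁻¹ = u')
    (z : M.carrier s ⊗[k] N.carrier t) :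
    TensorProduct.map (N.π q hq) (M.π q hs) (twist M N hu z) =
      twist M N hu' (TensorProduct.map (M.π q hs) (N.π q ht) z) := by
  induction z using TensorProduct.induction_on with
  | zero => simp
  | add u v hu hv => simp only [map_add, hu, hv]
  | tmul m n =>
    simp only [twist_tmul, TensorProduct.map_tmul]
    congr 1
    rw [N.π_comp q s hu hq (by rw [← hq, ← hu]; group)]
    rw [N.π_comp s' q ht hu' (by rw [← hu', ← ht]; group)]
    congr 2
    rw [← hs]; group

theorem π_braid_tmk (q : G) {s t p s' t' u' p' : G} (h : s * t = p) (hp : q * p * q⁻¹ = p')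
    (hs : q * s * q⁻¹ = s') (ht : q * t * q⁻¹ = t') (hu' : s' * t' * s'⁻¹ = u')
    (h' : u' * s' = p') (z : M.carrier s ⊗[k] N.carrier t) :
    tensorπ N M q hp (braid R M N p (M.tmk N.toAGModule h z)) =
      N.tmk M.toAGModule h' (twist M N hu' ((M.unital₂ N.toAGModule s' t').ext
        (Mult.congr (AlgIso.tensor (H.piIso q hs) (H.piIso q ht)) (R s t))
        (TensorProduct.map (M.π q hs) (N.π q ht) z))) := by
  have hq : q * (s * t * s⁻¹) * q⁻¹ = u' := by rw [← hu', ← hs, ← ht]; group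
  rw [braid_tmk R M N h rfl (conj_mul_self h),
    tensorπ_tmk' N M q hp _ hq hs h', map_π_twist M N q rfl hs ht hu', map_π_ext]

theorem braid_π_tmk (q : G) {s t p s' t' u' p' : G} (h : s * t = p) (hp : q * p * q⁻¹ = p')
    (hs : q * s * q⁻¹ = s') (ht : q * t * q⁻¹ = t') (hu' : s' * t' * s'⁻¹ = u')
    (h' : u' * s' = p') (z : M.carrier s ⊗[k] N.carrier t) :
    braid R M N p' (tensorπ M N q hp (M.tmk N.toAGModule h z)) =
      N.tmk M.toAGModule h' (twist M N hu' ((M.unital₂ N.toAGModule s' t').ext (R s' t')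
        (TensorProduct.map (M.π q hs) (N.π q ht) z))) := by
  rw [tensorπ_tmk' M N q hp h hs ht (by rw [← hp, ← hs, ← ht, ← h]; group),
    braid_tmk R M N _ hu' h']

end Components

/-! ### The first hexagon -/

theorem braid_natural {M N M' N' : CrossedModule H} (f : M ⟶ M') (g : N ⟶ N') (p : G) :
    braid R M' N' p ∘ₗ Hom.app (tensorHom f g) p = Hom.app (tensorHom g f) p ∘ₗ braid R M N p := by
  refine tensor_ext fun s t h m n => ?_
  have a1 := tensorHom_tmk f g h m n
  have a2 := braid_tmk R M' N' h rfl (conj_mul_self h) (Hom.app f s m ⊗ₜ Hom.app g t n)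
  have a3 := braid_tmk R M N h rfl (conj_mul_self h) (m ⊗ₜ n)
  refine (congrArg (braid R M' N' p) a1).trans (a2.trans ?_)
  refine Eq.trans ?_ (congrArg (Hom.app (tensorHom g f) p) a3).symm
  refine Eq.trans ?_ (tensorApp_tmk _ _ _ _).symm
  congr 1
  have e : (M'.unital₂ N'.toAGModule s t).ext (R s t) (Hom.app f s m ⊗ₜ Hom.app g t n) =
      TensorProduct.map (Hom.app f s) (Hom.app g t)
        ((M.unital₂ N.toAGModule s t).ext (R s t) (m ⊗ₜ n)) := by
    refine (IsUnitalModule.ext_map _ _ (TensorProduct.map (Hom.app f s) (Hom.app g t))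
      (fun b z => ?_) (R s t) (m ⊗ₜ n)).symm
    refine (tensorAct_intertwine .id .id _ _ (Hom.app_act f s) (Hom.app_act g t) b z).trans ?_
    rw [TensorProduct.map_id]
    rfl
  rw [e]
  generalize (M.unital₂ N.toAGModule s t).ext (R s t) (m ⊗ₜ n) = w
  induction w using TensorProduct.induction_on with
  | zero => simp
  | add u v hu hv => simp only [map_add, hu, hv]
  | tmul x y => simp [Hom.app_π]

section Hexagon

variable (X Y Z : CrossedModule H)

/-- `X_r ⊗ Y_s ⊗ Z_t` is a unital `A_r ⊗ A_s ⊗ A_t`-module. -/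
theorem unital₃ (r s t : G) :
    IsUnitalModule (k := k) (B := H.C r ⊗[k] (H.C s ⊗[k] H.C t))
      (tensorAct (X.act r) (tensorAct (Y.act s) (Z.act t))) :=
  (X.unital r).tensor (Y.unital₂ Z.toAGModule s t)

theorem ext_leg₁₂ {r s t : G} (m : Mult k (H.C r ⊗[k] H.C s))
    (w : X.carrier r ⊗[k] Y.carrier s) (z : Z.carrier t) :
    (unital₃ X Y Z r s t).ext (leg₁₂ H r s t m) (TensorProduct.assoc k _ _ _ (w ⊗ₜ z)) =
      TensorProduct.assoc k _ _ _ ((X.unital₂ Y.toAGModule r s).ext m w ⊗ₜ z) := by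
  refine (IsUnitalModule.ext_congr_assoc (X.unital r) (Y.unital s) (Z.unital t)
    (Mult.tmul m 1) (w ⊗ₜ z)).trans ?_
  rw [((X.unital r).tensor (Y.unital s)).ext_tmul (Z.unital t), TensorProduct.map_tmul,
    (Z.unital t).ext_one]

theorem ext_leg₂₃ {r s t : G} (m : Mult k (H.C s ⊗[k] H.C t))
    (x : X.carrier r) (w : Y.carrier s ⊗[k] Z.carrier t) :
    (unital₃ X Y Z r s t).ext (leg₂₃ H r s t m) (x ⊗ₜ w) =
      x ⊗ₜ (Y.unital₂ Z.toAGModule s t).ext m w := by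
  refine ((X.unital r).ext_tmul (Y.unital₂ Z.toAGModule s t) 1 m (x ⊗ₜ w)).trans ?_
  rw [TensorProduct.map_tmul, (X.unital r).ext_one]

theorem ext_leg₁₃ {r s t : G} (m : Mult k (H.C r ⊗[k] H.C t))
    (y : Y.carrier s) (w : X.carrier r ⊗[k] Z.carrier t) :
    (unital₃ X Y Z r s t).ext (leg₁₃ H r s t m) (TensorProduct.leftComm k _ _ _ (y ⊗ₜ w)) =
      TensorProduct.leftComm k _ _ _ (y ⊗ₜ (X.unital₂ Z.toAGModule r t).ext m w) := by
  refine (IsUnitalModule.ext_congr_leftComm (Y.unital s) (X.unital r) (Z.unital t)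
    (Mult.tmul 1 m) (y ⊗ₜ w)).trans ?_
  rw [(Y.unital s).ext_tmul ((X.unital r).tensor (Z.unital t)), TensorProduct.map_tmul,
    (Y.unital s).ext_one]

/-- The action of `R_{r,u}` on `X_r ⊗ (Y_s ⊗ Z_t)`, for `u = s t`, is given by
`(ι ⊗ Δ_{s,t})(R_{r,u})`. -/
theorem ext_tensor_pairAct {r s t : G} (m : Mult k (H.C r ⊗[k] H.C (s * t)))
    (w : X.carrier r ⊗[k] (Y.carrier s ⊗[k] Z.carrier t)) :
    ((X.unital r).tensor (Y.pairAct_unital Z.toAGModule (rfl : s * t = s * t))).ext m w =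
      (unital₃ X Y Z r s t).ext (idTensorComul H r s t m) w :=
  (X.unital r).ext_id_tensor_pull (H.span_mul r) (H.comulHom rfl) (nondeg₃ H r s t)
    (Y.unital₂ Z.toAGModule s t) m w

/-- The action of `R_{sr,t}` on `(X_r ⊗ Y_s) ⊗ Z_t`, where `A_{sr}` acts on `X_r ⊗ Y_s` through
`Δ̃_{r,s}`, is given by `(Δ̃_{r,s} ⊗ ι)(R_{sr,t})`. -/
theorem ext_comulTilde_tensor {r s t : G} (m : Mult k (H.C (s * r) ⊗[k] H.C t))
    (w : (X.carrier r ⊗[k] Y.carrier s) ⊗[k] Z.carrier t) :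
    TensorProduct.assoc k _ _ _ ((((X.unital₂ Y.toAGModule r s).pull (comulTilde H r s)).tensor
      (Z.unital t)).ext m w) =
      (unital₃ X Y Z r s t).ext (comulTildeTensorId H r s t m) (TensorProduct.assoc k _ _ _ w) := by
  rw [(Z.unital t).ext_pull_tensor_id (H.span_mul t) (comulTilde H r s)
    ((H.nondeg₂ r s).tensor (H.nondeg t)) (X.unital₂ Y.toAGModule r s) m w]
  exact (IsUnitalModule.ext_congr_assoc (X.unital r) (Y.unital s) (Z.unital t) _ w).symm

theorem rotate_aux {r s t p : G} (h : r * (s * t) = p) :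
    r * s * r⁻¹ * (r * t * r⁻¹ * r) = p := by rw [← h]; group

/-- The map `x ⊗ (y ⊗ z) ↦ π_r y ⊗ (π_r z ⊗ x)` from `X_r ⊗ (Y_s ⊗ Z_t)` to
`(Y ⊗ (Z ⊗ X))_{rst}`. -/
def rotate {r s t p : G} (h : r * (s * t) = p) :
    X.carrier r ⊗[k] (Y.carrier s ⊗[k] Z.carrier t) →ₗ[k]
      (tensorObj Y (tensorObj Z X)).carrier p :=
  Y.tmk (tensorObj Z X).toAGModule (rotate_aux h) ∘ₗ
    TensorProduct.map (Y.π r rfl) (Z.tmk X.toAGModule rfl ∘ₗ twist X Z rfl) ∘ₗ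
      (TensorProduct.leftComm k _ _ _).toLinearMap

theorem rotate_injective {r s t p : G} (h : r * (s * t) = p) :
    Function.Injective (rotate X Y Z h) := by
  have h₁ : Function.Injective (TensorProduct.map (Y.π r (rfl : r * s * r⁻¹ = _))
      (Z.tmk X.toAGModule rfl ∘ₗ twist X Z (rfl : r * t * r⁻¹ = _))) :=
    TensorProduct.map_injective_of_flat_flat _ _ (Y.π_bijective r rfl).1
      ((tmk_injective _ _ _).comp (twist_bijective X Z rfl).1)
  exact (tmk_injective Y.toAGModule (tensorObj Z X).toAGModule (rotate_aux h)).comp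
    (h₁.comp (TensorProduct.leftComm k _ _ _).injective)

/-- The left-hand side of the first hexagon axiom is `rotate` after the action of
`(ι ⊗ Δ_{s,t})(R_{r,st})`. -/
theorem hexagon_forward_left {r s t u p : G} (hu : r * s = u) (h : u * t = p)
    (h' : r * (s * t) = p) (x : X.carrier r) (y : Y.carrier s) (z : Z.carrier t) :
    assocApp Y.toAGModule Z.toAGModule X.toAGModule p (braid R X (tensorObj Y Z) p
      (assocApp X.toAGModule Y.toAGModule Z.toAGModule p
        ((tensorObj X Y).tmk Z.toAGModule h (X.tmk Y.toAGModule hu (x ⊗ₜ y) ⊗ₜ z)))) =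
      rotate X Y Z h' ((unital₃ X Y Z r s t).ext (idTensorComul H r s t (R r (s * t)))
        (x ⊗ₜ (y ⊗ₜ z))) := by
  have a1 := assocApp_tmk hu h rfl h' x y z
  have a2 := braid_tmk R X (tensorObj Y Z) h' rfl (conj_mul_self h')
    (x ⊗ₜ Y.tmk Z.toAGModule rfl (y ⊗ₜ z))
  refine (congrArg (fun v => assocApp Y.toAGModule Z.toAGModule X.toAGModule p
    (braid R X (tensorObj Y Z) p v)) a1).trans
      ((congrArg (assocApp Y.toAGModule Z.toAGModule X.toAGModule p) a2).trans ?_)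
  rw [← ext_tensor_pairAct]
  have a3 := IsUnitalModule.ext_map
    ((X.unital r).tensor (Y.pairAct_unital Z.toAGModule (rfl : s * t = s * t)))
    (X.unital₂ (tensorObj Y Z).toAGModule r (s * t))
    ((Y.tmk Z.toAGModule rfl).lTensor (X.carrier r)) (fun b w => by
      refine (tensorAct_intertwine (.id : H.C r →ₗ[k] H.C r) (.id : H.C (s * t) →ₗ[k] H.C (s * t))
        .id (Y.tmk Z.toAGModule rfl) (fun _ _ => rfl)
        (fun c v => (act_tmk _ _ _ c v).symm) b w).trans ?_
      rw [TensorProduct.map_id]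
      rfl) (R r (s * t)) (x ⊗ₜ (y ⊗ₜ z))
  refine (congrArg (fun v => assocApp Y.toAGModule Z.toAGModule X.toAGModule p
    ((tensorObj Y Z).tmk X.toAGModule (conj_mul_self h') (twist X (tensorObj Y Z) rfl v)))
      a3.symm).trans ?_
  generalize ((X.unital r).tensor (Y.pairAct_unital Z.toAGModule (rfl : s * t = s * t))).ext
    (R r (s * t)) (x ⊗ₜ[k] (y ⊗ₜ[k] z)) = w
  refine LinearMap.congr_fun (f := assocApp Y.toAGModule Z.toAGModule X.toAGModule p ∘ₗ
    (tensorObj Y Z).tmk X.toAGModule (conj_mul_self h') ∘ₗ twist X (tensorObj Y Z) rfl ∘ₗ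
    (Y.tmk Z.toAGModule rfl).lTensor (X.carrier r)) (g := rotate X Y Z h') ?_ w
  refine TensorProduct.ext_threefold' fun x y z => ?_
  have e1 := tensorπ_tmk Y Z r (rfl : r * (s * t) * r⁻¹ = _) (rfl : s * t = _) rfl rfl
    (conj_mul rfl rfl) y z
  refine (congrArg (fun v => assocApp Y.toAGModule Z.toAGModule X.toAGModule p
    ((tensorObj Y Z).tmk X.toAGModule (conj_mul_self h') (v ⊗ₜ x))) e1).trans ?_
  exact assocApp_tmk _ _ rfl _ _ _ _

/-- The right-hand side of the first hexagon axiom is `rotate` after the action of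
`(R_{r,t})₁₃ (R_{r,s})₁₂`.  The morphisms `f` and `g` stand for the braidings, which are only known
to have the components `c`. -/
theorem hexagon_forward_right {r s t u p : G} (hu : r * s = u) (h : u * t = p)
    (h' : r * (s * t) = p) (x : X.carrier r) (y : Y.carrier s) (z : Z.carrier t)
    (f : tensorObj X Y ⟶ tensorObj Y X) (g : tensorObj X Z ⟶ tensorObj Z X)
    (hf : ∀ p, Hom.app f p = braid R X Y p) (hg : ∀ p, Hom.app g p = braid R X Z p) :
    Hom.app (tensorHom (𝟙 Y) g) p (assocApp Y.toAGModule X.toAGModule Z.toAGModule p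
      (Hom.app (tensorHom f (𝟙 Z)) p
        ((tensorObj X Y).tmk Z.toAGModule h (X.tmk Y.toAGModule hu (x ⊗ₜ y) ⊗ₜ z)))) =
      rotate X Y Z h' ((unital₃ X Y Z r s t).ext
        (leg₁₃ H r s t (R r t) * leg₁₂ H r s t (R r s)) (x ⊗ₜ (y ⊗ₜ z))) := by
  have a1 := tensorHom_tmk f (𝟙 Z) h (X.tmk Y.toAGModule hu (x ⊗ₜ y)) z
  rw [hf] at a1
  have a2 := braid_tmk R X Y hu rfl (conj_mul_self hu) (x ⊗ₜ y)
  refine (congrArg (fun v => Hom.app (tensorHom (𝟙 Y) g) p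
    (assocApp Y.toAGModule X.toAGModule Z.toAGModule p v)) (a1.trans
      (congrArg (fun v => (tensorObj Y X).tmk Z.toAGModule h (v ⊗ₜ z)) a2))).trans ?_
  rw [IsUnitalModule.ext_mul]
  refine Eq.trans ?_ (congrArg (fun v => rotate X Y Z h' ((unital₃ X Y Z r s t).ext
    (leg₁₃ H r s t (R r t)) v)) (ext_leg₁₂ X Y Z (R r s) (x ⊗ₜ y) z).symm)
  generalize (X.unital₂ Y.toAGModule r s).ext (R r s) (x ⊗ₜ y) = w
  have h3 : r * s * r⁻¹ * (r * t) = p := by rw [← h']; group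
  refine LinearMap.congr_fun (f := Hom.app (tensorHom (𝟙 Y) g) p ∘ₗ
      assocApp Y.toAGModule X.toAGModule Z.toAGModule p ∘ₗ
      (tensorObj Y X).tmk Z.toAGModule h ∘ₗ (TensorProduct.mk k _ _).flip z ∘ₗ
      Y.tmk X.toAGModule (conj_mul_self hu) ∘ₗ twist X Y rfl)
    (g := rotate X Y Z h' ∘ₗ (unital₃ X Y Z r s t).ext (leg₁₃ H r s t (R r t)) ∘ₗ
      (TensorProduct.assoc k _ _ _).toLinearMap ∘ₗ (TensorProduct.mk k _ _).flip z) ?_ w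
  refine TensorProduct.ext' fun x y => ?_
  have b1 := assocApp_tmk (conj_mul_self hu) h rfl h3 (Y.π r rfl y) x z
  have b2 := tensorHom_tmk (𝟙 Y) g h3 (Y.π r rfl y) (X.tmk Z.toAGModule rfl (x ⊗ₜ z))
  rw [hg] at b2
  have b3 := braid_tmk R X Z (rfl : r * t = r * t) rfl (conj_mul_self rfl) (x ⊗ₜ z)
  have b4 := ext_leg₁₃ X Y Z (R r t) y (x ⊗ₜ z)
  refine (congrArg (Hom.app (tensorHom (𝟙 Y) g) p) b1).trans (b2.trans ?_)
  refine (congrArg (fun v => Y.tmk (tensorObj Z X).toAGModule h3 (Y.π r rfl y ⊗ₜ v)) b3).trans ?_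
  refine Eq.trans ?_ (congrArg (rotate X Y Z h') b4).symm
  generalize (X.unital₂ Z.toAGModule r t).ext (R r t) (x ⊗ₜ z) = w
  refine LinearMap.congr_fun (f := Y.tmk (tensorObj Z X).toAGModule h3 ∘ₗ
      TensorProduct.mk k _ _ (Y.π r rfl y) ∘ₗ Z.tmk X.toAGModule (conj_mul_self rfl) ∘ₗ
      twist X Z rfl)
    (g := rotate X Y Z h' ∘ₗ (TensorProduct.leftComm k _ _ _).toLinearMap ∘ₗ
      TensorProduct.mk k _ _ y) ?_ w
  refine TensorProduct.ext' fun x z => ?_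
  have : ∀ {q : G} (hq : r * t * r⁻¹ * r = q) (h4 : r * s * r⁻¹ * q = p),
      Y.tmk (tensorObj Z X).toAGModule h4
        (Y.π r rfl y ⊗ₜ[k] Z.tmk X.toAGModule hq (Z.π r rfl z ⊗ₜ x)) =
      Y.tmk (tensorObj Z X).toAGModule (rotate_aux h')
        (Y.π r rfl y ⊗ₜ[k] Z.tmk X.toAGModule rfl (Z.π r rfl z ⊗ₜ x)) := by
    intro q hq h4
    subst hq
    rfl
  exact this _ _

end Hexagon

/-! ### The second hexagon -/

section Hexagon

variable (X Y Z : CrossedModule H)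

theorem conj_mul_right (s r : G) : s * r * s⁻¹ * s = s * r := inv_mul_cancel_right _ _

theorem rotateInv_aux {r s t p : G} (h : s * r * t = p) :
    s * r * t * (s * r)⁻¹ * (s * r * s⁻¹) * s = p := by rw [← h]; group

/-- The map `x ⊗ (y ⊗ z) ↦ (π_{sr} z ⊗ π_s x) ⊗ y` from `X_r ⊗ (Y_s ⊗ Z_t)` to
`((Z ⊗ X) ⊗ Y)_{srt}`. -/
def rotateInv {r s t p : G} (h : s * r * t = p) :
    X.carrier r ⊗[k] (Y.carrier s ⊗[k] Z.carrier t) →ₗ[k]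
      (tensorObj (tensorObj Z X) Y).carrier p :=
  (tensorObj Z X).tmk Y.toAGModule (rotateInv_aux h) ∘ₗ
    TensorProduct.map (Z.tmk X.toAGModule rfl ∘ₗ TensorProduct.map (Z.π (s * r) rfl) (X.π s rfl) ∘ₗ
      (TensorProduct.comm k (X.carrier r) (Z.carrier t)).toLinearMap) LinearMap.id ∘ₗ
      (TensorProduct.assoc k (X.carrier r) (Z.carrier t) (Y.carrier s)).symm.toLinearMap ∘ₗ
        TensorProduct.map LinearMap.id
          (TensorProduct.comm k (Y.carrier s) (Z.carrier t)).toLinearMap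

theorem rotateInv_injective {r s t p : G} (h : s * r * t = p) :
    Function.Injective (rotateInv X Y Z h) := by
  have h₁ : Function.Injective (TensorProduct.map (Z.π (s * r) (rfl : s * r * t * (s * r)⁻¹ = _))
      (X.π s (rfl : s * r * s⁻¹ = _))) :=
    TensorProduct.map_injective_of_flat_flat _ _ (Z.π_bijective _ rfl).1 (X.π_bijective _ rfl).1
  have h₂ : Function.Injective (TensorProduct.map (Z.tmk X.toAGModule rfl ∘ₗ
      TensorProduct.map (Z.π (s * r) (rfl : s * r * t * (s * r)⁻¹ = _))
        (X.π s (rfl : s * r * s⁻¹ = _)) ∘ₗ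
      (TensorProduct.comm k (X.carrier r) (Z.carrier t)).toLinearMap)
      (LinearMap.id : Y.carrier s →ₗ[k] Y.carrier s)) :=
    TensorProduct.map_injective_of_flat_flat _ _ ((tmk_injective _ _ _).comp
      (h₁.comp (TensorProduct.comm k (X.carrier r) (Z.carrier t)).injective))
      Function.injective_id
  have h₃ : Function.Injective (TensorProduct.map (LinearMap.id : X.carrier r →ₗ[k] X.carrier r)
      (TensorProduct.comm k (Y.carrier s) (Z.carrier t)).toLinearMap) :=
    TensorProduct.map_injective_of_flat_flat _ _ Function.injective_id
      (TensorProduct.comm k (Y.carrier s) (Z.carrier t)).injective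
  exact (tmk_injective (tensorObj Z X).toAGModule Y.toAGModule (rotateInv_aux h)).comp
    (h₂.comp ((TensorProduct.assoc k (X.carrier r) (Z.carrier t) (Y.carrier s)).symm.injective.comp
      h₃))

/-- The left-hand side of the second hexagon axiom is `rotateInv` after the action of
`(Δ̃_{r,s} ⊗ ι)(R_{sr,t})`.  The first argument is `π_s x` with `x ∈ X_r`, so that `A_{sr}` acts on
`X_r ⊗ Y_s` through `Δ̃_{r,s}`. -/
theorem hexagon_reverse_left {r s t v p : G} (hv : s * t = v) (h : s * r * s⁻¹ * v = p)
    (h' : s * r * t = p) (x : X.carrier r) (y : Y.carrier s) (z : Z.carrier t) :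
    assocInvApp Z.toAGModule X.toAGModule Y.toAGModule p (braid R (tensorObj X Y) Z p
      (assocInvApp X.toAGModule Y.toAGModule Z.toAGModule p
        (X.tmk (tensorObj Y Z).toAGModule h (X.π s rfl x ⊗ₜ Y.tmk Z.toAGModule hv (y ⊗ₜ z))))) =
      rotateInv X Y Z h' ((unital₃ X Y Z r s t).ext (comulTildeTensorId H r s t (R (s * r) t))
        (x ⊗ₜ (y ⊗ₜ z))) := by
  have a1 := assocInvApp_tmk (conj_mul_right s r) h' hv h (X.π s rfl x) y z
  have a2 := braid_tmk R (tensorObj X Y) Z h' rfl (conj_mul_self h')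
    (X.tmk Y.toAGModule (conj_mul_right s r) (X.π s rfl x ⊗ₜ y) ⊗ₜ z)
  refine (congrArg (fun v => assocInvApp Z.toAGModule X.toAGModule Y.toAGModule p
    (braid R (tensorObj X Y) Z p v)) a1).trans
      ((congrArg (assocInvApp Z.toAGModule X.toAGModule Y.toAGModule p) a2).trans ?_)
  let j : X.carrier r ⊗[k] Y.carrier s →ₗ[k] (tensorObj X Y).carrier (s * r) :=
    X.tmk Y.toAGModule (conj_mul_right s r) ∘ₗ TensorProduct.map (X.π s rfl) LinearMap.id
  have hj : ∀ (b : H.C (s * r)) w, j (pullAct (comulTilde H r s) (X.unital₂ Y.toAGModule r s) b w) =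
      (tensorObj X Y).act (s * r) b (j w) := fun b w =>
    ((act_tmk _ _ _ b _).trans (congrArg (X.tmk Y.toAGModule (conj_mul_right s r))
      (pairAct_map_π Y X rfl _ b w))).symm
  have a3 := IsUnitalModule.ext_map
    (((X.unital₂ Y.toAGModule r s).pull (comulTilde H r s)).tensor (Z.unital t))
    ((tensorObj X Y).unital₂ Z.toAGModule (s * r) t)
    (j.rTensor (Z.carrier t)) (fun b w => by
      refine (tensorAct_intertwine (.id : H.C (s * r) →ₗ[k] H.C (s * r))
        (.id : H.C t →ₗ[k] H.C t) j .id hj (fun _ _ => rfl) b w).trans ?_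
      rw [TensorProduct.map_id]
      rfl) (R (s * r) t) ((x ⊗ₜ y) ⊗ₜ z)
  have a4 := ext_comulTilde_tensor X Y Z (R (s * r) t) ((x ⊗ₜ y) ⊗ₜ z)
  refine (congrArg (fun v => assocInvApp Z.toAGModule X.toAGModule Y.toAGModule p
    (Z.tmk (tensorObj X Y).toAGModule (conj_mul_self h') (twist (tensorObj X Y) Z rfl v)))
      a3.symm).trans ?_
  refine Eq.trans ?_ (congrArg (rotateInv X Y Z h') a4)
  generalize (((X.unital₂ Y.toAGModule r s).pull (comulTilde H r s)).tensor (Z.unital t)).ext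
    (R (s * r) t) ((x ⊗ₜ[k] y) ⊗ₜ[k] z) = w
  refine LinearMap.congr_fun (f := assocInvApp Z.toAGModule X.toAGModule Y.toAGModule p ∘ₗ
    Z.tmk (tensorObj X Y).toAGModule (conj_mul_self h') ∘ₗ twist (tensorObj X Y) Z rfl ∘ₗ
    j.rTensor (Z.carrier t)) (g := rotateInv X Y Z h' ∘ₗ
      (TensorProduct.assoc k _ _ _).toLinearMap) ?_ w
  refine TensorProduct.ext_threefold fun x y z => ?_
  exact assocInvApp_tmk rfl (rotateInv_aux h') (conj_mul_right s r) (conj_mul_self h')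
    (Z.π (s * r) rfl z) (X.π s rfl x) y

/-- The right-hand side of the second hexagon axiom is `rotateInv` after the action of
`(R_{r,t})₁₃ (R_{s,t})₂₃`.  The invariance of `R` moves `R_{srs⁻¹,sts⁻¹}`, acting on
`π_s x ⊗ π_s z`, back to `R_{r,t}`. -/
theorem hexagon_reverse_right {r s t v p : G} (hv : s * t = v) (h : s * r * s⁻¹ * v = p)
    (h' : s * r * t = p) (x : X.carrier r) (y : Y.carrier s) (z : Z.carrier t)
    (hR : Mult.congr (AlgIso.tensor (H.piIso s (s := r) rfl) (H.piIso s (s := t) rfl)) (R r t) =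
      R (s * r * s⁻¹) (s * t * s⁻¹))
    (f : tensorObj Y Z ⟶ tensorObj Z Y) (g : tensorObj X Z ⟶ tensorObj Z X)
    (hf : ∀ p, Hom.app f p = braid R Y Z p) (hg : ∀ p, Hom.app g p = braid R X Z p) :
    Hom.app (tensorHom g (𝟙 Y)) p (assocInvApp X.toAGModule Z.toAGModule Y.toAGModule p
      (Hom.app (tensorHom (𝟙 X) f) p
        (X.tmk (tensorObj Y Z).toAGModule h (X.π s rfl x ⊗ₜ Y.tmk Z.toAGModule hv (y ⊗ₜ z))))) =
      rotateInv X Y Z h' ((unital₃ X Y Z r s t).ext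
        (leg₁₃ H r s t (R r t) * leg₂₃ H r s t (R s t)) (x ⊗ₜ (y ⊗ₜ z))) := by
  have a1 := tensorHom_tmk (𝟙 X) f h (X.π s rfl x) (Y.tmk Z.toAGModule hv (y ⊗ₜ z))
  rw [hf] at a1
  have a2 := braid_tmk R Y Z hv rfl (conj_mul_self hv) (y ⊗ₜ z)
  refine (congrArg (fun v => Hom.app (tensorHom g (𝟙 Y)) p
    (assocInvApp X.toAGModule Z.toAGModule Y.toAGModule p v)) (a1.trans
      (congrArg (fun v => X.tmk (tensorObj Z Y).toAGModule h (X.π s rfl x ⊗ₜ v)) a2))).trans ?_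
  rw [IsUnitalModule.ext_mul]
  refine Eq.trans ?_ (congrArg (fun v => rotateInv X Y Z h' ((unital₃ X Y Z r s t).ext
    (leg₁₃ H r s t (R r t)) v)) (ext_leg₂₃ X Y Z (R s t) x (y ⊗ₜ z)).symm)
  generalize (Y.unital₂ Z.toAGModule s t).ext (R s t) (y ⊗ₜ z) = w
  have h3 : s * r * s⁻¹ * (s * t * s⁻¹) * s = p := by rw [← h']; group
  refine LinearMap.congr_fun (f := Hom.app (tensorHom g (𝟙 Y)) p ∘ₗ
      assocInvApp X.toAGModule Z.toAGModule Y.toAGModule p ∘ₗ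
      X.tmk (tensorObj Z Y).toAGModule h ∘ₗ TensorProduct.mk k _ _ (X.π s rfl x) ∘ₗ
      Z.tmk Y.toAGModule (conj_mul_self hv) ∘ₗ twist Y Z rfl)
    (g := rotateInv X Y Z h' ∘ₗ (unital₃ X Y Z r s t).ext (leg₁₃ H r s t (R r t)) ∘ₗ
      TensorProduct.mk k _ _ x) ?_ w
  refine TensorProduct.ext' fun y z => ?_
  have b1 := assocInvApp_tmk rfl h3 (conj_mul_self hv) h (X.π s rfl x) (Z.π s rfl z) y
  have b2 := tensorHom_tmk g (𝟙 Y) h3 (X.tmk Z.toAGModule rfl (X.π s rfl x ⊗ₜ Z.π s rfl z)) y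
  rw [hg] at b2
  have h4 : s * r * s⁻¹ * (s * t * s⁻¹) * (s * r * s⁻¹)⁻¹ = s * r * t * (s * r)⁻¹ := by group
  have h5 : s * r * t * (s * r)⁻¹ * (s * r * s⁻¹) = s * r * s⁻¹ * (s * t * s⁻¹) := by group
  have b3 := braid_tmk R X Z (rfl : s * r * s⁻¹ * (s * t * s⁻¹) = _) h4 h5
    (TensorProduct.map (X.π s rfl) (Z.π s rfl) (x ⊗ₜ z))
  rw [← hR, ← map_π_ext X Z s rfl rfl] at b3
  have b4 := ext_leg₁₃ X Y Z (R r t) y (x ⊗ₜ z)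
  refine (congrArg (Hom.app (tensorHom g (𝟙 Y)) p) b1).trans (b2.trans ?_)
  refine (congrArg (fun v => (tensorObj Z X).tmk Y.toAGModule h3 (v ⊗ₜ y)) b3).trans ?_
  refine Eq.trans ?_ (congrArg (rotateInv X Y Z h') b4).symm
  generalize (X.unital₂ Z.toAGModule r t).ext (R r t) (x ⊗ₜ z) = w
  refine LinearMap.congr_fun (f := (tensorObj Z X).tmk Y.toAGModule h3 ∘ₗ
      (TensorProduct.mk k _ _).flip y ∘ₗ Z.tmk X.toAGModule h5 ∘ₗ
      twist X Z h4 ∘ₗ TensorProduct.map (X.π s rfl) (Z.π s rfl))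
    (g := rotateInv X Y Z h' ∘ₗ (TensorProduct.leftComm k _ _ _).toLinearMap ∘ₗ
      TensorProduct.mk k _ _ y) ?_ w
  refine TensorProduct.ext' fun x z => ?_
  have e : ∀ (q : G) (hq : q = s * r) (hz : q * t * q⁻¹ = s * r * t * (s * r)⁻¹),
      Z.π q hz z = Z.π (s * r) rfl z := by
    rintro q rfl hz; rfl
  have e' : Z.π (s * r * s⁻¹) h4 (Z.π s rfl z) = Z.π (s * r) rfl z :=
    (Z.π_comp _ _ _ _ (by group) z).trans (e _ (by group) _)
  have : ∀ {q : G} (hq : s * r * t * (s * r)⁻¹ * (s * r * s⁻¹) = q) (h6 : q * s = p),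
      (tensorObj Z X).tmk Y.toAGModule h6
        (Z.tmk X.toAGModule hq (Z.π (s * r * s⁻¹) h4 (Z.π s rfl z) ⊗ₜ[k] X.π s rfl x) ⊗ₜ y) =
      (tensorObj Z X).tmk Y.toAGModule (rotateInv_aux h')
        (Z.tmk X.toAGModule rfl (Z.π (s * r) rfl z ⊗ₜ X.π s rfl x) ⊗ₜ y) := by
    intro q hq h6
    subst hq
    rw [e']
  exact this _ _

end Hexagon

end CrossedModule

namespace CrossedModule

open AGModule

variable {H : MultiplierHopfTCoalgebra k G A} {R : ∀ p q : G, Mult k (H.C p ⊗[k] H.C q)}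

/-! ### The braiding of a quasitriangular structure -/

section Inverse

variable (hR : ∀ s t, IsUnit (R s t)) (M N : CrossedModule H)

/-- The inverse of `c_{M,N}`, which on `N_u ⊗ M_s` is the inverse of `twist` followed by the action
of the inverse of `R_{s,t}`, for `t = s⁻¹ u s`. -/
def braidInv (p : G) : (tensorObj N M).carrier p →ₗ[k] (tensorObj M N).carrier p :=
  tdesc (M := N.toAGModule) (N := M.toAGModule) fun u s h =>
    M.tmk N.toAGModule (show s * (s⁻¹ * u * s) = p by rw [← h]; group) ∘ₗ
      (M.unital₂ N.toAGModule s (s⁻¹ * u * s)).ext ↑(hR s (s⁻¹ * u * s)).unit⁻¹ ∘ₗ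
      (LinearEquiv.ofBijective _ (twist_bijective M N
        (show s * (s⁻¹ * u * s) * s⁻¹ = u by group))).symm.toLinearMap

theorem braidInv_tmk {s t u p : G} (h : s * t = p) (hu : s * t * s⁻¹ = u) (h' : u * s = p)
    (z : M.carrier s ⊗[k] N.carrier t) :
    braidInv hR M N p (N.tmk M.toAGModule h' (twist M N hu z)) =
      M.tmk N.toAGModule h ((M.unital₂ N.toAGModule s t).ext ↑(hR s t).unit⁻¹ z) := by
  obtain rfl : t = s⁻¹ * u * s := by rw [← hu]; group
  refine (tdesc_tmk _ _ _ _ _).trans ?_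
  exact congrArg (fun v => M.tmk N.toAGModule h
    ((M.unital₂ N.toAGModule s (s⁻¹ * u * s)).ext ↑(hR s (s⁻¹ * u * s)).unit⁻¹ v))
    (LinearEquiv.symm_apply_apply (LinearEquiv.ofBijective _ (twist_bijective M N hu)) z)

theorem braidInv_braid (p : G) (x : (tensorObj M N).carrier p) :
    braidInv hR M N p (braid R M N p x) = x := by
  refine LinearMap.congr_fun (f := braidInv hR M N p ∘ₗ braid R M N p) (g := .id)
    (tensor_ext fun s t h m n => ?_) x
  refine (congrArg (braidInv hR M N p) (braid_tmk R M N h rfl (conj_mul_self h) _)).trans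
    ((braidInv_tmk hR M N h rfl _ _).trans ?_)
  rw [← IsUnitalModule.ext_mul, IsUnit.val_inv_mul, IsUnitalModule.ext_one]
  rfl

theorem braid_braidInv (p : G) (x : (tensorObj N M).carrier p) :
    braid R M N p (braidInv hR M N p x) = x := by
  refine LinearMap.congr_fun (f := braid R M N p ∘ₗ braidInv hR M N p) (g := .id)
    (tensor_ext (M := N.toAGModule) (N := M.toAGModule) fun u s h n m => ?_) x
  have hu : s * (s⁻¹ * u * s) * s⁻¹ = u := by group
  have h' : s * (s⁻¹ * u * s) = p := by rw [← h]; group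
  obtain ⟨w, hw⟩ := (twist_bijective M N hu).2 (n ⊗ₜ m)
  rw [← hw]
  refine (congrArg (braid R M N p) (braidInv_tmk hR M N h' hu h w)).trans
    ((braid_tmk R M N h' hu h _).trans ?_)
  rw [← IsUnitalModule.ext_mul, IsUnit.mul_val_inv, IsUnitalModule.ext_one]
  rfl

end Inverse

/-- The maps `c_{M,N}` of a quasitriangular structure form a morphism of crossed modules. -/
def braidHom (hR : IsQuasitriangular H R) (M N : CrossedModule H) :
    tensorObj M N ⟶ tensorObj N M where
  app := braid R M N
  app_act p a x := by
    refine LinearMap.congr_fun (f := braid R M N p ∘ₗ (M.toAGModule.tensor N.toAGModule).act p a)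
      (g := (N.toAGModule.tensor M.toAGModule).act p a ∘ₗ braid R M N p)
      (tensor_ext fun s t h m n => ?_) x
    have h' := conj_mul_self h
    refine (braid_act_tmk R M N h rfl h' a (m ⊗ₜ n)).trans
      (Eq.trans ?_ (act_braid_tmk R M N h rfl h' a (m ⊗ₜ n)).symm)
    rw [← hR.mul_comul]
  app_π q p p' hp x := by
    refine LinearMap.congr_fun (f := braid R M N p' ∘ₗ tensorπ M N q hp)
      (g := tensorπ N M q hp ∘ₗ braid R M N p) (tensor_ext fun s t h m n => ?_) x
    have h' := conj_mul_self (conj_mul hp h)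
    refine (braid_π_tmk R M N q h hp rfl rfl rfl h' (m ⊗ₜ n)).trans
      (Eq.trans ?_ (π_braid_tmk R M N q h hp rfl rfl rfl h' (m ⊗ₜ n)).symm)
    rw [hR.invariant]

/-- The maps `c_{M,N}` of a quasitriangular structure form an isomorphism of crossed modules. -/
def braidIso (hR : IsQuasitriangular H R) (M N : CrossedModule H) :
    tensorObj M N ≅ tensorObj N M :=
  mkIso (braidHom hR M N) (braidInv hR.isUnit M N) (braidInv_braid hR.isUnit M N)
    (braid_braidInv hR.isUnit M N)

/-- The braiding of a quasitriangular structure. -/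
@[reducible]
def braidedCategory (hR : IsQuasitriangular H R) : BraidedCategory (CrossedModule H) where
  braiding := braidIso hR
  braiding_naturality_right X _ _ f := hom_ext fun p => braid_natural R (𝟙 X) f p
  braiding_naturality_left f Z := hom_ext fun p => braid_natural R f (𝟙 Z) p
  hexagon_forward X Y Z := hom_ext fun p => tensor_ext₃ fun r s u t hu h x y z => by
    have h' : r * (s * t) = p := by rw [← h, ← hu, mul_assoc]
    refine (hexagon_forward_left R X Y Z hu h h' x y z).trans (Eq.trans ?_
      (hexagon_forward_right R X Y Z hu h h' x y z (braidHom hR X Y) (braidHom hR X Z)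
        (fun _ => rfl) fun _ => rfl).symm)
    rw [hR.comul_right]
  hexagon_reverse X Y Z := hom_ext fun p => tensor_ext₃' fun q s t v hv h x y z => by
    obtain ⟨r, rfl⟩ : ∃ r, s * r * s⁻¹ = q := ⟨s⁻¹ * q * s, by group⟩
    have h' : s * r * t = p := by rw [← h, ← hv]; group
    obtain ⟨x, rfl⟩ := (X.π_bijective s (rfl : s * r * s⁻¹ = _)).2 x
    refine (hexagon_reverse_left R X Y Z hv h h' x y z).trans (Eq.trans ?_
      (hexagon_reverse_right R X Y Z hv h h' x y z (hR.invariant s r t) (braidHom hR Y Z)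
        (braidHom hR X Z) (fun _ => rfl) fun _ => rfl).symm)
    rw [hR.comul_left]

end CrossedModule

namespace CrossedModule

open AGModule MonoidalCategory

/-! ### Evaluation of the braiding axioms on the regular crossed module -/

/-- The crossed module formed by the algebras `A_p`, each acting on itself by left
multiplication. -/
def regular (H : MultiplierHopfTCoalgebra k G A) : CrossedModule H where
  carrier p := H.C p
  act p := LinearMap.mul k (H.C p)
  unital p := isUnitalModule_mul (H.nondeg p) (H.span_mul p)
  π q _ _ h := (H.piIso q h).toLinearEquiv.toLinearMap
  π_bijective q _ _ h := (H.piIso q h).toLinearEquiv.bijective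
  π_act q _ _ h a m := (H.piIso q h).map_mul a m
  π_comp p q _ _ _ _ _ _ m := Subtype.ext (by
    change H.π p (H.π q m) = H.π (p * q) m
    rw [map_mul]; rfl)

variable {H : MultiplierHopfTCoalgebra k G A} {R : ∀ p q : G, Mult k (H.C p ⊗[k] H.C q)}

/-- On the regular crossed module, a multiplier acts by left multiplication, so it is determined by
this action. -/
theorem regular_ext₂ {s t : G} (m : Mult k (H.C s ⊗[k] H.C t)) (z : H.C s ⊗[k] H.C t) :
    ((regular H).unital₂ (regular H).toAGModule s t).ext m z = m.l z :=
  IsUnitalModule.ext_eq_l (H.nondeg₂ s t) _ (tensorAct_mul (fun _ _ => rfl) fun _ _ => rfl) m z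

theorem regular_ext₃ {r s t : G} (m : Mult k (H.C r ⊗[k] (H.C s ⊗[k] H.C t)))
    (z : H.C r ⊗[k] (H.C s ⊗[k] H.C t)) :
    (unital₃ (regular H) (regular H) (regular H) r s t).ext m z = m.l z :=
  IsUnitalModule.ext_eq_l (nondeg₃ H r s t) _
    (tensorAct_mul (fun _ _ => rfl) (tensorAct_mul (fun _ _ => rfl) fun _ _ => rfl)) m z

section Necessity

/-- The maps `c_{M,N}` defined by `R` are the components of the braiding `B`. -/
abbrev IsBraiding (B : BraidedCategory (CrossedModule H))
    (R : ∀ p q : G, Mult k (H.C p ⊗[k] H.C q)) : Prop :=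
  ∀ (M N : CrossedModule H) (p : G), Hom.app (B.braiding M N).hom p = braid R M N p

variable {B : BraidedCategory (CrossedModule H)}

/-- `(π_q ⊗ π_q)(R_{s,t}) = R_{qsq⁻¹,qtq⁻¹}`, because `c` commutes with the crossing. -/
theorem invariant_of_braided (hB : IsBraiding B R) (q s t : G) :
    Mult.congr (AlgIso.tensor (H.piIso q (s := s) rfl) (H.piIso q (s := t) rfl)) (R s t) =
      R (q * s * q⁻¹) (q * t * q⁻¹) := by
  let M := regular H
  refine Mult.ext_l (H.nondeg₂ _ _) fun w => ?_
  obtain ⟨z, rfl⟩ := (TensorProduct.congr (H.piIso q (s := s) rfl).toLinearEquiv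
    (H.piIso q (s := t) rfl).toLinearEquiv).surjective w
  have e := Hom.app_π (B.braiding M M).hom q (rfl : q * (s * t) * q⁻¹ = _)
    (M.tmk M.toAGModule rfl z)
  rw [hB, hB] at e
  have h' := conj_mul_self (conj_mul (rfl : q * (s * t) * q⁻¹ = _) rfl)
  have e' := (π_braid_tmk R M M q rfl rfl rfl rfl rfl h' z).symm.trans
    (e.symm.trans (braid_π_tmk R M M q rfl rfl rfl rfl rfl h' z))
  have e'' := (twist_bijective M M rfl).1 (tmk_injective _ _ _ e')
  exact (regular_ext₂ _ _).symm.trans (e''.trans (regular_ext₂ _ _))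

/-- `R Δ(a) = τ(Δ̃(a)) R`, because `c` is linear over the algebra. -/
theorem mul_comul_of_braided (hB : IsBraiding B R) (s t : G) (a : H.C (s * t)) :
    R s t * H.comul s t a =
      Mult.congr (AlgIso.comm k (H.C t) (H.C s)) ((comulTilde H t s).toLin a) * R s t := by
  let M := regular H
  refine Mult.ext_l (H.nondeg₂ _ _) fun z => ?_
  have e := Hom.app_act (B.braiding M M).hom (s * t) a (M.tmk M.toAGModule rfl z)
  rw [hB] at e
  have h' := conj_mul_self (rfl : s * t = s * t)
  have e' := (braid_act_tmk R M M rfl rfl h' a z).symm.trans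
    (e.trans (act_braid_tmk R M M rfl rfl h' a z))
  have e'' := (twist_bijective M M rfl).1 (tmk_injective _ _ _ e')
  exact (regular_ext₂ _ _).symm.trans (e''.trans (regular_ext₂ _ _))

/-- `(ι ⊗ Δ)(R) = R₁₃ R₁₂`, from the first hexagon axiom. -/
theorem comul_right_of_braided (hB : IsBraiding B R) (r s t : G) :
    idTensorComul H r s t (R r (s * t)) = leg₁₃ H r s t (R r t) * leg₁₂ H r s t (R r s) := by
  let M := regular H
  refine Mult.ext_l (nondeg₃ H r s t) fun z => LinearMap.congr_fun
    (TensorProduct.ext_threefold' fun x y z => ?_) z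
  have h' : r * (s * t) = r * s * t := (mul_assoc _ _ _).symm
  have e := congrArg (fun f => Hom.app f (r * s * t) ((tensorObj M M).tmk M.toAGModule rfl
    (M.tmk M.toAGModule (rfl : r * s = r * s) (x ⊗ₜ y) ⊗ₜ z))) (B.hexagon_forward M M M)
  have e₁ := hexagon_forward_left R M M M rfl rfl h' x y z
  have e₂ := hexagon_forward_right R M M M rfl rfl h' x y z (B.braiding M M).hom
    (B.braiding M M).hom (hB M M) (hB M M)
  rw [← hB] at e₁
  have e' := rotate_injective M M M h' (e₁.symm.trans (e.trans e₂))
  exact (regular_ext₃ _ _).symm.trans (e'.trans (regular_ext₃ _ _))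

/-- `(Δ̃ ⊗ ι)(R) = R₁₃ R₂₃`, from the second hexagon axiom. -/
theorem comul_left_of_braided (hB : IsBraiding B R) (r s t : G) :
    comulTildeTensorId H r s t (R (s * r) t) = leg₁₃ H r s t (R r t) * leg₂₃ H r s t (R s t) := by
  let M := regular H
  refine Mult.ext_l (nondeg₃ H r s t) fun z => LinearMap.congr_fun
    (TensorProduct.ext_threefold' fun x y z => ?_) z
  have h : s * r * s⁻¹ * (s * t) = s * r * t := by group
  have e := congrArg (fun f => Hom.app f (s * r * t) (M.tmk (tensorObj M M).toAGModule h
    (M.π s rfl x ⊗ₜ M.tmk M.toAGModule (rfl : s * t = s * t) (y ⊗ₜ z)))) (B.hexagon_reverse M M M)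
  have e₁ := hexagon_reverse_left R M M M rfl h rfl x y z
  have e₂ := hexagon_reverse_right R M M M rfl h rfl x y z (invariant_of_braided hB s r t)
    (B.braiding M M).hom (B.braiding M M).hom (hB M M) (hB M M)
  rw [← hB] at e₁
  have e' := rotateInv_injective M M M rfl (e₁.symm.trans (e.trans e₂))
  exact (regular_ext₃ _ _).symm.trans (e'.trans (regular_ext₃ _ _))

theorem app_bijective {M N : CrossedModule H} (e : M ≅ N) (p : G) :
    Function.Bijective (Hom.app e.hom p) :=
  Function.bijective_iff_has_inverse.2 ⟨Hom.app e.inv p,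
    fun x => congrArg (fun f => Hom.app f p x) e.hom_inv_id,
    fun x => congrArg (fun f => Hom.app f p x) e.inv_hom_id⟩

/-- For given `p` and `s`, the map `c_{M,N}` in degree `p` sends the summand `M_s ⊗ N_{s⁻¹p}`, and no
other one, to the summand `N_{ps⁻¹} ⊗ M_s`. -/
theorem tproj_braid (M N : CrossedModule H) {s t u p : G} (h : s * t = p) (hu : s * t * s⁻¹ = u)
    (h' : u * s = p) (x : (tensorObj M N).carrier p) :
    N.tproj M.toAGModule h' (braid R M N p x) =
      twist M N hu ((M.unital₂ N.toAGModule s t).ext (R s t) (M.tproj N.toAGModule h x)) := by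
  refine LinearMap.congr_fun (f := N.tproj M.toAGModule h' ∘ₗ braid R M N p)
    (g := twist M N hu ∘ₗ (M.unital₂ N.toAGModule s t).ext (R s t) ∘ₗ M.tproj N.toAGModule h)
    (tensor_ext fun s' t' h₁ m n => ?_) x
  refine (congrArg (N.tproj M.toAGModule h')
    (braid_tmk R M N h₁ rfl (conj_mul_self h₁) (m ⊗ₜ n))).trans ?_
  by_cases hs : s' = s
  · subst hs
    obtain rfl : t' = t := mul_left_cancel (h₁.trans h.symm)
    subst hu
    refine (tproj_tmk _ _ _ _).trans ?_
    exact congrArg (fun v => twist M N rfl ((M.unital₂ N.toAGModule s' t').ext (R s' t') v))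
      (tproj_tmk M.toAGModule N.toAGModule h (m ⊗ₜ n)).symm
  · have hne : s' * t' * s'⁻¹ ≠ u := fun e => hs (mul_left_cancel
      (a := u) (by rw [h', ← e, inv_mul_cancel_right, h₁]))
    refine (tproj_tmk_ne _ _ _ _ hne _).trans ?_
    refine Eq.trans ?_ (congrArg (fun v => twist M N hu ((M.unital₂ N.toAGModule s t).ext (R s t) v))
      (tproj_tmk_ne M.toAGModule N.toAGModule h h₁ hs (m ⊗ₜ n)).symm)
    simp

/-- The left multiplication by `R_{s,t}` is bijective, because the braiding is an isomorphism. -/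
theorem l_bijective_of_braided (hB : IsBraiding B R) (s t : G) : Function.Bijective (R s t).l := by
  let M := regular H
  have hb := app_bijective (B.braiding M M) (s * t)
  rw [hB] at hb
  have h' := conj_mul_self (rfl : s * t = s * t)
  constructor
  · intro z w hzw
    refine tmk_injective M.toAGModule M.toAGModule rfl (hb.1 ?_)
    refine (braid_tmk R M M rfl rfl h' z).trans (Eq.trans ?_ (braid_tmk R M M rfl rfl h' w).symm)
    congr 2
    exact (regular_ext₂ _ _).trans (hzw.trans (regular_ext₂ _ _).symm)
  · intro w
    obtain ⟨x, hx⟩ := hb.2 (M.tmk M.toAGModule h' (twist M M rfl w))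
    refine ⟨M.tproj M.toAGModule rfl x, (twist_bijective M M rfl).1 ?_⟩
    refine (congrArg (twist M M rfl) (regular_ext₂ _ _).symm).trans
      ((tproj_braid M M rfl rfl h' x).symm.trans ?_)
    rw [hx]
    exact tproj_tmk _ _ _ _

/-! ### The unit object and the counit of `R` -/

variable (H) in
/-- The element `1` of `K_1 = k`. -/
def unitOne : (unitObj H).carrier 1 := unitElem H.toGCogradedMHA

variable (H) in
/-- The identification `K_1 = k`. -/
def unitCoeff : (unitObj H).carrier 1 →ₗ[k] k := unitVal H.toGCogradedMHA 1

theorem eq_unitCoeff_smul (c : (unitObj H).carrier 1) : c = unitCoeff H c • unitOne H :=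
  unit_eq_smul c

theorem unit_tensor_eq {X : CrossedModule H} {t : G}
    (w : (unitObj H).carrier 1 ⊗[k] X.carrier t) :
    ∃ x, w = unitOne H ⊗ₜ x := by
  induction w using TensorProduct.induction_on with
  | zero => exact ⟨0, by simp⟩
  | add u v hu hv =>
    obtain ⟨x, rfl⟩ := hu
    obtain ⟨y, rfl⟩ := hv
    exact ⟨x + y, (TensorProduct.tmul_add _ _ _).symm⟩
  | tmul c x =>
    refine ⟨unitCoeff H c • x, ?_⟩
    rw [TensorProduct.tmul_smul, TensorProduct.smul_tmul', ← eq_unitCoeff_smul]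

theorem tensor_unit_eq {X : CrossedModule H} {r : G}
    (w : X.carrier r ⊗[k] (unitObj H).carrier 1) :
    ∃ x, w = x ⊗ₜ unitOne H := by
  induction w using TensorProduct.induction_on with
  | zero => exact ⟨0, by simp⟩
  | add u v hu hv =>
    obtain ⟨x, rfl⟩ := hu
    obtain ⟨y, rfl⟩ := hv
    exact ⟨x + y, (TensorProduct.add_tmul _ _ _).symm⟩
  | tmul x c =>
    refine ⟨unitCoeff H c • x, ?_⟩
    rw [TensorProduct.smul_tmul, ← eq_unitCoeff_smul]

theorem leftUnitor_tmk (X : CrossedModule H) (t : G) (x : X.carrier t) :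
    Hom.app (λ_ X).hom t ((unitObj H).tmk X.toAGModule (one_mul t) (unitOne H ⊗ₜ x)) = x :=
  (leftUnitorApp_tmk X.toAGModule t (unitElem H.toGCogradedMHA) (one_mul t) x).trans
    (one_smul k x)

theorem rightUnitor_tmk (X : CrossedModule H) (t : G) (x : X.carrier t) :
    Hom.app (ρ_ X).hom t (X.tmk (unitObj H).toAGModule (mul_one t) (x ⊗ₜ unitOne H)) = x :=
  (rightUnitorApp_tmk X.toAGModule t (unitElem H.toGCogradedMHA) (mul_one t) x).trans
    (one_smul k x)

/-- `R_{r,1}` acts trivially on `X_r ⊗ K_1`, because the braiding of `X` with the unit object is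
given by the unit constraints. -/
theorem ext_tmul_unit_of_braided (hB : IsBraiding B R) (X : CrossedModule H) (r : G)
    (w : X.carrier r ⊗[k] (unitObj H).carrier 1) :
    (X.unital₂ (unitObj H).toAGModule r 1).ext (R r 1) w = w := by
  obtain ⟨x, rfl⟩ := tensor_unit_eq w
  obtain ⟨y, hy⟩ := tensor_unit_eq
    ((X.unital₂ (unitObj H).toAGModule r 1).ext (R r 1) (x ⊗ₜ unitOne H))
  have hu : r * 1 * r⁻¹ = 1 := by simp
  have e := congrArg (fun f => Hom.app f r (X.tmk (unitObj H).toAGModule (mul_one r)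
    (x ⊗ₜ unitOne H))) (braiding_leftUnitor X)
  have e₁ := braid_tmk R X (unitObj H) (mul_one r) hu (one_mul r) (x ⊗ₜ unitOne H)
  rw [hy, ← hB] at e₁
  have e₂ := ((congrArg (Hom.app (λ_ X).hom r) e₁).symm.trans e).trans (rightUnitor_tmk X r x)
  rw [hy, ← e₂]
  exact congrArg (· ⊗ₜ unitOne H) (leftUnitor_tmk X r y).symm

/-- `R_{1,t}` acts trivially on `K_1 ⊗ X_t`. -/
theorem ext_unit_tmul_of_braided (hB : IsBraiding B R) (X : CrossedModule H) (t : G)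
    (w : (unitObj H).carrier 1 ⊗[k] X.carrier t) :
    ((unitObj H).unital₂ X.toAGModule 1 t).ext (R 1 t) w = w := by
  obtain ⟨x, rfl⟩ := unit_tensor_eq w
  obtain ⟨y, hy⟩ := unit_tensor_eq
    (((unitObj H).unital₂ X.toAGModule 1 t).ext (R 1 t) (unitOne H ⊗ₜ x))
  have hu : 1 * t * 1⁻¹ = t := by simp
  have e := congrArg (fun f => Hom.app f t ((unitObj H).tmk X.toAGModule (one_mul t)
    (unitOne H ⊗ₜ x))) (braiding_rightUnitor X)
  have e₁ := braid_tmk R (unitObj H) X (one_mul t) hu (mul_one t) (unitOne H ⊗ₜ x)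
  rw [hy, ← hB] at e₁
  have e₂ := ((congrArg (Hom.app (ρ_ X).hom t) e₁).symm.trans e).trans (leftUnitor_tmk X t x)
  rw [hy, ← e₂]
  exact congrArg (unitOne H ⊗ₜ ·)
    ((X.π_one hu y).symm.trans (rightUnitor_tmk X t (X.π 1 hu y)).symm)

/-- The counit as a map `A_1 → K_1`. -/
def counitUnit (H : MultiplierHopfTCoalgebra k G A) : H.C 1 →ₗ[k] (unitObj H).carrier 1 :=
  LinearMap.toSpanSingleton k _ (unitOne H) ∘ₗ H.hopf.counit ∘ₗ H.inc 1

theorem counitUnit_act (a x : H.C 1) :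
    counitUnit H (a * x) = (unitObj H).act 1 a (counitUnit H x) := by
  refine Eq.trans ?_ (unitMod_act _ _ _).symm
  have e : H.hopf.counit ((a * x : H.C 1) : A) = H.hopf.counit a * H.hopf.counit x :=
    H.hopf.counit_mul a x
  change H.hopf.counit ((a * x : H.C 1) : A) • unitOne H =
    H.hopf.counit (a : A) • H.hopf.counit (x : A) • unitOne H
  rw [e, mul_smul]

theorem unitCoeff_comp_counitUnit :
    unitCoeff H ∘ₗ counitUnit H = H.hopf.counit ∘ₗ H.inc 1 :=
  LinearMap.ext fun _ => mul_one _

/-- `(ι ⊗ ε)(R_{r,1}) = 1`. -/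
theorem counit_right_of_braided (hB : IsBraiding B R) (r : G) (z : H.C r ⊗[k] H.C 1) :
    TensorProduct.map LinearMap.id (H.hopf.counit ∘ₗ H.inc 1) ((R r 1).l z) =
      TensorProduct.map LinearMap.id (H.hopf.counit ∘ₗ H.inc 1) z := by
  let M := regular H
  have e := IsUnitalModule.ext_map (M.unital₂ M.toAGModule r 1)
    (M.unital₂ (unitObj H).toAGModule r 1) (TensorProduct.map LinearMap.id (counitUnit H))
    (fun b w => (tensorAct_intertwine .id .id LinearMap.id (counitUnit H) (fun _ _ => rfl)
      counitUnit_act b w).trans (by rw [TensorProduct.map_id]; rfl)) (R r 1) z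
  have e' := (congrArg (TensorProduct.map LinearMap.id (counitUnit H))
    (regular_ext₂ (R r 1) z).symm).trans (e.trans (ext_tmul_unit_of_braided hB M r _))
  rw [← unitCoeff_comp_counitUnit, ← LinearMap.id_comp (LinearMap.id : H.C r →ₗ[k] H.C r),
    TensorProduct.map_comp]
  exact congrArg (TensorProduct.map LinearMap.id (unitCoeff H)) e'

/-- `(ε ⊗ ι)(R_{1,t}) = 1`. -/
theorem counit_left_of_braided (hB : IsBraiding B R) (t : G) (z : H.C 1 ⊗[k] H.C t) :
    TensorProduct.map (H.hopf.counit ∘ₗ H.inc 1) LinearMap.id ((R 1 t).l z) =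
      TensorProduct.map (H.hopf.counit ∘ₗ H.inc 1) LinearMap.id z := by
  let M := regular H
  have e := IsUnitalModule.ext_map (M.unital₂ M.toAGModule 1 t)
    ((unitObj H).unital₂ M.toAGModule 1 t) (TensorProduct.map (counitUnit H) LinearMap.id)
    (fun b w => (tensorAct_intertwine .id .id (counitUnit H) LinearMap.id
      counitUnit_act (fun _ _ => rfl) b w).trans (by rw [TensorProduct.map_id]; rfl)) (R 1 t) z
  have e' := (congrArg (TensorProduct.map (counitUnit H) LinearMap.id)
    (regular_ext₂ (R 1 t) z).symm).trans (e.trans (ext_unit_tmul_of_braided hB M t _))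
  rw [← unitCoeff_comp_counitUnit, ← LinearMap.id_comp (LinearMap.id : H.C t →ₗ[k] H.C t),
    TensorProduct.map_comp]
  exact congrArg (TensorProduct.map (unitCoeff H) LinearMap.id) e'

end Necessity

end CrossedModule

end Crossed

/-! ### The antipode of a multiplier Hopf algebra -/

section Antipode

namespace IsMultiplierHopf

variable {k A : Type*} [Field k]
  [NonUnitalRing A] [Module k A] [IsScalarTower k A A] [SMulCommClass k A A]
  {Δ : A →ₗ[k] Mult k (A ⊗[k] A)}

/-- `T₁` as a linear automorphism. -/
def T₁Equiv (h : IsMultiplierHopf Δ) : A ⊗[k] A ≃ₗ[k] A ⊗[k] A :=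
  LinearEquiv.ofBijective h.T₁ h.T₁_bij

/-- `T₂` as a linear automorphism. -/
def T₂Equiv (h : IsMultiplierHopf Δ) : A ⊗[k] A ≃ₗ[k] A ⊗[k] A :=
  LinearEquiv.ofBijective h.T₂ h.T₂_bij

/-- The map `a ⊗ b ↦ S(a) b`, where `S : A → M(A)` is the antipode.  It is `(ε ⊗ ι)T₁⁻¹`. -/
def antipodeLeft (h : IsMultiplierHopf Δ) : A ⊗[k] A →ₗ[k] A :=
  (TensorProduct.lid k A).toLinearMap ∘ₗ h.counit.rTensor A ∘ₗ h.T₁Equiv.symm.toLinearMap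

/-- The map `a ⊗ b ↦ a S(b)`, where `S : A → M(A)` is the antipode.  It is `(ι ⊗ ε)T₂⁻¹`. -/
def antipodeRight (h : IsMultiplierHopf Δ) : A ⊗[k] A →ₗ[k] A :=
  (TensorProduct.rid k A).toLinearMap ∘ₗ h.counit.lTensor A ∘ₗ h.T₂Equiv.symm.toLinearMap

theorem antipodeLeft_T₁ (h : IsMultiplierHopf Δ) (w : A ⊗[k] A) :
    h.antipodeLeft (h.T₁ w) = TensorProduct.lid k A (h.counit.rTensor A w) := by
  have : h.T₁Equiv.symm (h.T₁ w) = w := h.T₁Equiv.symm_apply_apply w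
  simp [antipodeLeft, this]

theorem antipodeRight_T₂ (h : IsMultiplierHopf Δ) (w : A ⊗[k] A) :
    h.antipodeRight (h.T₂ w) = TensorProduct.rid k A (h.counit.lTensor A w) := by
  have : h.T₂Equiv.symm (h.T₂ w) = w := h.T₂Equiv.symm_apply_apply w
  simp [antipodeRight, this]

/-- `S(a₍₁₎ b) a₍₂₎ c = ε(a) S(b) c`. -/
theorem antipodeLeft_comul (h : IsMultiplierHopf Δ) (a : A) (w : A ⊗[k] A) :
    h.antipodeLeft ((Δ a).l w) = h.counit a • h.antipodeLeft w := by
  obtain ⟨v, rfl⟩ := h.T₁_bij.2 w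
  induction v using TensorProduct.induction_on with
  | zero => simp
  | add u v hu hv => simp only [_root_.map_add, smul_add, hu, hv]
  | tmul x y =>
    have : (Δ a).l (h.T₁ (x ⊗ₜ y)) = h.T₁ ((a * x) ⊗ₜ y) := by
      apply h.T₁_eq
      rw [h.map_mul, mul_assoc, ← h.incl_T₁]
      refine Mult.ext_l (h.nondeg.tensor h.nondeg) fun z => ?_
      simp [Mult.l_mul_right (h.nondeg.tensor h.nondeg)]
    rw [this, antipodeLeft_T₁, antipodeLeft_T₁]
    simp [h.counit_mul, mul_smul]

/-- `a (S(b) c) = (a S(b)) c`. -/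
theorem mul_antipodeLeft (h : IsMultiplierHopf Δ) (x a z : A) :
    x * h.antipodeLeft (a ⊗ₜ z) = h.antipodeRight (x ⊗ₜ a) * z := by
  let T₁₂ : A ⊗[k] (A ⊗[k] A) ≃ₗ[k] A ⊗[k] (A ⊗[k] A) :=
    (TensorProduct.assoc k A A A).symm ≪≫ₗ
      TensorProduct.congr h.T₂Equiv (LinearEquiv.refl k A) ≪≫ₗ TensorProduct.assoc k A A A
  let T₂₃ : A ⊗[k] (A ⊗[k] A) ≃ₗ[k] A ⊗[k] (A ⊗[k] A) :=
    TensorProduct.congr (LinearEquiv.refl k A) h.T₁Equiv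
  let f : A ⊗[k] (A ⊗[k] A) →ₗ[k] A := mulMap k A ∘ₗ TensorProduct.map LinearMap.id
    ((TensorProduct.lid k A).toLinearMap ∘ₗ h.counit.rTensor A)
  -- coassociativity: the two maps commute
  have hcomm : ∀ u, T₂₃ (T₁₂ u) = T₁₂ (T₂₃ u) := by
    intro u
    refine LinearMap.congr_fun (f := T₂₃.toLinearMap ∘ₗ T₁₂.toLinearMap)
      (g := T₁₂.toLinearMap ∘ₗ T₂₃.toLinearMap)
      (TensorProduct.ext_threefold' fun a b c => ?_) u
    have := congrArg (TensorProduct.assoc k A A A) (h.coassoc a b c)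
    rw [LinearEquiv.apply_symm_apply] at this
    exact this.symm
  have hf : ∀ (t : A ⊗[k] A) (y : A), f (TensorProduct.assoc k A A A (t ⊗ₜ y)) =
      TensorProduct.rid k A (h.counit.lTensor A t) * y := by
    intro t y
    induction t using TensorProduct.induction_on with
    | zero => simp
    | add u v hu hv => simp only [_root_.map_add, TensorProduct.add_tmul, add_mul, hu, hv]
    | tmul p q => simp [f, smul_mul_assoc]
  -- both maps become the threefold product after contraction with the counit
  have hmul : ∀ u, f (T₁₂ u) = f (T₂₃ u) := by
    intro u
    refine LinearMap.congr_fun (f := f ∘ₗ T₁₂.toLinearMap) (g := f ∘ₗ T₂₃.toLinearMap)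
      (TensorProduct.ext_threefold' fun p b y => ?_) u
    refine (hf (h.T₂ (p ⊗ₜ b)) y).trans ?_
    rw [h.counit_T₂]
    refine Eq.trans ?_ (congrArg (p * ·) (h.counit_T₁ (b ⊗ₜ y)).symm)
    simp [mul_assoc]
  let u := T₁₂.symm (x ⊗ₜ h.T₁Equiv.symm (a ⊗ₜ z))
  have h1 : T₁₂ u = x ⊗ₜ h.T₁Equiv.symm (a ⊗ₜ z) := T₁₂.apply_symm_apply _
  have h2 : T₂₃ u = TensorProduct.assoc k A A A (h.T₂Equiv.symm (x ⊗ₜ a) ⊗ₜ z) := by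
    apply T₁₂.injective
    rw [← hcomm, h1]
    simp [T₁₂, T₂₃]
  have h3 := hmul u
  rw [h1, h2, hf] at h3
  exact h3

end IsMultiplierHopf

namespace GCogradedMHA

variable {k G A : Type*} [Field k] [Group G] [DecidableEq G]
  [NonUnitalRing A] [Module k A] [IsScalarTower k A A] [SMulCommClass k A A]
  (H : GCogradedMHA k G A)

/-- `(A_r ⊗ 1)Δ(A_{rt})` is contained in `A_r ⊗ A_t`. -/
theorem T₂_mem {r t : G} {a b : A} (ha : a ∈ H.comp r) (hb : b ∈ H.comp (r * t)) :
    H.hopf.T₂ (a ⊗ₜ b) ∈ LinearMap.range (TensorProduct.map (H.inc r) (H.inc t)) := by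
  have h1 : (Mult.incl (H.hopf.T₂ (a ⊗ₜ b)) : Mult k (A ⊗[k] A)) ∈ Submodule.map Mult.incl
      (LinearMap.range (TensorProduct.map (H.inc r) (H.inc t))) := by
    have h3 : tmulOne a * H.Δ b ∈
        Submodule.span k {m | ∃ a ∈ H.comp r, ∃ b ∈ H.comp t, Mult.incl (a ⊗ₜ[k] b) = m} := by
      rw [← H.comul_right r t]; exact Submodule.subset_span ⟨a, ha, b, hb, rfl⟩
    rw [H.hopf.incl_T₂]
    refine Submodule.span_le.2 ?_ h3
    rintro _ ⟨x, hx, y, hy, rfl⟩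
    exact ⟨_, ⟨(⟨x, hx⟩ : H.C r) ⊗ₜ (⟨y, hy⟩ : H.C t), rfl⟩, rfl⟩
  obtain ⟨z, hz, e⟩ := h1
  rwa [← incl_injective (k := k) H.nondegAA e]

/-- The map `A_s ⊗ A_t → A_t`, `a ⊗ b ↦ S(a) b`. -/
def antipodeLeft (s t : G) : H.C s ⊗[k] H.C t →ₗ[k] H.C t :=
  H.pr t ∘ₗ H.hopf.antipodeLeft ∘ₗ TensorProduct.map (H.inc s) (H.inc t)

/-- The map `A_t ⊗ A_s → A_t`, `a ⊗ b ↦ a S(b)`. -/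
def antipodeRight (t s : G) : H.C t ⊗[k] H.C s →ₗ[k] H.C t :=
  H.pr t ∘ₗ H.hopf.antipodeRight ∘ₗ TensorProduct.map (H.inc t) (H.inc s)

theorem antipodeLeft_comul (s t : G) (a : A) (w : H.C s ⊗[k] H.C t) :
    H.antipodeLeft s t ((H.comul s t a).l w) = H.hopf.counit a • H.antipodeLeft s t w := by
  have e : TensorProduct.map (H.inc s) (H.inc t) ((H.comul s t a).l w) =
      (H.Δ a).l (TensorProduct.map (H.inc s) (H.inc t) w) :=
    ((H.isFactor s).tensor (H.isFactor t)).j_restrict_l H.nondegAA (H.Δ a) w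
  simp only [antipodeLeft, LinearMap.comp_apply]
  rw [e, H.hopf.antipodeLeft_comul, map_smul]

theorem mul_antipodeLeft (s t : G) (x z : H.C t) (a : H.C s) :
    x * H.antipodeLeft s t (a ⊗ₜ z) = H.antipodeRight t s (x ⊗ₜ a) * z := by
  have e := congrArg (H.pr t) (H.hopf.mul_antipodeLeft (x : A) (a : A) (z : A))
  rw [(H.isFactor t).r_mul H.nondegA, (H.isFactor t).r_mul H.nondegA, H.pr_same x.2,
    H.pr_same z.2] at e
  exact e

/-- `A_t S(A_{t⁻¹}) = A_t`: if `q ∈ A_1` has `ε(q) = 1`, then `(p ⊗ 1)Δ(q)`, which lies in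
`A_t ⊗ A_{t⁻¹}` for `p ∈ A_t`, is mapped to `p q₍₁₎ S(q₍₂₎) = p`. -/
theorem antipodeRight_surjective {t s : G} (h : t * s = 1) :
    Function.Surjective (H.antipodeRight t s) := by
  intro p
  obtain ⟨q, hq⟩ := H.exists_counit_eq_one
  rw [← H.counit_pr] at hq
  obtain ⟨w, hw⟩ := H.T₂_mem (r := t) (t := s) p.2 (b := H.pr 1 q) (by rw [h]; exact (H.pr 1 q).2)
  refine ⟨w, ?_⟩
  simp only [antipodeRight, LinearMap.comp_apply]
  rw [hw, H.hopf.antipodeRight_T₂]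
  simp only [LinearMap.lTensor_tmul, TensorProduct.rid_tmul, hq, one_smul]
  exact H.pr_same p.2

end GCogradedMHA

end Antipode

/-! ### Contractions with the counit -/

section Contraction

variable {k B C X Y W : Type*} [Field k]
  [NonUnitalRing B] [Module k B] [IsScalarTower k B B] [SMulCommClass k B B]
  [NonUnitalRing C] [Module k C] [IsScalarTower k C C] [SMulCommClass k C C]
  [AddCommGroup X] [Module k X] [AddCommGroup Y] [Module k Y] [AddCommGroup W] [Module k W]
  {actX : B →ₗ[k] X →ₗ[k] X} {actY : C →ₗ[k] Y →ₗ[k] Y}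

/-- If `(ι ⊗ ε)(m) = 1` and `P` transforms the action of `C` into `ε`, then `m` acts trivially
after `ι ⊗ P`. -/
theorem IsUnitalModule.map_id_ext_tensor (hX : IsUnitalModule actX) (hY : IsUnitalModule actY)
    {ε : C →ₗ[k] k} {P : Y →ₗ[k] W} (hP : ∀ c y, P (actY c y) = ε c • P y)
    {m : Mult k (B ⊗[k] C)}
    (hm : ∀ z, TensorProduct.map LinearMap.id ε (m.l z) = TensorProduct.map LinearMap.id ε z)
    (w : X ⊗[k] Y) :
    TensorProduct.map LinearMap.id P ((hX.tensor hY).ext m w) =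
      TensorProduct.map LinearMap.id P w := by
  refine (hX.tensor hY).induct (p := fun w => TensorProduct.map LinearMap.id P
    ((hX.tensor hY).ext m w) = TensorProduct.map LinearMap.id P w) (fun z w => ?_)
    (fun _ _ h h' => by rw [map_add, map_add, map_add, h, h']) w
  rw [(hX.tensor hY).ext_act]
  induction w using TensorProduct.induction_on with
  | zero => simp
  | add u v hu hv => simp only [map_add, hu, hv]
  | tmul x y =>
    have key : ∀ z, TensorProduct.map LinearMap.id P (tensorAct actX actY z (x ⊗ₜ y)) =
        TensorProduct.rid k _ (TensorProduct.map (actX.flip x) LinearMap.id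
          (TensorProduct.map LinearMap.id ε z)) ⊗ₜ P y := by
      intro z
      induction z using TensorProduct.induction_on with
      | zero => simp
      | add u v hu hv => simp only [map_add, LinearMap.add_apply, TensorProduct.add_tmul, hu, hv]
      | tmul b c => simp [tensorAct_tmul, hP, TensorProduct.smul_tmul]
    rw [key, key, hm]

/-- If `(ε ⊗ ι)(m) = 1` and `P` transforms the action of `B` into `ε`, then `m` acts trivially
after `P ⊗ ι`. -/
theorem IsUnitalModule.map_ext_tensor_id (hX : IsUnitalModule actX) (hY : IsUnitalModule actY)
    {ε : B →ₗ[k] k} {P : X →ₗ[k] W} (hP : ∀ b x, P (actX b x) = ε b • P x)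
    {m : Mult k (B ⊗[k] C)}
    (hm : ∀ z, TensorProduct.map ε LinearMap.id (m.l z) = TensorProduct.map ε LinearMap.id z)
    (w : X ⊗[k] Y) :
    TensorProduct.map P LinearMap.id ((hX.tensor hY).ext m w) =
      TensorProduct.map P LinearMap.id w := by
  refine (hX.tensor hY).induct (p := fun w => TensorProduct.map P LinearMap.id
    ((hX.tensor hY).ext m w) = TensorProduct.map P LinearMap.id w) (fun z w => ?_)
    (fun _ _ h h' => by rw [map_add, map_add, map_add, h, h']) w
  rw [(hX.tensor hY).ext_act]
  induction w using TensorProduct.induction_on with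
  | zero => simp
  | add u v hu hv => simp only [map_add, hu, hv]
  | tmul x y =>
    have key : ∀ z, TensorProduct.map P LinearMap.id (tensorAct actX actY z (x ⊗ₜ y)) =
        P x ⊗ₜ TensorProduct.lid k _ (TensorProduct.map LinearMap.id (actY.flip y)
          (TensorProduct.map ε LinearMap.id z)) := by
      intro z
      induction z using TensorProduct.induction_on with
      | zero => simp
      | add u v hu hv => simp only [map_add, LinearMap.add_apply, TensorProduct.tmul_add, hu, hv]
      | tmul b c => simp [tensorAct_tmul, hP, TensorProduct.smul_tmul]
    rw [key, key, hm]

end Contraction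

section Invertibility

variable {k G A : Type u} [Field k] [Group G] [DecidableEq G]
  [NonUnitalRing A] [Module k A] [IsScalarTower k A A] [SMulCommClass k A A]

namespace CrossedModule

open AGModule

variable {H : MultiplierHopfTCoalgebra k G A} {R : ∀ p q : G, Mult k (H.C p ⊗[k] H.C q)}
  {B : BraidedCategory (CrossedModule H)}

/-! ### Invertibility of `R` -/

theorem leg₁₂_l {r s t : G} (m : Mult k (H.C r ⊗[k] H.C s)) (w : H.C r ⊗[k] H.C s) (z : H.C t) :
    (leg₁₂ H r s t m).l (TensorProduct.assoc k _ _ _ (w ⊗ₜ z)) =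
      TensorProduct.assoc k _ _ _ (m.l w ⊗ₜ z) :=
  congrArg (fun v => TensorProduct.assoc k _ _ _ ((Mult.tmul m 1).l v))
    ((TensorProduct.assoc k (H.C r) (H.C s) (H.C t)).symm_apply_apply (w ⊗ₜ z))

theorem leg₂₃_l {r s t : G} (m : Mult k (H.C s ⊗[k] H.C t)) (x : H.C r) (w : H.C s ⊗[k] H.C t) :
    (leg₂₃ H r s t m).l (x ⊗ₜ w) = x ⊗ₜ m.l w := rfl

theorem leg₁₃_l {r s t : G} (m : Mult k (H.C r ⊗[k] H.C t)) (y : H.C s) (w : H.C r ⊗[k] H.C t) :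
    (leg₁₃ H r s t m).l (TensorProduct.leftComm k _ _ _ (y ⊗ₜ w)) =
      TensorProduct.leftComm k _ _ _ (y ⊗ₜ m.l w) :=
  congrArg (fun v => TensorProduct.leftComm k _ _ _ ((Mult.tmul 1 m).l v))
    ((TensorProduct.leftComm k (H.C s) (H.C r) (H.C t)).symm_apply_apply (y ⊗ₜ w))

/-- `R₁₃ R₁₂` acts trivially after applying `b ⊗ c ↦ S(b) c` to the last two legs, because
`R₁₃ R₁₂ = (ι ⊗ Δ)(R_{r,1})`, this map transforms `Δ` into `ε`, and `(ι ⊗ ε)(R_{r,1}) = 1`. -/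
theorem map_id_antipodeLeft_of_braided (hB : IsBraiding B R) (r s t : G) (h : s * t = 1)
    (w : H.C r ⊗[k] (H.C s ⊗[k] H.C t)) :
    TensorProduct.map LinearMap.id (H.antipodeLeft s t)
      ((leg₁₃ H r s t (R r t) * leg₁₂ H r s t (R r s)).l w) =
      TensorProduct.map LinearMap.id (H.antipodeLeft s t) w := by
  let M := regular H
  rw [← comul_right_of_braided hB]
  have hε : ∀ (p : G) (_ : p = 1) (z : H.C r ⊗[k] H.C p),
      TensorProduct.map LinearMap.id (H.hopf.counit ∘ₗ H.inc p) ((R r p).l z) =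
        TensorProduct.map LinearMap.id (H.hopf.counit ∘ₗ H.inc p) z := by
    rintro _ rfl z
    exact counit_right_of_braided hB r z
  have e := (M.unital r).map_id_ext_tensor
    (M.pairAct_unital M.toAGModule (rfl : s * t = s * t)) (P := H.antipodeLeft s t)
    (ε := H.hopf.counit ∘ₗ H.inc (s * t))
    (fun a y => (congrArg (H.antipodeLeft s t) (regular_ext₂ (H.comul s t a) y)).trans
      (H.antipodeLeft_comul s t a y)) (hε _ h) w
  refine Eq.trans (congrArg _ ?_) e
  exact (regular_ext₃ _ _).symm.trans (ext_tensor_pairAct M M M _ _).symm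

/-- The multiplier `(1 ⊗ c) R_{r,t} (a ⊗ 1)` lies in `A_r ⊗ A_t`: for `c = x S(y)` with
`y ∈ A_{t⁻¹}` it is `(ι ⊗ x S)(v)` with `R_{r,t⁻¹} v = a ⊗ y`, as the triviality of `R₁₃ R₁₂` after
contraction shows when it is applied to `v ⊗ z`. -/
theorem exists_eq_mul_of_braided (hB : IsBraiding B R) (r t : G) (a : H.C r) (c : H.C t) :
    ∃ n : H.C r ⊗[k] H.C t, ∀ z, TensorProduct.map LinearMap.id (LinearMap.mulLeft k c)
      ((R r t).l (a ⊗ₜ z)) = TensorProduct.map LinearMap.id (LinearMap.mulRight k z) n := by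
  obtain ⟨u, rfl⟩ := H.antipodeRight_surjective (mul_inv_cancel t) c
  induction u using TensorProduct.induction_on with
  | zero => exact ⟨0, fun z => by simp⟩
  | add u v hu hv =>
    obtain ⟨n, hn⟩ := hu
    obtain ⟨n', hn'⟩ := hv
    refine ⟨n + n', fun z => ?_⟩
    have hadd : ∀ c c' : H.C t, LinearMap.mulLeft k (c + c') =
        LinearMap.mulLeft k c + LinearMap.mulLeft k c' := fun c c' =>
      LinearMap.ext fun x => add_mul c c' x
    rw [map_add, hadd, TensorProduct.map_add_right, LinearMap.add_apply, hn, hn', map_add]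
  | tmul x y =>
    obtain ⟨v, hv⟩ := (l_bijective_of_braided hB r t⁻¹).2 (a ⊗ₜ y)
    refine ⟨TensorProduct.map LinearMap.id
      (H.antipodeRight t t⁻¹ ∘ₗ TensorProduct.mk k _ _ x) v, fun z => ?_⟩
    have e := map_id_antipodeLeft_of_braided hB r t⁻¹ t (inv_mul_cancel t)
      (TensorProduct.assoc k _ _ _ (v ⊗ₜ z))
    have e₁ : (leg₁₃ H r t⁻¹ t (R r t) * leg₁₂ H r t⁻¹ t (R r t⁻¹)).l
        (TensorProduct.assoc k _ _ _ (v ⊗ₜ z)) =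
        TensorProduct.leftComm k _ _ _ (y ⊗ₜ (R r t).l (a ⊗ₜ z)) := by
      rw [Mult.l_mul, leg₁₂_l, hv]
      exact leg₁₃_l (R r t) y (a ⊗ₜ z)
    rw [e₁] at e
    have e₂ := congrArg (TensorProduct.map LinearMap.id (LinearMap.mulLeft k x)) e
    have l₁ : ∀ u : H.C r ⊗[k] H.C t, TensorProduct.map LinearMap.id (LinearMap.mulLeft k x)
        (TensorProduct.map LinearMap.id (H.antipodeLeft t⁻¹ t)
          (TensorProduct.leftComm k _ _ _ (y ⊗ₜ u))) =
        TensorProduct.map LinearMap.id (LinearMap.mulLeft k (H.antipodeRight t t⁻¹ (x ⊗ₜ y))) u := by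
      intro u
      induction u using TensorProduct.induction_on with
      | zero => simp
      | add u v hu hv => simp only [map_add, TensorProduct.tmul_add, hu, hv]
      | tmul p q => simp [H.mul_antipodeLeft]
    have l₂ : TensorProduct.map LinearMap.id (LinearMap.mulLeft k x)
        (TensorProduct.map LinearMap.id (H.antipodeLeft t⁻¹ t)
          (TensorProduct.assoc k _ _ _ (v ⊗ₜ z))) =
        TensorProduct.map LinearMap.id (LinearMap.mulRight k z) (TensorProduct.map LinearMap.id
          (H.antipodeRight t t⁻¹ ∘ₗ TensorProduct.mk k _ _ x) v) := by
      clear hv e e₁ e₂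
      induction v using TensorProduct.induction_on with
      | zero => simp
      | add u v hu hv => simp only [map_add, TensorProduct.add_tmul, hu, hv]
      | tmul p q => simp [H.mul_antipodeLeft]
    rw [← l₁, ← l₂]
    exact e₂

theorem conj_inv_conj (r s : G) : s⁻¹ * (s * r * s⁻¹) * s⁻¹⁻¹ = r := by group

variable (H) in
/-- The map `A_r ⊗ A_s → A_s`, `a ⊗ b ↦ S(π_s(a)) b`. -/
def antipodeLeftTilde (r s : G) : H.C r ⊗[k] H.C s →ₗ[k] H.C s :=
  H.antipodeLeft (s * r * s⁻¹) s ∘ₗ TensorProduct.map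
    (H.piIso s⁻¹ (conj_inv_conj r s)).toLinearEquiv.symm.toLinearMap LinearMap.id

variable (H) in
/-- The map `A_s ⊗ A_r → A_s`, `a ⊗ b ↦ a S(π_s(b))`. -/
def antipodeRightTilde (s r : G) : H.C s ⊗[k] H.C r →ₗ[k] H.C s :=
  H.antipodeRight s (s * r * s⁻¹) ∘ₗ TensorProduct.map LinearMap.id
    (H.piIso s⁻¹ (conj_inv_conj r s)).toLinearEquiv.symm.toLinearMap

theorem mul_antipodeLeftTilde (r s : G) (x z : H.C s) (a : H.C r) :
    x * antipodeLeftTilde H r s (a ⊗ₜ z) = antipodeRightTilde H s r (x ⊗ₜ a) * z :=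
  H.mul_antipodeLeft _ s x z _

theorem antipodeRightTilde_surjective {s r : G} (h : s * r = 1) :
    Function.Surjective (antipodeRightTilde H s r) := by
  have h' : s * (s * r * s⁻¹) = 1 := by rw [h]; simp
  exact (H.antipodeRight_surjective h').comp (TensorProduct.map_surjective
    Function.surjective_id (H.piIso s⁻¹ (conj_inv_conj r s)).toLinearEquiv.symm.surjective)

theorem antipodeLeftTilde_comulTilde (r s : G) (a : H.C (s * r)) (w : H.C r ⊗[k] H.C s) :
    antipodeLeftTilde H r s (((comulTilde H r s).toLin a).l w) =
      H.hopf.counit (a : A) • antipodeLeftTilde H r s w := by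
  refine Eq.trans ?_ (H.antipodeLeft_comul (s * r * s⁻¹) s a _)
  refine congrArg (H.antipodeLeft (s * r * s⁻¹) s) ?_
  exact (TensorProduct.congr (H.piIso s⁻¹ (conj_inv_conj r s)).toLinearEquiv
    (LinearEquiv.refl k (H.C s))).symm_apply_apply _

/-- `R₁₃ R₂₃` acts trivially after applying `a ⊗ b ↦ S(π_s(a)) b` to the first two legs, because
`R₁₃ R₂₃ = (Δ̃ ⊗ ι)(R_{1,t})` and `(ε ⊗ ι)(R_{1,t}) = 1`. -/
theorem map_antipodeLeftTilde_id_of_braided (hB : IsBraiding B R) (r s t : G) (h : s * r = 1)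
    (w : H.C r ⊗[k] (H.C s ⊗[k] H.C t)) :
    TensorProduct.map (antipodeLeftTilde H r s) LinearMap.id ((TensorProduct.assoc k _ _ _).symm
      ((leg₁₃ H r s t (R r t) * leg₂₃ H r s t (R s t)).l w)) =
      TensorProduct.map (antipodeLeftTilde H r s) LinearMap.id
        ((TensorProduct.assoc k _ _ _).symm w) := by
  let M := regular H
  rw [← comul_left_of_braided hB]
  have hε : ∀ (p : G) (_ : p = 1) (z : H.C p ⊗[k] H.C t),
      TensorProduct.map (H.hopf.counit ∘ₗ H.inc p) LinearMap.id ((R p t).l z) =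
        TensorProduct.map (H.hopf.counit ∘ₗ H.inc p) LinearMap.id z := by
    rintro _ rfl z
    exact counit_left_of_braided hB t z
  have e := ((M.unital₂ M.toAGModule r s).pull (comulTilde H r s)).map_ext_tensor_id
    (M.unital t) (P := antipodeLeftTilde H r s) (ε := H.hopf.counit ∘ₗ H.inc (s * r))
    (fun a y => (congrArg (antipodeLeftTilde H r s)
      (regular_ext₂ ((comulTilde H r s).toLin a) y)).trans (antipodeLeftTilde_comulTilde r s a y))
    (hε _ h) ((TensorProduct.assoc k _ _ _).symm w)
  refine Eq.trans (congrArg _ ?_) e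
  refine (TensorProduct.assoc k (H.C r) (H.C s) (H.C t)).symm_apply_eq.2 ?_
  refine ((ext_comulTilde_tensor M M M (R (s * r) t) _).trans ((congrArg _
    ((TensorProduct.assoc k (H.C r) (H.C s) (H.C t)).apply_symm_apply w)).trans ?_)).symm
  exact regular_ext₃ _ _

/-- Every `x S(π_s(a)) ⊗ c` with `a ∈ A_{s⁻¹}` is of the form `w R_{s,t}`, where
`w = (x S π_s ⊗ ι)((1 ⊗ c) R_{s⁻¹,t} (a ⊗ 1))`.  These elements span `A_s ⊗ A_t`. -/
theorem r_surjective_of_braided (hB : IsBraiding B R) (s t : G) :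
    Function.Surjective (R s t).r := by
  rw [← LinearMap.range_eq_top, eq_top_iff, ← TensorProduct.span_tmul_eq_top, Submodule.span_le]
  rintro _ ⟨b, c, rfl⟩
  obtain ⟨u, rfl⟩ := antipodeRightTilde_surjective (H := H) (mul_inv_cancel s) b
  change _ ∈ LinearMap.range (R s t).r
  induction u using TensorProduct.induction_on with
  | zero => simp
  | add u v hu hv => rw [map_add, TensorProduct.add_tmul]; exact add_mem hu hv
  | tmul x a =>
    obtain ⟨n, hn⟩ := exists_eq_mul_of_braided hB s⁻¹ t a c
    refine ⟨TensorProduct.map (antipodeRightTilde H s s⁻¹ ∘ₗ TensorProduct.mk k _ _ x)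
      LinearMap.id n, sub_eq_zero.1 ((H.nondeg₂ s t).1 _ fun y => ?_)⟩
    rw [sub_mul, sub_eq_zero, ← Mult.l_r]
    have e := congrArg (TensorProduct.map (LinearMap.mulLeft k x) (LinearMap.mulLeft k c))
      (map_antipodeLeftTilde_id_of_braided hB s⁻¹ s t (mul_inv_cancel s) (a ⊗ₜ y))
    rw [Mult.l_mul, leg₂₃_l] at e
    refine Eq.trans ?_ (e.trans ?_)
    -- for every `v`, the contraction of `R₁₃ (a ⊗ v)` is `w v`
    · generalize (R s t).l y = v
      induction v using TensorProduct.induction_on with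
      | zero => simp
      | add u v hu hv => simp only [mul_add, map_add, TensorProduct.tmul_add, hu, hv]
      | tmul p q =>
        have l : ∀ u : H.C s⁻¹ ⊗[k] H.C t,
            TensorProduct.map (LinearMap.mulLeft k x) (LinearMap.mulLeft k c)
              (TensorProduct.map (antipodeLeftTilde H s⁻¹ s) LinearMap.id
                ((TensorProduct.assoc k _ _ _).symm (TensorProduct.leftComm k _ _ _ (p ⊗ₜ u)))) =
            TensorProduct.map (LinearMap.mulRight k p ∘ₗ antipodeRightTilde H s s⁻¹ ∘ₗ
                TensorProduct.mk k _ _ x) LinearMap.id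
              (TensorProduct.map LinearMap.id (LinearMap.mulLeft k c) u) := by
          intro u
          induction u using TensorProduct.induction_on with
          | zero => simp
          | add u v hu hv => simp only [map_add, TensorProduct.tmul_add, hu, hv]
          | tmul a' q' => simp [mul_antipodeLeftTilde]
        refine Eq.trans ?_ (congrArg (fun v => TensorProduct.map (LinearMap.mulLeft k x)
          (LinearMap.mulLeft k c) (TensorProduct.map (antipodeLeftTilde H s⁻¹ s) LinearMap.id
            ((TensorProduct.assoc k _ _ _).symm v))) (leg₁₃_l (R s⁻¹ t) p (a ⊗ₜ q))).symm
        rw [l, hn]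
        clear hn e l
        induction n using TensorProduct.induction_on with
        | zero => simp
        | add u v hu hv => simp only [map_add, add_mul, hu, hv]
        | tmul a' q' => simp
    · clear e
      induction y using TensorProduct.induction_on with
      | zero => simp
      | add u v hu hv => simp only [mul_add, map_add, TensorProduct.tmul_add, hu, hv]
      | tmul p q => simp [mul_antipodeLeftTilde]

theorem isUnit_of_braided (hB : IsBraiding B R) (s t : G) : IsUnit (R s t) :=
  Mult.isUnit_of_bijective (H.nondeg₂ s t) _ (l_bijective_of_braided hB s t)
    (r_surjective_of_braided hB s t)

end CrossedModule

end Invertibility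

end

end TCoalg

theorem theorem4p4 {k G A : Type u} [Field k] [Group G] [DecidableEq G] [NonUnitalRing A]
    [Module k A] [IsScalarTower k A A] [SMulCommClass k A A]
    (H : TCoalg.MultiplierHopfTCoalgebra k G A)
    (R : ∀ p q : G, TCoalg.Mult k (H.C p ⊗[k] H.C q)) :
    (∃ B : CategoryTheory.BraidedCategory (TCoalg.CrossedModule H),
      ∀ (M N : TCoalg.CrossedModule H) (p : G),
        TCoalg.CrossedModule.Hom.app (B.braiding M N).hom p = TCoalg.braid R M N p) ↔
    TCoalg.IsQuasitriangular H R := by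
  refine ⟨fun ⟨B, hB⟩ => ?_, fun hR => ⟨TCoalg.CrossedModule.braidedCategory hR,
    fun _ _ _ => rfl⟩⟩
  exact
    { isUnit := TCoalg.CrossedModule.isUnit_of_braided hB
      invariant := TCoalg.CrossedModule.invariant_of_braided hB
      mul_comul := TCoalg.CrossedModule.mul_comul_of_braided hB
      comul_right := TCoalg.CrossedModule.comul_right_of_braided hB
      comul_left := TCoalg.CrossedModule.comul_left_of_braided hB }
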